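/- Work in the category $\mathrm{SM}$ of (real) supermanifolds: second countable Hausdorff spaces with a sheaf of supercommutative $\mathbb R$-superalgebras locally isomorphic to $\mathbb R^{p|q}=(\mathbb R^p, C^\infty\otimes\Lambda[\theta_1,\dots,\theta_q])$. Let $\mathbb R^{1|1}$ have coordinates $(t,\theta)$ and the group law $(t,\theta)(t',\theta')=(t+t'+\theta\theta',\theta+\theta')$, let $\mathbb Z/2=\{\pm1\}$ act on it by $a\cdot(t,\theta)=(t,a\theta)$, and let $G=\mathbb R^{1|1}\rtimes\mathbb Z/2$; as a supermanifold $G$ is two copies of $\mathbb R^{1|1}$. Let $\omega=dt-\theta\,d\theta$. **Proposition.** (0) For every supermanifold $S$, taking coordinates identifies $G(S)=\mathrm{SM}(S,G)$ with the group of triples $(r,\eta,a)$ of global functions on $S$ with $r$ even, $\eta$ odd, $a$ even and $a^2=1$, under the multiplication $(r',\eta',a')(r,\eta,a)=(r'+r+\eta'a'\eta,\ \eta'+a'\eta,\ a'a)$. (1) For a supermanifold $S$, let $\mathrm{Diff}_\omega(S)$ be the set of diffeomorphisms $\Phi$ of $S\times\mathbb R^{1|1}$ over $S$ with $\Phi^*\omega=\omega$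 as fibrewise $1$-forms over $S$ (that is, as sections of $\operatorname{Coker}(T^*S\to T^*(S\times\mathbb R^{1|1}))$). Then $\mathrm{Diff}_\omega$ is represented by $G$: there are bijections $G(S)\cong\mathrm{Diff}_\omega(S)$, natural in $S$ and taking the product of $G(S)$ to composition of diffeomorphisms, under which $(r,\eta,a)$ corresponds to the standard left action $$(s,t,\theta)\longmapsto\bigl(s,\ (r(s),\eta(s))\cdot(t,a(s)\theta)\bigr)=\bigl(s,\ r+t+\eta a\theta,\ \eta+a\theta\bigr).$$ (2) Let $U\subset\mathbb R^{1|1}$ be a (nonempty) connected domain, and let $\mathrm{Emb}_\omega(U)(S)$ be the set of open embeddings $\Phi\colon S\times U\to S\times\mathbb R^{1|1}$ over $S$ with $\Phi^*\omega=\omega|_U$ as fibrewise $1$-forms over $S$. Then there are bijections $G(S)\cong\mathrm{Emb}_\omega(U)(S)$, natural in $S$, which send $(r,\eta,a)$ to the restriction to $S\times U$ of the diffeomorphism in (1). -/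

import Mathlib

open TopologicalSpace
open scoped ContDiff

/-! ### Supercommutative real algebras -/

/-- A supercommutative superalgebra over `ℝ`: a `ℤ/2`-graded algebra `A = gr 0 ⊕ gr 1` in which
even elements are central and odd elements anticommute. -/
class SuperAlgebra (A : Type) [Ring A] [Algebra ℝ A] where
  gr : ZMod 2 → Submodule ℝ A
  one_mem : (1 : A) ∈ gr 0
  mul_mem : ∀ {i j : ZMod 2} {a b : A}, a ∈ gr i → b ∈ gr j → a * b ∈ gr (i + j)
  isCompl : IsCompl (gr 0) (gr 1)
  even_comm : ∀ {a : A}, a ∈ gr 0 → ∀ b : A, a * b = b * a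
  odd_anticomm : ∀ {a b : A}, a ∈ gr 1 → b ∈ gr 1 → a * b = -(b * a)

open SuperAlgebra (gr)

theorem SuperAlgebra.odd_sq {A : Type} [Ring A] [Algebra ℝ A] [SuperAlgebra A] {a : A}
    (ha : a ∈ gr (A := A) 1) : a * a = 0 := by
  have h : a * a = -(a * a) := SuperAlgebra.odd_anticomm ha ha
  have h2 : (2 : ℝ) • (a * a) = 0 := by
    rw [two_smul]
    nth_rewrite 2 [h]
    exact add_neg_cancel _
  exact (smul_eq_zero.mp h2).resolve_left two_ne_zero

/-! ### Superspaces: spaces with a sheaf of superalgebras -/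

/-- A topological space with a sheaf of supercommutative superalgebras over `ℝ`. -/
structure SuperSpace where
  pt : Type
  [top : TopologicalSpace pt]
  O : Opens pt → Type
  [ring : ∀ U, Ring (O U)]
  [alg : ∀ U, Algebra ℝ (O U)]
  [sup : ∀ U, SuperAlgebra (O U)]
  /-- restriction of sections -/
  res : ∀ {U V : Opens pt}, U ≤ V → (O V →ₐ[ℝ] O U)
  res_gr : ∀ {U V : Opens pt} (h : U ≤ V) (i : ZMod 2) (s : O V),
    s ∈ gr (A := O V) i → res h s ∈ gr (A := O U) i
  res_id : ∀ {U : Opens pt} (s : O U), res le_rfl s = s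
  res_comp : ∀ {U V W : Opens pt} (h : U ≤ V) (k : V ≤ W) (s : O W),
    res h (res k s) = res (h.trans k) s
  /-- sections that agree on overlaps glue uniquely -/
  glue : ∀ {ι : Type} (V : Opens pt) (U : ι → Opens pt) (hU : ∀ i, U i ≤ V)
    (_ : ∀ x ∈ V, ∃ i, x ∈ U i) (s : ∀ i, O (U i)),
    (∀ (i j : ι) (W : Opens pt) (hi : W ≤ U i) (hj : W ≤ U j), res hi (s i) = res hj (s j)) →
    ∃! t : O V, ∀ i, res (hU i) t = s i

attribute [instance] SuperSpace.top SuperSpace.ring SuperSpace.alg SuperSpace.sup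

namespace SuperSpace

/-- A morphism of superspaces: a continuous map together with a morphism of sheaves of
superalgebras over it, recorded by the parity-preserving algebra maps
`O_Y(V) → O_X(U)` for all open `U`, `V` such that `U` is mapped into `V`. -/
structure Hom (X Y : SuperSpace) where
  base : X.pt → Y.pt
  cont : Continuous base
  pull : ∀ (V : Opens Y.pt) (U : Opens X.pt), (∀ x ∈ U, base x ∈ V) → (Y.O V →ₐ[ℝ] X.O U)
  pull_gr : ∀ (V : Opens Y.pt) (U : Opens X.pt) (h : ∀ x ∈ U, base x ∈ V) (i : ZMod 2) (s : Y.O V),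
    s ∈ gr (A := Y.O V) i → pull V U h s ∈ gr (A := X.O U) i
  pull_res : ∀ {V V' : Opens Y.pt} {U U' : Opens X.pt} (hV : V ≤ V') (hU : U' ≤ U)
    (h : ∀ x ∈ U, base x ∈ V) (h' : ∀ x ∈ U', base x ∈ V') (s : Y.O V'),
    X.res hU (pull V U h (Y.res hV s)) = pull V' U' h' s

theorem Hom.ext' {X Y : SuperSpace} {F G : Hom X Y} (hb : F.base = G.base)
    (hp : ∀ V U h h' s, F.pull V U h s = G.pull V U h' s) : F = G := by
  obtain ⟨f, fc, p, pg, pr⟩ := F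
  obtain ⟨g, gc, q, qg, qr⟩ := G
  obtain rfl : f = g := hb
  have : p = q := by
    funext V U h
    exact AlgHom.ext fun s => hp V U h h s
  subst this
  rfl

/-- The preimage of an open set. -/
def Hom.pre {X Y : SuperSpace} (F : Hom X Y) (V : Opens Y.pt) : Opens X.pt :=
  ⟨F.base ⁻¹' V, V.2.preimage F.cont⟩

def Hom.id (X : SuperSpace) : Hom X X where
  base := fun x => x
  cont := continuous_id
  pull V U h := X.res (show U ≤ V from h)
  pull_gr V U h i s hs := X.res_gr _ i s hs
  pull_res hV hU h h' s := by rw [X.res_comp, X.res_comp]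

def Hom.comp {X Y Z : SuperSpace} (F : Hom X Y) (G : Hom Y Z) : Hom X Z where
  base := fun x => G.base (F.base x)
  cont := G.cont.comp F.cont
  pull V U h := (F.pull (G.pre V) U h).comp (G.pull V (G.pre V) fun _ hy => hy)
  pull_gr V U h i s hs := F.pull_gr _ _ _ i _ (G.pull_gr _ _ _ i s hs)
  pull_res {V V' U U'} hV hU h h' s := by
    have hle : G.pre V ≤ G.pre V' := fun y hy => hV hy
    have h1 : G.pull V (G.pre V) (fun _ hy => hy) (Z.res hV s)
        = Y.res hle (G.pull V' (G.pre V') (fun _ hy => hy) s) := by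
      have a := G.pull_res hV le_rfl (fun _ hy => hy) (U := G.pre V) (fun x hx => hV hx) s
      have b := G.pull_res (le_refl V') hle (fun _ hy => hy) (U := G.pre V')
        (fun x hx => hV hx) s
      rw [Y.res_id] at a
      rw [Z.res_id] at b
      rw [a, b]
    change X.res hU (F.pull _ _ _ (G.pull V (G.pre V) _ (Z.res hV s))) = _
    rw [h1]
    exact F.pull_res hle hU h h' _

instance : CategoryTheory.Category SuperSpace where
  Hom := Hom
  id := Hom.id
  comp := Hom.comp
  id_comp F := by
    refine Hom.ext' rfl fun V U h h' s => ?_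
    have a := F.pull_res (le_refl V) (U := F.pre V) (U' := U) h (fun _ hy => hy) h s
    rw [SuperSpace.res_id] at a
    exact a
  comp_id {X Y} F := by
    refine Hom.ext' rfl fun V U h h' s => ?_
    exact congrArg (F.pull V U h') (Y.res_id s)
  assoc {W X Y Z} F G H := Hom.ext' rfl fun V U h h' s => rfl

/-- An open embedding, i.e. an isomorphism onto an open sub-superspace. -/
def Hom.IsOpenEmb {X Y : SuperSpace} (F : Hom X Y) : Prop :=
  Topology.IsOpenEmbedding F.base ∧
    ∀ V : Opens Y.pt, (V : Set Y.pt) ⊆ Set.range F.base →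
      Function.Bijective (F.pull V (F.pre V) fun _ hx => hx)

/-! ### Open subspaces and disjoint unions -/

/-- An open subset of an open subset, as an open subset of the ambient space. -/
def img {X : Type} [TopologicalSpace X] (U : Opens X) (W : Opens U) : Opens X :=
  ⟨Subtype.val '' (W : Set U), U.2.isOpenMap_subtype_val _ W.2⟩

theorem img_mono {X : Type} [TopologicalSpace X] (U : Opens X) {W W' : Opens U} (h : W ≤ W') :
    img U W ≤ img U W' := Set.image_mono h

/-- The open sub-superspace on an open set `U`. -/
def restrict (X : SuperSpace) (U : Opens X.pt) : SuperSpace where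
  pt := U
  O W := X.O (img U W)
  res h := X.res (img_mono U h)
  res_gr h i s hs := X.res_gr _ i s hs
  res_id s := X.res_id s
  res_comp h k s := X.res_comp _ _ s
  glue V C hC hcov s hs := by
    refine X.glue (img U V) (fun i => img U (C i)) (fun i => img_mono U (hC i)) ?_ s ?_
    · rintro _ ⟨x, hx, rfl⟩
      obtain ⟨i, hi⟩ := hcov x hx
      exact ⟨i, x, hi, rfl⟩
    · intro i j W hi hj
      let W' : Opens U := ⟨Subtype.val ⁻¹' (W : Set X.pt), W.2.preimage continuous_subtype_val⟩
      have hWi : W' ≤ C i := by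
        intro x hx
        obtain ⟨y, hy, hyx⟩ := hi (show x.1 ∈ W from hx)
        rwa [← Subtype.ext hyx]
      have hWj : W' ≤ C j := by
        intro x hx
        obtain ⟨y, hy, hyx⟩ := hj (show x.1 ∈ W from hx)
        rwa [← Subtype.ext hyx]
      have hW : W ≤ img U W' := by
        intro x hx
        obtain ⟨y, hy, rfl⟩ := hi hx
        exact ⟨y, hx, rfl⟩
      have e := congrArg (X.res hW) (hs i j W' hWi hWj)
      rw [X.res_comp, X.res_comp] at e
      exact e

/-- The inclusion of an open sub-superspace. -/
def incl (X : SuperSpace) (U : Opens X.pt) : Hom (X.restrict U) X where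
  base := Subtype.val
  cont := continuous_subtype_val
  pull V W h := X.res (show img U W ≤ V by rintro _ ⟨x, hx, rfl⟩; exact h x hx)
  pull_gr V W h i s hs := X.res_gr _ i s hs
  pull_res hV hU h h' s := by
    change X.res _ (X.res _ (X.res _ s)) = X.res _ s
    rw [X.res_comp, X.res_comp]

theorem incl_isOpenEmb (X : SuperSpace) (U : Opens X.pt) : (X.incl U).IsOpenEmb := by
  refine ⟨U.2.isOpenEmbedding_subtypeVal, fun V hV => ?_⟩
  have hle : V ≤ img U ((X.incl U).pre V) := by
    intro x hx
    obtain ⟨y, rfl⟩ := hV hx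
    exact ⟨y, hx, rfl⟩
  have hge : img U ((X.incl U).pre V) ≤ V := by
    rintro _ ⟨x, hx, rfl⟩
    exact hx
  refine Function.bijective_iff_has_inverse.mpr ⟨fun s => X.res hle s, fun s => ?_, fun s => ?_⟩
  · change X.res hle (X.res hge s) = s
    rw [X.res_comp, X.res_id]
  · exact (X.res_comp hge hle s).trans (X.res_id s)

end SuperSpace

instance SuperAlgebra.prod (A B : Type) [Ring A] [Algebra ℝ A] [SuperAlgebra A] [Ring B]
    [Algebra ℝ B] [SuperAlgebra B] : SuperAlgebra (A × B) where
  gr i := (gr (A := A) i).prod (gr (A := B) i)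
  one_mem := ⟨one_mem, one_mem⟩
  mul_mem ha hb := ⟨mul_mem ha.1 hb.1, mul_mem ha.2 hb.2⟩
  isCompl := by
    have hA := SuperAlgebra.isCompl (A := A)
    have hB := SuperAlgebra.isCompl (A := B)
    constructor
    · rw [disjoint_iff, Submodule.prod_inf_prod, hA.inf_eq_bot, hB.inf_eq_bot,
        Submodule.prod_bot]
    · rw [codisjoint_iff, Submodule.prod_sup_prod, hA.sup_eq_top, hB.sup_eq_top,
        Submodule.prod_top]
  even_comm ha b := Prod.ext (even_comm ha.1 b.1) (even_comm ha.2 b.2)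
  odd_anticomm ha hb := Prod.ext (odd_anticomm ha.1 hb.1) (odd_anticomm ha.2 hb.2)

namespace SuperSpace

def preInl {X Y : Type} [TopologicalSpace X] [TopologicalSpace Y] (W : Opens (X ⊕ Y)) : Opens X :=
  ⟨Sum.inl ⁻¹' (W : Set (X ⊕ Y)), W.2.preimage continuous_inl⟩

def preInr {X Y : Type} [TopologicalSpace X] [TopologicalSpace Y] (W : Opens (X ⊕ Y)) : Opens Y :=
  ⟨Sum.inr ⁻¹' (W : Set (X ⊕ Y)), W.2.preimage continuous_inr⟩

theorem preInl_mono {X Y : Type} [TopologicalSpace X] [TopologicalSpace Y] {W W' : Opens (X ⊕ Y)}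
    (h : W ≤ W') : preInl W ≤ preInl W' := fun _ hx => h hx

theorem preInr_mono {X Y : Type} [TopologicalSpace X] [TopologicalSpace Y] {W W' : Opens (X ⊕ Y)}
    (h : W ≤ W') : preInr W ≤ preInr W' := fun _ hx => h hx

/-- The disjoint union of two superspaces. -/
def sum (X Y : SuperSpace) : SuperSpace where
  pt := X.pt ⊕ Y.pt
  O W := X.O (preInl W) × Y.O (preInr W)
  res h := (X.res (preInl_mono h)).prodMap (Y.res (preInr_mono h))
  res_gr h i s hs := Submodule.mem_prod.mpr ⟨X.res_gr _ i _ hs.1, Y.res_gr _ i _ hs.2⟩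
  res_id s := Prod.ext (X.res_id s.1) (Y.res_id s.2)
  res_comp h k s := Prod.ext (X.res_comp _ _ s.1) (Y.res_comp _ _ s.2)
  glue V C hC hcov s hs := by
    obtain ⟨a, ha, hau⟩ := X.glue (preInl V) (fun i => preInl (C i))
      (fun i => preInl_mono (hC i)) (fun x hx => hcov (Sum.inl x) hx) (fun i => (s i).1) (by
        intro i j W hi hj
        let W' : Opens (X.pt ⊕ Y.pt) := ⟨Sum.inl '' (W : Set X.pt), isOpenMap_inl _ W.2⟩
        have e := congrArg Prod.fst (hs i j W' (by rintro _ ⟨x, hx, rfl⟩; exact hi hx)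
          (by rintro _ ⟨x, hx, rfl⟩; exact hj hx))
        have hW : W ≤ preInl W' := fun x hx => ⟨x, hx, rfl⟩
        have e' := congrArg (X.res hW) e
        change X.res _ (X.res _ _) = X.res _ (X.res _ _) at e'
        rw [X.res_comp, X.res_comp] at e'
        exact e')
    obtain ⟨b, hb, hbu⟩ := Y.glue (preInr V) (fun i => preInr (C i))
      (fun i => preInr_mono (hC i)) (fun x hx => hcov (Sum.inr x) hx) (fun i => (s i).2) (by
        intro i j W hi hj
        let W' : Opens (X.pt ⊕ Y.pt) := ⟨Sum.inr '' (W : Set Y.pt), isOpenMap_inr _ W.2⟩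
        have e := congrArg Prod.snd (hs i j W' (by rintro _ ⟨x, hx, rfl⟩; exact hi hx)
          (by rintro _ ⟨x, hx, rfl⟩; exact hj hx))
        have hW : W ≤ preInr W' := fun x hx => ⟨x, hx, rfl⟩
        have e' := congrArg (Y.res hW) e
        change Y.res _ (Y.res _ _) = Y.res _ (Y.res _ _) at e'
        rw [Y.res_comp, Y.res_comp] at e'
        exact e')
    refine ⟨(a, b), fun i => Prod.ext (ha i) (hb i), fun t ht => Prod.ext ?_ ?_⟩
    · exact hau t.1 fun i => congrArg Prod.fst (ht i)
    · exact hbu t.2 fun i => congrArg Prod.snd (ht i)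

def inl (X Y : SuperSpace) : Hom X (X.sum Y) where
  base := Sum.inl
  cont := continuous_inl
  pull V U h := (X.res (show U ≤ preInl V from h)).comp (AlgHom.fst ℝ _ _)
  pull_gr V U h i s hs := X.res_gr _ i _ hs.1
  pull_res hV hU h h' s := by
    change X.res _ (X.res _ (X.res _ s.1)) = X.res _ s.1
    rw [X.res_comp, X.res_comp]

def inr (X Y : SuperSpace) : Hom Y (X.sum Y) where
  base := Sum.inr
  cont := continuous_inr
  pull V U h := (Y.res (show U ≤ preInr V from h)).comp (AlgHom.snd ℝ _ _)
  pull_gr V U h i s hs := Y.res_gr _ i _ hs.2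
  pull_res hV hU h h' s := by
    change Y.res _ (Y.res _ (Y.res _ s.2)) = Y.res _ s.2
    rw [Y.res_comp, Y.res_comp]

theorem subsingleton_of_empty (X : SuperSpace) (U : Opens X.pt) (hU : ∀ x, x ∉ U) :
    Subsingleton (X.O U) := by
  obtain ⟨t, -, ht⟩ := X.glue (ι := Empty) U (fun i => i.elim) (fun i => i.elim)
    (fun x hx => absurd hx (hU x)) (fun i => i.elim) (fun i => i.elim)
  exact ⟨fun a b => (ht a fun i => i.elim).trans (ht b fun i => i.elim).symm⟩

theorem inl_isOpenEmb (X Y : SuperSpace) : (X.inl Y).IsOpenEmb := by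
  refine ⟨Topology.IsOpenEmbedding.inl, fun V hV => ?_⟩
  have hs : Subsingleton (Y.O (preInr V)) := Y.subsingleton_of_empty _ fun y hy => by
    obtain ⟨x, hx⟩ := hV hy
    cases hx
  refine Function.bijective_iff_has_inverse.mpr ⟨fun s => (s, 0), fun s => ?_, fun s => ?_⟩
  · exact Prod.ext (X.res_id s.1) (Subsingleton.elim _ _)
  · exact X.res_id s

theorem inr_isOpenEmb (X Y : SuperSpace) : (X.inr Y).IsOpenEmb := by
  refine ⟨Topology.IsOpenEmbedding.inr, fun V hV => ?_⟩
  have hs : Subsingleton (X.O (preInl V)) := X.subsingleton_of_empty _ fun y hy => by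
    obtain ⟨x, hx⟩ := hV hy
    cases hx
  refine Function.bijective_iff_has_inverse.mpr ⟨fun s => (0, s), fun s => ?_, fun s => ?_⟩
  · exact Prod.ext (Subsingleton.elim _ _) (Y.res_id s.2)
  · exact Y.res_id s

theorem Hom.IsOpenEmb.comp {X Y Z : SuperSpace} {F : Hom X Y} {G : Hom Y Z} (hF : F.IsOpenEmb)
    (hG : G.IsOpenEmb) : (F.comp G).IsOpenEmb := by
  refine ⟨hG.1.comp hF.1, fun V hV => ?_⟩
  have h1 : (V : Set Z.pt) ⊆ Set.range G.base := fun z hz => by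
    obtain ⟨x, rfl⟩ := hV hz
    exact ⟨F.base x, rfl⟩
  have h2 : ((G.pre V : Opens Y.pt) : Set Y.pt) ⊆ Set.range F.base := fun y hy => by
    obtain ⟨x, hx⟩ := hV (show G.base y ∈ (V : Set Z.pt) from hy)
    exact ⟨x, hG.1.injective hx⟩
  exact (hF.2 _ h2).comp (hG.2 V h1)

end SuperSpace

/-! ### The model superspaces `ℝ^{p|q}` -/

/-- The Grassmann algebra on `q` generators. -/
abbrev Grass (q : ℕ) : Type := ExteriorAlgebra ℝ (Fin q → ℝ)

/-- Its even (`i = 0`) and odd (`i = 1`) parts. -/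
abbrev Grass.part (q : ℕ) (i : ZMod 2) : Submodule ℝ (Grass q) :=
  CliffordAlgebra.evenOdd (0 : QuadraticForm ℝ (Fin q → ℝ)) i

instance Grass.superAlgebra (q : ℕ) : SuperAlgebra (Grass q) where
  gr := Grass.part q
  one_mem := SetLike.GradedOne.one_mem
  mul_mem ha hb := SetLike.GradedMul.mul_mem ha hb
  isCompl := CliffordAlgebra.evenOdd_isCompl _
  even_comm := by
    intro a ha b
    have hb : b ∈ Grass.part q 0 ⊔ Grass.part q 1 := by
      rw [(CliffordAlgebra.evenOdd_isCompl _).sup_eq_top]; trivial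
    obtain ⟨b0, h0, b1, h1, rfl⟩ := Submodule.mem_sup.mp hb
    have key : ∀ {i : ZMod 2} {c : Grass q}, c ∈ Grass.part q i → a * c = c * a := by
      intro i c hc
      have := CliffordAlgebra.commute_map_mul_map_of_isOrtho_of_mem_evenOdd_zero_left
        (QuadraticMap.Isometry.id (0 : QuadraticForm ℝ (Fin q → ℝ)))
        (QuadraticMap.Isometry.id 0) (fun x y => by simp [QuadraticMap.IsOrtho]) a c ha hc
      simpa [CliffordAlgebra.map_id] using this.eq
    rw [mul_add, add_mul, key h0, key h1]
  odd_anticomm := by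
    intro a b ha hb
    have := CliffordAlgebra.map_mul_map_eq_neg_of_isOrtho_of_mem_evenOdd_one
        (QuadraticMap.Isometry.id (0 : QuadraticForm ℝ (Fin q → ℝ)))
        (QuadraticMap.Isometry.id 0) (fun x y => by simp [QuadraticMap.IsOrtho]) a b ha hb
    simpa [CliffordAlgebra.map_id] using this

section Model

variable (E : Type) [NormedAddCommGroup E] [NormedSpace ℝ E]

open Classical in
/-- Extension by zero of a function on an open set. -/
noncomputable def extZero {E : Type} [NormedAddCommGroup E] [NormedSpace ℝ E] {q : ℕ}
    {W : Opens E} (f : W → Grass q) : E → Grass q :=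
  fun y => if h : y ∈ W then f ⟨y, h⟩ else 0

/-- Smoothness of a function with values in the finite-dimensional space `Grass q`. -/
def IsSmoothSection {E : Type} [NormedAddCommGroup E] [NormedSpace ℝ E] {q : ℕ}
    {W : Opens E} (f : W → Grass q) : Prop :=
  ∀ l : Grass q →ₗ[ℝ] ℝ, ∀ x ∈ W, ContDiffAt ℝ ∞ (fun y => l (extZero f y)) x

variable {E} {q : ℕ}

theorem extZero_apply {W : Opens E} (f : W → Grass q) {y : E} (h : y ∈ W) :
    extZero f y = f ⟨y, h⟩ := by
  simp [extZero, h]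

theorem IsSmoothSection.congr {W : Opens E} {f : W → Grass q}
    (h : ∀ l : Grass q →ₗ[ℝ] ℝ, ∀ x ∈ W, ∃ g : E → ℝ, ContDiffAt ℝ ∞ g x ∧
      ∀ᶠ y in nhds x, ∀ hy : y ∈ W, l (f ⟨y, hy⟩) = g y) : IsSmoothSection f := by
  intro l x hx
  obtain ⟨g, hg, he⟩ := h l x hx
  refine hg.congr_of_eventuallyEq ?_
  filter_upwards [he, W.2.mem_nhds hx] with y hy hyW
  rw [extZero_apply f hyW, hy hyW]

variable (E q)

/-- The superalgebra `C^∞(W) ⊗ Λ[θ₁, …, θ_q]`, as the smooth functions `W → Λ[θ₁, …, θ_q]`. -/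
noncomputable def smoothSections (W : Opens E) : Subalgebra ℝ (W → Grass q) where
  carrier := {f | IsSmoothSection f}
  add_mem' {f g} hf hg := IsSmoothSection.congr fun l x hx =>
    ⟨_, (hf l x hx).add (hg l x hx), Filter.Eventually.of_forall fun y hy => by
      simp [extZero_apply _ hy]⟩
  mul_mem' {f g} hf hg := IsSmoothSection.congr fun l x hx => by
    let b := (Pi.basisFun ℝ (Fin q)).ExteriorAlgebra
    refine ⟨fun y => ∑ i, ∑ j, (b.coord i (extZero f y) * b.coord j (extZero g y)) *
      l (b i * b j), ?_, Filter.Eventually.of_forall fun y hy => ?_⟩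
    · exact ContDiffAt.sum fun i _ => ContDiffAt.sum fun j _ =>
        ((hf (b.coord i) x hx).mul (hg (b.coord j) x hx)).mul contDiffAt_const
    · beta_reduce
      rw [extZero_apply _ hy, extZero_apply _ hy, Pi.mul_apply]
      conv_lhs => rw [← b.sum_repr (f ⟨y, hy⟩), ← b.sum_repr (g ⟨y, hy⟩)]
      simp only [Finset.sum_mul_sum, map_sum, smul_mul_smul_comm, map_smul, smul_eq_mul,
        Module.Basis.coord_apply]
  algebraMap_mem' r := IsSmoothSection.congr fun l x hx =>
    ⟨fun _ => l (algebraMap ℝ _ r), contDiffAt_const, Filter.Eventually.of_forall fun _ _ => rfl⟩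

variable {E q}

/-- Parity is detected pointwise. -/
noncomputable instance smoothSections.superAlgebra (W : Opens E) :
    SuperAlgebra (smoothSections E q W) where
  gr i :=
    { carrier := {f | ∀ x, f.1 x ∈ Grass.part q i}
      add_mem' := fun hf hg x => add_mem (hf x) (hg x)
      zero_mem' := fun x => zero_mem _
      smul_mem' := fun r f hf x => Submodule.smul_mem _ r (hf x) }
  one_mem := fun x => (Grass.superAlgebra q).one_mem
  mul_mem ha hb := fun x => (Grass.superAlgebra q).mul_mem (ha x) (hb x)
  isCompl := by
    have hC : IsCompl (Grass.part q 0) (Grass.part q 1) := CliffordAlgebra.evenOdd_isCompl _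
    constructor
    · rw [Submodule.disjoint_def]
      intro f h0 h1
      exact Subtype.ext (funext fun x => Submodule.disjoint_def.mp hC.disjoint _ (h0 x) (h1 x))
    · rw [codisjoint_iff, eq_top_iff]
      intro f _
      have sm : ∀ P : Grass q →ₗ[ℝ] Grass q, IsSmoothSection fun x => P (f.1 x) := fun P =>
        IsSmoothSection.congr fun l x hx => ⟨_, f.2 (l.comp P) x hx,
          Filter.Eventually.of_forall fun y hy => by simp [extZero_apply _ hy]⟩
      refine Submodule.mem_sup.mpr ⟨⟨_, sm (Submodule.projection _ _ hC)⟩, fun x => ?_,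
        ⟨_, sm (Submodule.projection _ _ hC.symm)⟩, fun x => ?_, Subtype.ext (funext fun x => ?_)⟩
      · exact Submodule.projection_apply_mem hC _
      · exact Submodule.projection_apply_mem hC.symm _
      · exact Submodule.projection_add_projection_eq_self hC _
  even_comm ha b := Subtype.ext (funext fun x => (Grass.superAlgebra q).even_comm (ha x) _)
  odd_anticomm ha hb :=
    Subtype.ext (funext fun x => (Grass.superAlgebra q).odd_anticomm (ha x) (hb x))

variable (E q)

/-- The superspace `E^{|q}`; for `E = ℝ^p` this is `ℝ^{p|q}`: the space `E` with the sheaf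
`C^∞ ⊗ Λ[θ₁, …, θ_q]`. -/
noncomputable def modelSpace : SuperSpace where
  pt := E
  O W := smoothSections E q W
  res {U V} h :=
    { toFun := fun f => ⟨fun x => f.1 ⟨x.1, h x.2⟩, IsSmoothSection.congr fun l x hx =>
        ⟨_, f.2 l x (h hx), Filter.Eventually.of_forall fun y hy => by
          simp [extZero_apply _ (h hy)]⟩⟩
      map_one' := rfl
      map_mul' := fun _ _ => rfl
      map_zero' := rfl
      map_add' := fun _ _ => rfl
      commutes' := fun _ => rfl }
  res_gr {U V} h i s hs := by
    have hs' : ∀ x : V, s.1 x ∈ Grass.part q i := hs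
    exact fun x : U => hs' ⟨x.1, h x.2⟩
  res_id s := rfl
  res_comp h k s := rfl
  glue {ι} V U hU hcov s hs := by
    choose c hc using hcov
    have agree : ∀ (i j : ι) (y : E) (hi : y ∈ U i) (hj : y ∈ U j),
        (s i).1 ⟨y, hi⟩ = (s j).1 ⟨y, hj⟩ := fun i j y hi hj =>
      congrFun (congrArg Subtype.val (hs i j (U i ⊓ U j) inf_le_left inf_le_right)) ⟨y, hi, hj⟩
    refine ⟨⟨fun x => (s (c x.1 x.2)).1 ⟨x.1, hc x.1 x.2⟩, IsSmoothSection.congr fun l x hx => ?_⟩,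
      fun i => Subtype.ext (funext fun x => agree _ _ _ _ _), fun t ht => Subtype.ext (funext
        fun x => ?_)⟩
    · refine ⟨_, (s (c x hx)).2 l x (hc x hx), ?_⟩
      filter_upwards [(U (c x hx)).2.mem_nhds (hc x hx)] with y hy hyV
      refine Eq.trans ?_ (congrArg l (extZero_apply _ hy)).symm
      exact congrArg l (agree _ _ _ _ _)
    · exact congrFun (congrArg Subtype.val (ht (c x.1 x.2))) ⟨x.1, hc x.1 x.2⟩

end Model

/-! ### The category of supermanifolds -/

/-- A supermanifold: a second countable Hausdorff superspace which is locally isomorphic to open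
sub-superspaces of the models `ℝ^{p|q}`. -/
structure SuperMfd where
  X : SuperSpace
  [t2 : T2Space X.pt]
  [sc : SecondCountableTopology X.pt]
  chart : ∀ x : X.pt, ∃ (E : Type) (_ : NormedAddCommGroup E) (_ : NormedSpace ℝ E)
    (_ : FiniteDimensional ℝ E) (q : ℕ) (U : Opens (modelSpace E q).pt)
    (φ : SuperSpace.Hom ((modelSpace E q).restrict U) X), φ.IsOpenEmb ∧ x ∈ Set.range φ.base

instance : CategoryTheory.Category SuperMfd where
  Hom M N := SuperSpace.Hom M.X N.X
  id M := SuperSpace.Hom.id M.X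
  comp F G := SuperSpace.Hom.comp F G
  id_comp {M N} F := CategoryTheory.Category.id_comp (obj := SuperSpace) (X := M.X) (Y := N.X) F
  comp_id {M N} F := CategoryTheory.Category.comp_id (obj := SuperSpace) (X := M.X) (Y := N.X) F
  assoc {M N P Q} F G H := CategoryTheory.Category.assoc (obj := SuperSpace)
    (W := M.X) (X := N.X) (Y := P.X) (Z := Q.X) F G H

namespace SuperMfd

open CategoryTheory CategoryTheory.Limits

/-- Global functions on a supermanifold. -/
abbrev Fun (M : SuperMfd) : Type := M.X.O ⊤

/-- Pullback of global functions. -/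
def pullback {M N : SuperMfd} (F : M ⟶ N) : N.Fun →ₐ[ℝ] M.Fun :=
  SuperSpace.Hom.pull F ⊤ ⊤ fun _ _ => trivial

theorem pullback_gr {M N : SuperMfd} (F : M ⟶ N) (i : ZMod 2) (s : N.Fun)
    (hs : s ∈ gr (A := N.Fun) i) : pullback F s ∈ gr (A := M.Fun) i :=
  SuperSpace.Hom.pull_gr F ⊤ ⊤ _ i s hs

/-- Open embeddings of supermanifolds. -/
def IsOpenEmb {M N : SuperMfd} (F : M ⟶ N) : Prop := SuperSpace.Hom.IsOpenEmb F

/-- The underlying superspace of `ℝ^{1|1}`. -/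
noncomputable abbrev R11space : SuperSpace := modelSpace ℝ 1

/-- The supermanifold `ℝ^{1|1}`. -/
noncomputable def R11 : SuperMfd where
  X := R11space
  t2 := inferInstanceAs (T2Space ℝ)
  sc := inferInstanceAs (SecondCountableTopology ℝ)
  chart x := ⟨ℝ, inferInstance, inferInstance, inferInstance, 1, ⊤, SuperSpace.incl R11space ⊤,
    SuperSpace.incl_isOpenEmb _ _, ⟨⟨x, trivial⟩, rfl⟩⟩

/-- The domain in `ℝ^{1|1}` with underlying open set `U ⊆ ℝ`. -/
noncomputable def dom (U : Opens ℝ) : SuperMfd where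
  X := R11space.restrict U
  t2 := inferInstanceAs (T2Space U)
  sc := inferInstanceAs (SecondCountableTopology U)
  chart x := ⟨ℝ, inferInstance, inferInstance, inferInstance, 1, U,
    SuperSpace.Hom.id _, ⟨Topology.IsOpenEmbedding.id, fun _ _ =>
      Function.bijective_iff_has_inverse.mpr ⟨fun s => s, fun s => SuperSpace.res_id _ s,
        fun s => SuperSpace.res_id _ s⟩⟩, ⟨x, rfl⟩⟩

/-- The inclusion of a domain. -/
noncomputable def domIncl (U : Opens ℝ) : dom U ⟶ R11 := SuperSpace.incl R11space U

/-- The supermanifold underlying the super Lie group `ℝ^{1|1} ⋊ ℤ/2`: two copies of `ℝ^{1|1}`,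
the left one being the component of the unit of `ℤ/2 = {1, -1}`. -/
noncomputable def IsomR11 : SuperMfd where
  X := R11space.sum R11space
  t2 := inferInstanceAs (T2Space (ℝ ⊕ ℝ))
  sc := inferInstanceAs (SecondCountableTopology (ℝ ⊕ ℝ))
  chart x := by
    refine ⟨ℝ, inferInstance, inferInstance, inferInstance, 1, ⊤, ?_⟩
    rcases x with x | x
    · exact ⟨(SuperSpace.incl R11space ⊤).comp (SuperSpace.inl _ _),
        (SuperSpace.incl_isOpenEmb _ _).comp (SuperSpace.inl_isOpenEmb _ _),
        ⟨⟨x, trivial⟩, rfl⟩⟩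
    · exact ⟨(SuperSpace.incl R11space ⊤).comp (SuperSpace.inr _ _),
        (SuperSpace.incl_isOpenEmb _ _).comp (SuperSpace.inr_isOpenEmb _ _),
        ⟨⟨x, trivial⟩, rfl⟩⟩

/-- A product of `S` and `U` in the category of supermanifolds (unique up to unique isomorphism),
regarded as the trivial `S`-family with fibre `U`. -/
structure Prd (S U : SuperMfd) where
  tot : SuperMfd
  fst : tot ⟶ S
  snd : tot ⟶ U
  isProd : Nonempty (IsLimit (BinaryFan.mk fst snd))

end SuperMfd

/-! ### The groups of `A`-points of `ℝ^{1|1}`, `ℤ/2` and `ℝ^{1|1} ⋊ ℤ/2` -/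

section Points

variable (A : Type) [Ring A] [Algebra ℝ A] [SuperAlgebra A]

/-- Points of `ℝ^{1|1}` with coordinates in `A`: pairs of an even and an odd element. -/
@[ext]
structure R11Pt where
  t : A
  θ : A
  even : t ∈ gr (A := A) 0
  odd : θ ∈ gr (A := A) 1

/-- Points of `ℤ/2 = {1, -1}`: even elements of square one. -/
@[ext]
structure SignPt where
  val : A
  even : val ∈ gr (A := A) 0
  sq : val * val = 1

variable {A}

/-- `(t, θ) (t', θ') = (t + t' + θ θ', θ + θ')`. -/
instance R11Pt.group : Group (R11Pt A) where
  mul x y := ⟨x.t + y.t + x.θ * y.θ, x.θ + y.θ,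
    add_mem (add_mem x.even y.even) (SuperAlgebra.mul_mem x.odd y.odd), add_mem x.odd y.odd⟩
  one := ⟨0, 0, zero_mem _, zero_mem _⟩
  inv x := ⟨-x.t, -x.θ, neg_mem x.even, neg_mem x.odd⟩
  mul_assoc x y z := by
    refine R11Pt.ext ?_ (add_assoc _ _ _)
    change x.t + y.t + x.θ * y.θ + z.t + (x.θ + y.θ) * z.θ
      = x.t + (y.t + z.t + y.θ * z.θ) + x.θ * (y.θ + z.θ)
    noncomm_ring
  one_mul x := by
    refine R11Pt.ext ?_ (zero_add _)
    change 0 + x.t + 0 * x.θ = x.t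
    simp
  mul_one x := by
    refine R11Pt.ext ?_ (add_zero _)
    change x.t + 0 + x.θ * 0 = x.t
    simp
  inv_mul_cancel x := by
    refine R11Pt.ext ?_ (neg_add_cancel _)
    change -x.t + x.t + -x.θ * x.θ = 0
    rw [neg_mul, SuperAlgebra.odd_sq x.odd]
    simp

instance SignPt.group : Group (SignPt A) where
  mul a b := ⟨a.val * b.val, by simpa using SuperAlgebra.mul_mem a.even b.even, by
    rw [mul_assoc, SuperAlgebra.even_comm b.even (a.val * b.val), mul_assoc a.val b.val, b.sq,
      mul_one, a.sq]⟩
  one := ⟨1, SuperAlgebra.one_mem, one_mul 1⟩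
  inv a := a
  mul_assoc a b c := SignPt.ext (mul_assoc _ _ _)
  one_mul a := SignPt.ext (one_mul _)
  mul_one a := SignPt.ext (mul_one _)
  inv_mul_cancel a := SignPt.ext a.sq

/-- `ℤ/2` acts on `ℝ^{1|1}` by `a · (t, θ) = (t, a θ)`. -/
def R11Pt.flip : SignPt A →* MulAut (R11Pt A) where
  toFun a :=
    { toFun := fun x => ⟨x.t, a.val * x.θ, x.even, by
        simpa using SuperAlgebra.mul_mem a.even x.odd⟩
      invFun := fun x => ⟨x.t, a.val * x.θ, x.even, by
        simpa using SuperAlgebra.mul_mem a.even x.odd⟩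
      left_inv := fun x => R11Pt.ext rfl (by
        change a.val * (a.val * x.θ) = x.θ
        rw [← mul_assoc, a.sq, one_mul])
      right_inv := fun x => R11Pt.ext rfl (by
        change a.val * (a.val * x.θ) = x.θ
        rw [← mul_assoc, a.sq, one_mul])
      map_mul' := fun x y => R11Pt.ext (by
        change x.t + y.t + x.θ * y.θ = x.t + y.t + a.val * x.θ * (a.val * y.θ)
        rw [SuperAlgebra.even_comm a.even x.θ, mul_assoc, ← mul_assoc a.val a.val, a.sq, one_mul])
        (mul_add _ _ _) }
  map_one' := MulEquiv.ext fun x => R11Pt.ext rfl (one_mul _)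
  map_mul' a b := MulEquiv.ext fun x => R11Pt.ext rfl (mul_assoc _ _ _)

variable (A) in
/-- Points of `ℝ^{1|1} ⋊ ℤ/2`. -/
abbrev IsomPt : Type := R11Pt A ⋊[R11Pt.flip] SignPt A

/-- The standard left action of `ℝ^{1|1} ⋊ ℤ/2` on `ℝ^{1|1}`: `ℤ/2` acts by negating `θ`, and
`ℝ^{1|1}` by left multiplication. -/
instance IsomPt.action : MulAction (IsomPt A) (R11Pt A) where
  smul g x := g.left * R11Pt.flip g.right x
  one_smul x := by
    change (1 : R11Pt A) * R11Pt.flip (1 : SignPt A) x = x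
    simp
  mul_smul g h x := by
    change g.left * R11Pt.flip g.right h.left * R11Pt.flip (g.right * h.right) x
      = g.left * R11Pt.flip g.right (h.left * R11Pt.flip h.right x)
    simp [mul_assoc]

variable {B : Type} [Ring B] [Algebra ℝ B] [SuperAlgebra B]

/-- Functoriality of the points of `ℝ^{1|1}`. -/
def R11Pt.map (f : A →ₐ[ℝ] B) (hf : ∀ i, ∀ a ∈ gr (A := A) i, f a ∈ gr (A := B) i)
    (x : R11Pt A) : R11Pt B :=
  ⟨f x.t, f x.θ, hf 0 _ x.even, hf 1 _ x.odd⟩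

/-- Functoriality of the points of `ℤ/2`. -/
def SignPt.map (f : A →ₐ[ℝ] B) (hf : ∀ i, ∀ a ∈ gr (A := A) i, f a ∈ gr (A := B) i)
    (a : SignPt A) : SignPt B :=
  ⟨f a.val, hf 0 _ a.even, by rw [← map_mul, a.sq, map_one]⟩

/-- Functoriality of the points of `ℝ^{1|1} ⋊ ℤ/2`. -/
def IsomPt.map (f : A →ₐ[ℝ] B) (hf : ∀ i, ∀ a ∈ gr (A := A) i, f a ∈ gr (A := B) i)
    (g : IsomPt A) : IsomPt B :=
  ⟨R11Pt.map f hf g.left, SignPt.map f hf g.right⟩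

end Points

namespace SuperMfd

open CategoryTheory CategoryTheory.Limits

/-- The standard coordinates `(t, θ)` on `ℝ^{1|1}`. -/
noncomputable def stdCoords : R11Pt R11.Fun where
  t := ⟨fun x => algebraMap ℝ (Grass 1) x.1, IsSmoothSection.congr fun l x _ =>
    ⟨fun y => y * l 1, contDiffAt_id.mul contDiffAt_const, Filter.Eventually.of_forall fun y _ => by
      rw [Algebra.algebraMap_eq_smul_one, map_smul, smul_eq_mul]⟩⟩
  θ := ⟨fun _ => ExteriorAlgebra.ι ℝ (fun _ => 1), IsSmoothSection.congr fun l x _ =>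
    ⟨fun _ => l (ExteriorAlgebra.ι ℝ (fun _ => 1)), contDiffAt_const,
      Filter.Eventually.of_forall fun _ _ => rfl⟩⟩
  even := fun x => (Algebra.algebraMap_eq_smul_one (A := Grass 1) x.1).symm ▸
    Submodule.smul_mem _ _ (Grass.superAlgebra 1).one_mem
  odd := fun x => CliffordAlgebra.ι_mem_evenOdd_one _ _

/-- The standard coordinates on `ℝ^{1|1} ⋊ ℤ/2`: `(t, θ)` on both components, and the sign `1`
on the left and `-1` on the right component. -/
noncomputable def stdIsomCoords : IsomPt IsomR11.Fun where
  left := ⟨(stdCoords.t, stdCoords.t), (stdCoords.θ, stdCoords.θ),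
    ⟨stdCoords.even, stdCoords.even⟩, ⟨stdCoords.odd, stdCoords.odd⟩⟩
  right := ⟨((1 : R11.Fun), (-1 : R11.Fun)),
    ⟨SuperAlgebra.one_mem, neg_mem SuperAlgebra.one_mem⟩,
    Prod.ext (one_mul (1 : R11.Fun)) (by
      change (-1 : R11.Fun) * (-1 : R11.Fun) = 1
      rw [neg_mul_neg, one_mul])⟩

/-- The coordinates of a map to `ℝ^{1|1}`. -/
noncomputable def coords {T : SuperMfd} (F : T ⟶ R11) : R11Pt T.Fun :=
  R11Pt.map (pullback F) (pullback_gr F) stdCoords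

/-- The coordinates `(r, η, a)` of a map to `ℝ^{1|1} ⋊ ℤ/2`. -/
noncomputable def isomCoords {T : SuperMfd} (g : T ⟶ IsomR11) : IsomPt T.Fun :=
  IsomPt.map (pullback g) (pullback_gr g) stdIsomCoords

/-! ### Fibrewise differential forms -/

/-- A homogeneous vertical vector field of parity `i` on the open set `W ⊆ P`, for `π : P ⟶ S`:
a derivation of parity `i` of the sheaf of superalgebras `O_P|_W` which kills the functions
pulled back from `S`. -/
structure VField {P S : SuperMfd} (π : P ⟶ S) (W : Opens P.X.pt) (i : ZMod 2) where
  D : ∀ V : Opens P.X.pt, V ≤ W → (P.X.O V →ₗ[ℝ] P.X.O V)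
  D_res : ∀ {V V' : Opens P.X.pt} (h : V ≤ V') (h' : V' ≤ W) (f : P.X.O V'),
    P.X.res h (D V' h' f) = D V (h.trans h') (P.X.res h f)
  D_gr : ∀ (V : Opens P.X.pt) (h : V ≤ W) (j : ZMod 2) (f : P.X.O V),
    f ∈ gr (A := P.X.O V) j → D V h f ∈ gr (A := P.X.O V) (i + j)
  leibniz : ∀ (V : Opens P.X.pt) (h : V ≤ W) (j : ZMod 2) (f g : P.X.O V),
    f ∈ gr (A := P.X.O V) j →
      D V h (f * g) = D V h f * g + (-1 : ℝ) ^ (i.val * j.val) • (f * D V h g)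
  vert : ∀ (V : Opens P.X.pt) (h : V ≤ W) (T : Opens S.X.pt)
    (hT : ∀ x ∈ V, SuperSpace.Hom.base π x ∈ T) (f : S.X.O T),
    D V h (SuperSpace.Hom.pull π T V hT f) = 0

/-- Fibrewise `1`-forms on `π : P ⟶ S` are dual to vertical vector fields. A form is recorded
here through all its contractions `⟨X, α⟩` with homogeneous vertical vector fields `X` on open
subsets, so that two forms agree if and only if they have the same contractions. -/
abbrev Contr {P S : SuperMfd} (π : P ⟶ S) : Type :=
  ∀ (W : Opens P.X.pt) (i : ZMod 2), VField π W i → P.X.O W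

/-- The fibrewise differential of a function: `⟨X, df⟩ = X f`. -/
def dRel {P S : SuperMfd} (π : P ⟶ S) (f : P.Fun) : Contr π :=
  fun W _ X => X.D W le_rfl (P.X.res le_top f)

/-- Left multiplication of a form by a function of parity `j`:
`⟨X, f α⟩ = (-1)^{|X| |f|} f ⟨X, α⟩`. -/
def fmul {P S : SuperMfd} (π : P ⟶ S) (j : ZMod 2) (f : P.Fun) (α : Contr π) : Contr π :=
  fun W i X => (-1 : ℝ) ^ (i.val * j.val) • (P.X.res le_top f * α W i X)

/-- The fibrewise form `F^* ω = d(F^* t) - F^* θ d(F^* θ)` on `P` over `S`, where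
`ω = dt - θ dθ` on `ℝ^{1|1}` and `F : P ⟶ ℝ^{1|1}`. -/
noncomputable def pullω {P S : SuperMfd} (π : P ⟶ S) (F : P ⟶ R11) : Contr π :=
  dRel π (coords F).t - fmul π 1 (coords F).θ (dRel π (coords F).θ)

/-! ### Families of `ω`-preserving diffeomorphisms and embeddings -/

/-- `S`-families of diffeomorphisms of `ℝ^{1|1}` that preserve `ω`: diffeomorphisms `Φ` of
`P = S × ℝ^{1|1}` over `S` with `Φ^* ω = ω` as fibrewise forms. -/
structure DiffFam {S : SuperMfd} (P : Prd S R11) where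
  Φ : P.tot ≅ P.tot
  fibred : Φ.hom ≫ P.fst = P.fst
  pres : pullω P.fst (Φ.hom ≫ P.snd) = pullω P.fst P.snd

/-- `S`-families of embeddings of the domain `U` in `ℝ^{1|1}` that preserve `ω`: (open) embeddings
`Φ : S × U ⟶ S × ℝ^{1|1}` over `S` with `Φ^* ω = ω|_U` as fibrewise forms. -/
structure EmbFam {S : SuperMfd} {U : Opens ℝ} (Q : Prd S (dom U)) (P : Prd S R11) where
  Φ : Q.tot ⟶ P.tot
  fibred : Φ ≫ P.fst = Q.fst
  emb : IsOpenEmb Φ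
  pres : pullω Q.fst (Φ ≫ P.snd) = pullω Q.fst (Q.snd ≫ domIncl U)

/-- The group element `g` at `S`, as an element at `P` by base change along `π : P ⟶ S`. -/
noncomputable def baseIsom {P S : SuperMfd} (π : P ⟶ S) (g : S ⟶ IsomR11) : IsomPt P.Fun :=
  IsomPt.map (pullback π) (pullback_gr π) (isomCoords g)

end SuperMfd

/-!
The proposition comes down to a short computation on `S × ℝ^{1|1}`, `const_of_preserves_form`. Over a
chart of `S`, write `t'` and `θ'` for the coordinates of a map to `ℝ^{1|1}` and contract the equation
`dt' - θ' dθ' = dt - θ dθ` with the vertical vector fields `∂/∂t` and `∂/∂θ`: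
`∂t'/∂t - θ' ∂θ'/∂t = 1` and `∂t'/∂θ + θ' ∂θ'/∂θ = θ`. Applying `∂/∂θ` to the second equation gives
`a² = 1` for `a = ∂θ'/∂θ`. Applying `∂/∂t` to the second and `∂/∂θ` to the first gives
`2 a ∂θ'/∂t = 0`, so that `∂θ'/∂t = 0` since `a` is invertible. It follows that `a`,
`η = θ' - aθ` and `r = t' - t - ηaθ` are killed by both vector fields. When the fibres are connected,
such functions come from `S` (`BoxChart.exists_pullFst_eq`), and the map is the translate of the
identity by `(r, η, a)`. The three functions are determined by the map because `1` and `θ` are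
linearly independent over the functions on `S` (`Translates.unique`); hence the local solutions glue
(`exists_translates`). Conversely, translates preserve the form (`pullω_eq_of_coords_eq_smul`). That
families of translates of a domain are open embeddings needs only that translates are invertible and
that `S × U ⟶ S × ℝ^{1|1}` is an open embedding (`isOpenEmb_prod`).

To speak of translates, maps to `ℝ^{1|1}` have to correspond to pairs of an even and an odd function,
and maps to the group to triples (`isomCoords_injective`, `isomCoords_surjective`). More generally, maps
to `E^{|q}` correspond to their coordinates.
* Uniqueness (`hom_model_ext`): by Hadamard's lemma, two algebra maps from germs of superfunctions to a
  Grassmann algebra which agree on the coordinates agree modulo every power of the augmentation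
  ideal, and this ideal is nilpotent (`smoothSections.germ_hom_unique`).
* Existence (`exists_hom_model`): a superfunction is evaluated at superfunctions by its Taylor
  expansion in their nilpotent parts, which is the exponential of a nilpotent derivation and therefore
  multiplicative (`smoothSections.evalAt`). The maps obtained in charts glue by uniqueness.

The group has two components, and a function `a` with `a² = 1` is locally `1` or `-1`. Products in the
category are only given by their universal property; `nonempty_boxChart` provides them with charts
in which the projections are the standard ones.
-/

/-! ### Morphisms of superspaces -/

namespace SuperSpace

variable {X Y Z : SuperSpace}

theorem Hom.res_pull (F : Hom X Y) {V : Opens Y.pt} {U U' : Opens X.pt} (hU : U' ≤ U)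
    (h : ∀ x ∈ U, F.base x ∈ V) (s : Y.O V) :
    X.res hU (F.pull V U h s) = F.pull V U' (fun x hx => h x (hU hx)) s := by
  have := F.pull_res (le_refl V) hU h (fun x hx => h x (hU hx)) s
  rwa [Y.res_id] at this

theorem Hom.pull_res' (F : Hom X Y) {V V' : Opens Y.pt} {U : Opens X.pt} (hV : V ≤ V')
    (h : ∀ x ∈ U, F.base x ∈ V) (s : Y.O V') :
    F.pull V U h (Y.res hV s) = F.pull V' U (fun x hx => hV (h x hx)) s := by
  have := F.pull_res hV (le_refl U) h (fun x hx => hV (h x hx)) s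
  rwa [X.res_id] at this

theorem Hom.comp_pull (F : Hom X Y) (G : Hom Y Z) (V : Opens Z.pt) (V' : Opens Y.pt)
    (U : Opens X.pt) (h : ∀ x ∈ U, G.base (F.base x) ∈ V) (h1 : ∀ x ∈ U, F.base x ∈ V')
    (h2 : ∀ y ∈ V', G.base y ∈ V) (s : Z.O V) :
    (F.comp G).pull V U h s = F.pull V' U h1 (G.pull V V' h2 s) := by
  change F.pull (G.pre V) U _ (G.pull V (G.pre V) _ s) = _
  have hle : V' ≤ G.pre V := fun y hy => h2 y hy
  rw [← G.res_pull hle (fun _ hy => hy) s, F.pull_res']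

theorem Hom.congr_pull {F G : Hom X Y} (e : F = G) {V : Opens Y.pt} {U : Opens X.pt}
    (h : ∀ x ∈ U, F.base x ∈ V) (s : Y.O V) :
    F.pull V U h s = G.pull V U (e ▸ h) s := by
  subst e
  rfl

theorem Hom.congr_base {F G : Hom X Y} (e : F = G) (x : X.pt) : F.base x = G.base x := by
  rw [e]

/-- Two sections are equal if they agree near every point. -/
theorem eq_of_locally_eq {V : Opens X.pt} (s t : X.O V)
    (h : ∀ x ∈ V, ∃ (W : Opens X.pt) (hW : W ≤ V), x ∈ W ∧ X.res hW s = X.res hW t) : s = t := by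
  choose W hW hx he using h
  have key := X.glue (ι := V) V (fun x => W x.1 x.2) (fun x => hW x.1 x.2)
    (fun x hxV => ⟨⟨x, hxV⟩, hx x hxV⟩) (fun x => X.res (hW x.1 x.2) s)
    (fun i j W' hi hj => by rw [X.res_comp, X.res_comp])
  exact key.unique (fun i => rfl) (fun i => (he i.1 i.2).symm)

/-- Parity is a local property of sections. -/
theorem gr_of_locally_gr {V : Opens X.pt} (i : ZMod 2) (s : X.O V)
    (h : ∀ x ∈ V, ∃ (W : Opens X.pt) (hW : W ≤ V), x ∈ W ∧ X.res hW s ∈ gr (A := X.O W) i) :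
    s ∈ gr (A := X.O V) i := by
  have hA := SuperAlgebra.isCompl (A := X.O V)
  obtain ⟨a, ha, b, hb, rfl⟩ := Submodule.mem_sup.mp
    (show s ∈ gr (A := X.O V) 0 ⊔ gr (A := X.O V) 1 by rw [hA.sup_eq_top]; trivial)
  have hi : i = 0 ∨ i = 1 := by clear h; revert i; decide
  obtain rfl | rfl := hi
  · have : b = 0 := eq_of_locally_eq _ _ fun x hx => by
      obtain ⟨W, hW, hxW, he⟩ := h x hx
      rw [map_add] at he
      refine ⟨W, hW, hxW, ?_⟩
      rw [map_zero]
      exact Submodule.disjoint_def.mp (SuperAlgebra.isCompl (A := X.O W)).disjoint _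
        ((Submodule.add_mem_iff_right _ (X.res_gr _ 0 _ ha)).mp he) (X.res_gr _ 1 _ hb)
    simpa [this] using ha
  · have : a = 0 := eq_of_locally_eq _ _ fun x hx => by
      obtain ⟨W, hW, hxW, he⟩ := h x hx
      rw [map_add] at he
      refine ⟨W, hW, hxW, ?_⟩
      rw [map_zero]
      exact Submodule.disjoint_def.mp (SuperAlgebra.isCompl (A := X.O W)).disjoint _
        (X.res_gr _ 0 _ ha) ((Submodule.add_mem_iff_left _ (X.res_gr _ 1 _ hb)).mp he)
    simpa [this] using hb

/-- Two morphisms are equal if they agree near every point of the source. -/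
theorem Hom.ext_locally {F G : Hom X Y} (hb : F.base = G.base)
    (h : ∀ (V : Opens Y.pt) (s : Y.O V) (x : X.pt), F.base x ∈ V →
      ∃ W : Opens X.pt, x ∈ W ∧ ∃ (h1 : ∀ x ∈ W, F.base x ∈ V) (h2 : ∀ x ∈ W, G.base x ∈ V),
        F.pull V W h1 s = G.pull V W h2 s) : F = G := by
  refine Hom.ext' hb fun V U h1 h2 s => eq_of_locally_eq _ _ fun x hx => ?_
  obtain ⟨W, hxW, h1', h2', e⟩ := h V s x (h1 x hx)
  refine ⟨W ⊓ U, inf_le_right, ⟨hxW, hx⟩, ?_⟩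
  rw [F.res_pull, G.res_pull, ← F.res_pull inf_le_left h1', ← G.res_pull inf_le_left h2', e]

/-! ### Open embeddings -/

theorem Hom.IsOpenEmb.bijective {F : Hom X Y} (hF : F.IsOpenEmb) (V : Opens Y.pt)
    (U : Opens X.pt) (hU : ∀ x, x ∈ U ↔ F.base x ∈ V) (hV : (V : Set Y.pt) ⊆ Set.range F.base) :
    Function.Bijective (F.pull V U fun x hx => (hU x).mp hx) := by
  have : U = F.pre V := by
    ext x
    exact hU x
  subst this
  exact hF.2 V hV

/-- The image of an open set under an open embedding. -/
def Hom.IsOpenEmb.image {F : Hom X Y} (hF : F.IsOpenEmb) (U : Opens X.pt) : Opens Y.pt :=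
  ⟨F.base '' U, hF.1.isOpenMap _ U.2⟩

theorem Hom.IsOpenEmb.mem_image {F : Hom X Y} (hF : F.IsOpenEmb) (U : Opens X.pt) (x : X.pt) :
    F.base x ∈ hF.image U ↔ x ∈ U :=
  ⟨fun ⟨_, hy, e⟩ => hF.1.injective e ▸ hy, fun h => ⟨x, h, rfl⟩⟩

theorem Hom.IsOpenEmb.bijective_image {F : Hom X Y} (hF : F.IsOpenEmb) (U : Opens X.pt) :
    Function.Bijective (F.pull (hF.image U) U fun x hx => (hF.mem_image U x).mpr hx) :=
  hF.bijective _ _ (fun x => (hF.mem_image U x).symm) (Set.image_subset_range _ _)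

/-- Sections over an open set are sections over its image under an open embedding. -/
noncomputable def Hom.IsOpenEmb.sectionEquiv {F : Hom X Y} (hF : F.IsOpenEmb) (U : Opens X.pt) :
    Y.O (hF.image U) ≃ₐ[ℝ] X.O U :=
  AlgEquiv.ofBijective (F.pull (hF.image U) U _) (hF.bijective_image U)

theorem Hom.IsOpenEmb.sectionEquiv_apply {F : Hom X Y} (hF : F.IsOpenEmb) (U : Opens X.pt)
    (s : Y.O (hF.image U)) : hF.sectionEquiv U s =
      F.pull (hF.image U) U (fun x hx => (hF.mem_image U x).mpr hx) s := rfl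

/-- An injective parity preserving algebra map reflects the parity. -/
theorem gr_of_map_gr {A B : Type} [Ring A] [Algebra ℝ A] [SuperAlgebra A] [Ring B] [Algebra ℝ B]
    [SuperAlgebra B] (f : A →ₐ[ℝ] B) (hf : Function.Injective f)
    (hgr : ∀ i, ∀ a ∈ gr (A := A) i, f a ∈ gr (A := B) i) (i : ZMod 2) (a : A)
    (h : f a ∈ gr (A := B) i) : a ∈ gr (A := A) i := by
  have hA := SuperAlgebra.isCompl (A := A)
  have hB := SuperAlgebra.isCompl (A := B)
  obtain ⟨a0, h0, a1, h1, rfl⟩ := Submodule.mem_sup.mp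
    (show a ∈ gr (A := A) 0 ⊔ gr (A := A) 1 by rw [hA.sup_eq_top]; trivial)
  rw [map_add] at h
  have hi : i = 0 ∨ i = 1 := by clear h; revert i; decide
  obtain rfl | rfl := hi
  · have : f a1 ∈ gr (A := B) 0 := by
      simpa using sub_mem h (hgr 0 a0 h0)
    have h' := Submodule.disjoint_def.mp hB.disjoint _ this (hgr 1 a1 h1)
    rw [map_eq_zero_iff f hf] at h'
    simpa [h'] using h0
  · have : f a0 ∈ gr (A := B) 1 := by
      simpa using sub_mem h (hgr 1 a1 h1)
    have h' := Submodule.disjoint_def.mp hB.disjoint _ (hgr 0 a0 h0) this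
    rw [map_eq_zero_iff f hf] at h'
    simpa [h'] using h1

theorem Hom.IsOpenEmb.pull_eq_sectionEquiv_symm {F : Hom X Y} (hF : F.IsOpenEmb) {U : Opens X.pt}
    (s : X.O U) : F.pull (hF.image U) U (fun x hx => (hF.mem_image U x).mpr hx)
      ((hF.sectionEquiv U).symm s) = s :=
  (hF.sectionEquiv U).apply_symm_apply s

theorem Hom.IsOpenEmb.sectionEquiv_symm_gr {F : Hom X Y} (hF : F.IsOpenEmb) {U : Opens X.pt}
    (i : ZMod 2) (s : X.O U) (h : s ∈ gr (A := X.O U) i) :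
    (hF.sectionEquiv U).symm s ∈ gr (A := Y.O (hF.image U)) i :=
  gr_of_map_gr _ (hF.bijective_image U).1 (F.pull_gr _ _ _) i _
    ((hF.pull_eq_sectionEquiv_symm s).symm ▸ h)

theorem Hom.IsOpenEmb.res_sectionEquiv_symm {F : Hom X Y} (hF : F.IsOpenEmb) {U U' : Opens X.pt}
    (hU : U' ≤ U) (s : X.O U) :
    Y.res (show hF.image U' ≤ hF.image U from Set.image_mono hU) ((hF.sectionEquiv U).symm s) =
      (hF.sectionEquiv U').symm (X.res hU s) := by
  apply (hF.bijective_image U').1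
  rw [hF.pull_eq_sectionEquiv_symm, F.pull_res']
  conv_rhs => rw [← hF.pull_eq_sectionEquiv_symm s, F.res_pull]

/-- A morphism whose image lies in the image of an open embedding `F` factors through `F`. -/
noncomputable def Hom.IsOpenEmb.lift {F : Hom X Y} (hF : F.IsOpenEmb) (G : Hom Z Y)
    (h : ∀ z, G.base z ∈ Set.range F.base) : Hom Z X where
  base z := (h z).choose
  cont := by
    rw [hF.1.isEmbedding.continuous_iff]
    have : F.base ∘ (fun z => (h z).choose) = G.base := funext fun z => (h z).choose_spec
    rw [this]
    exact G.cont
  pull V U hU := (G.pull (hF.image V) U fun z hz => ⟨_, hU z hz, (h z).choose_spec⟩).comp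
    (hF.sectionEquiv V).symm.toAlgHom
  pull_gr V U hU i s hs := G.pull_gr _ _ _ i _ (hF.sectionEquiv_symm_gr i s hs)
  pull_res {V V' U U'} hV hU h h' s := by
    change Z.res _ (G.pull _ _ _ ((hF.sectionEquiv V).symm _)) =
      G.pull _ _ _ ((hF.sectionEquiv V').symm _)
    rw [← hF.res_sectionEquiv_symm hV]
    exact (congrArg (Z.res hU) (G.pull_res' _ _ _)).trans (G.res_pull _ _ _)

theorem Hom.IsOpenEmb.base_lift {F : Hom X Y} (hF : F.IsOpenEmb) (G : Hom Z Y)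
    (h : ∀ z, G.base z ∈ Set.range F.base) (z : Z.pt) :
    F.base ((hF.lift G h).base z) = G.base z := (h z).choose_spec

theorem Hom.IsOpenEmb.lift_comp {F : Hom X Y} (hF : F.IsOpenEmb) (G : Hom Z Y)
    (h : ∀ z, G.base z ∈ Set.range F.base) : (hF.lift G h).comp F = G := by
  refine Hom.ext' (funext fun z => hF.base_lift G h z) fun V U h1 h2 s => ?_
  change G.pull _ _ _ ((hF.sectionEquiv _).symm (F.pull V (F.pre V) _ s)) = _
  have hle : hF.image (F.pre V) ≤ V := by
    rintro _ ⟨x, hx, rfl⟩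
    exact hx
  have : (hF.sectionEquiv (F.pre V)).symm (F.pull V (F.pre V) (fun _ hx => hx) s) =
      Y.res hle s := by
    rw [AlgEquiv.symm_apply_eq, hF.sectionEquiv_apply, F.pull_res']
  rw [this]
  exact G.pull_res' _ _ _

/-- Open embeddings are monomorphisms. -/
theorem Hom.IsOpenEmb.cancel {F : Hom X Y} (hF : F.IsOpenEmb) {G G' : Hom Z X}
    (h : G.comp F = G'.comp F) : G = G' := by
  have hb : G.base = G'.base := funext fun z => hF.1.injective (Hom.congr_base h z)
  refine Hom.ext' hb fun V U h1 h2 s => ?_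
  rw [← hF.pull_eq_sectionEquiv_symm s,
    ← G.comp_pull F _ V U (fun x hx => (hF.mem_image _ _).mpr (h1 x hx)) h1,
    ← G'.comp_pull F _ V U (fun x hx => (hF.mem_image _ _).mpr (h2 x hx)) h2]
  exact Hom.congr_pull h _ _

/-- A morphism is an open embedding if it becomes one after composition with an open embedding. -/
theorem Hom.IsOpenEmb.of_comp {F : Hom X Y} {G : Hom Y Z} (hG : G.IsOpenEmb)
    (h : (F.comp G).IsOpenEmb) : F.IsOpenEmb := by
  refine ⟨Topology.IsOpenEmbedding.of_comp _ hG.1 h.1, fun V hV => ?_⟩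
  have h1 := h.bijective (hG.image V) (F.pre V) (fun x => (hG.mem_image V _).symm) (by
    rintro _ ⟨y, hy, rfl⟩
    obtain ⟨x, rfl⟩ := hV hy
    exact ⟨x, rfl⟩)
  have h2 : ∀ s, (F.comp G).pull (hG.image V) (F.pre V)
      (fun x hx => (hG.mem_image V _).mpr hx) s = F.pull V (F.pre V) (fun _ hx => hx)
        (hG.sectionEquiv V s) := fun s => F.comp_pull G _ V _ _ _ _ s
  have h3 : Function.Bijective (fun s => F.pull V (F.pre V) (fun _ hx => hx)
      (hG.sectionEquiv V s)) := by
    rw [← funext h2]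
    exact h1
  exact (Function.Bijective.of_comp_iff (F.pull V (F.pre V) fun _ hx => hx)
    (hG.sectionEquiv V).bijective).mp h3

/-- Isomorphisms are open embeddings. -/
theorem Hom.IsOpenEmb.of_inverse {F : Hom X Y} {G : Hom Y X} (h1 : F.comp G = Hom.id X)
    (h2 : G.comp F = Hom.id Y) : F.IsOpenEmb := by
  have b1 : ∀ x, G.base (F.base x) = x := Hom.congr_base h1
  have b2 : ∀ y, F.base (G.base y) = y := Hom.congr_base h2
  refine ⟨(Homeomorph.mk ⟨F.base, G.base, b1, b2⟩ F.cont G.cont).isOpenEmbedding, fun V _ => ?_⟩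
  have g1 : ∀ y ∈ V, G.base y ∈ F.pre V := fun y hy => show F.base (G.base y) ∈ V by rwa [b2]
  refine Function.bijective_iff_has_inverse.mpr
    ⟨G.pull (F.pre V) V g1, fun s => ?_, fun s => ?_⟩
  · exact (G.comp_pull F V (F.pre V) V g1 g1 (fun _ hx => hx) s).symm.trans
      ((Hom.congr_pull h2 _ s).trans (Y.res_id s))
  · exact (F.comp_pull G (F.pre V) V (F.pre V) (fun x hx => (b1 x).symm ▸ hx)
      (fun _ hx => hx) g1 s).symm.trans ((Hom.congr_pull h1 _ s).trans (X.res_id s))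

/-- The inclusion of one open sub-superspace into a larger one. -/
noncomputable def inclLE (X : SuperSpace) {U V : Opens X.pt} (h : U ≤ V) :
    Hom (X.restrict U) (X.restrict V) :=
  (X.incl_isOpenEmb V).lift (X.incl U) fun x => ⟨⟨x.1, h x.2⟩, rfl⟩

theorem inclLE_comp (X : SuperSpace) {U V : Opens X.pt} (h : U ≤ V) :
    (X.inclLE h).comp (X.incl V) = X.incl U := Hom.IsOpenEmb.lift_comp _ _ _

theorem inclLE_isOpenEmb (X : SuperSpace) {U V : Opens X.pt} (h : U ≤ V) :
    (X.inclLE h).IsOpenEmb :=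
  (X.incl_isOpenEmb V).of_comp ((X.inclLE_comp h).symm ▸ X.incl_isOpenEmb U)

theorem base_inclLE (X : SuperSpace) {U V : Opens X.pt} (h : U ≤ V) (x : U) :
    (X.inclLE h).base x = ⟨x.1, h x.2⟩ :=
  Subtype.ext (Hom.congr_base (X.inclLE_comp h) x)

/-! ### Gluing morphisms -/

/-- The open set of `C` cut out by an open set of the ambient space. -/
def trace {X : Type} [TopologicalSpace X] (C U : Opens X) : Opens C :=
  ⟨Subtype.val ⁻¹' (U : Set X), U.2.preimage continuous_subtype_val⟩

theorem img_trace {X : Type} [TopologicalSpace X] (C U : Opens X) : img C (trace C U) = C ⊓ U := by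
  ext x
  constructor
  · rintro ⟨y, hy, rfl⟩
    exact ⟨y.2, hy⟩
  · rintro ⟨h1, h2⟩
    exact ⟨⟨x, h1⟩, h2, rfl⟩

/-- The pullback by a morphism defined on an open subset `C`, as a section over an open subset
of the ambient space that is contained in `C`. Open subsets of the ambient space are easier to
intersect than open subsets of the various `C`. -/
noncomputable def Hom.pullOn {C : Opens X.pt} (F : Hom (X.restrict C) Y) (V : Opens Y.pt)
    (U : Opens X.pt) (hU : U ≤ C) (h : ∀ x (hx : x ∈ U), F.base ⟨x, hU hx⟩ ∈ V) :
    Y.O V →ₐ[ℝ] X.O U :=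
  (X.res (show U ≤ img C (trace C U) from (img_trace C U).symm ▸ le_inf hU le_rfl)).comp
    (F.pull V (trace C U) fun x hx => h x.1 hx)

theorem Hom.pullOn_apply {C : Opens X.pt} (F : Hom (X.restrict C) Y) (V : Opens Y.pt)
    (U : Opens X.pt) (hU : U ≤ C) (h : ∀ x (hx : x ∈ U), F.base ⟨x, hU hx⟩ ∈ V) (W : Opens C)
    (hW : U ≤ img C W) (hV : ∀ x ∈ W, F.base x ∈ V) (s : Y.O V) :
    F.pullOn V U hU h s = X.res hW (F.pull V W hV s) := by
  have h1 : trace C U ≤ W := by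
    rintro x hx
    obtain ⟨y, hy, e⟩ := hW hx
    rwa [← Subtype.ext e]
  have := F.res_pull h1 hV s
  change X.res _ (F.pull V (trace C U) _ s) = _
  rw [← this]
  exact X.res_comp _ _ _

theorem Hom.res_pullOn {C : Opens X.pt} (F : Hom (X.restrict C) Y) (V : Opens Y.pt)
    (U U' : Opens X.pt) (hU : U ≤ C) (hU' : U' ≤ U)
    (h : ∀ x (hx : x ∈ U), F.base ⟨x, hU hx⟩ ∈ V) (s : Y.O V) :
    X.res hU' (F.pullOn V U hU h s) =
      F.pullOn V U' (hU'.trans hU) (fun x hx => h x (hU' hx)) s := by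
  rw [F.pullOn_apply V U' (hU'.trans hU) _ (trace C U)
    (hU'.trans ((img_trace C U).symm ▸ le_inf hU le_rfl)) (fun x hx => h x.1 hx)]
  exact X.res_comp _ _ _

theorem Hom.pullOn_res {C : Opens X.pt} (F : Hom (X.restrict C) Y) (V V' : Opens Y.pt)
    (hV : V ≤ V') (U : Opens X.pt) (hU : U ≤ C)
    (h : ∀ x (hx : x ∈ U), F.base ⟨x, hU hx⟩ ∈ V) (s : Y.O V') :
    F.pullOn V U hU h (Y.res hV s) = F.pullOn V' U hU (fun x hx => hV (h x hx)) s :=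
  congrArg (X.res _) (F.pull_res' hV _ s)

theorem Hom.pullOn_gr {C : Opens X.pt} (F : Hom (X.restrict C) Y) (V : Opens Y.pt)
    (U : Opens X.pt) (hU : U ≤ C) (h : ∀ x (hx : x ∈ U), F.base ⟨x, hU hx⟩ ∈ V) (i : ZMod 2)
    (s : Y.O V) (hs : s ∈ gr (A := Y.O V) i) : F.pullOn V U hU h s ∈ gr (A := X.O U) i :=
  X.res_gr _ i _ (F.pull_gr _ _ _ i s hs)

theorem Hom.pullOn_inclLE {C D : Opens X.pt} (hD : D ≤ C) (F : Hom (X.restrict C) Y)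
    (V : Opens Y.pt) (U : Opens X.pt) (hU : U ≤ D)
    (h : ∀ x (hx : x ∈ U), F.base ⟨x, hD (hU hx)⟩ ∈ V)
    (h' : ∀ x (hx : x ∈ U), ((X.inclLE hD).comp F).base ⟨x, hU hx⟩ ∈ V) (s : Y.O V) :
    ((X.inclLE hD).comp F).pullOn V U hU h' s = F.pullOn V U (hU.trans hD) h s := by
  change X.res _ (((X.inclLE hD).comp F).pull V (trace D U) (fun x hx => h' x.1 hx) s) =
    X.res _ (F.pull V (trace C U) _ s)
  have e : ∀ x ∈ trace D U, (X.inclLE hD).base x ∈ trace C U := fun x hx => by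
    rw [X.base_inclLE]
    exact hx
  have h2 := (X.inclLE hD).comp_pull F V (trace C U) (trace D U)
    (fun x hx => h _ (e x hx)) e (fun x hx => h x.1 hx) s
  refine (congrArg (X.res _) h2).trans ?_
  have hle : img D (trace D U) ≤ img C (trace C U) := by
    rw [img_trace, img_trace]
    exact inf_le_inf_right _ hD
  have h3 : ∀ t : X.O (img C (trace C U)),
      (X.inclLE hD).pull (trace C U) (trace D U) e t = X.res hle t := by
    intro t
    have h4 : t = (X.incl C).pull (img C (trace C U)) (trace C U) (fun x hx => ⟨x, hx, rfl⟩) t :=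
      (X.res_id t).symm
    rw [h4]
    refine ((X.inclLE hD).comp_pull (X.incl C) (img C (trace C U)) (trace C U) (trace D U)
      (fun x hx => ⟨_, e x hx, rfl⟩) e (fun x hx => ⟨x, hx, rfl⟩) t).symm.trans ?_
    refine (Hom.congr_pull (X.inclLE_comp hD) _ t).trans ?_
    rw [← h4]
    rfl
  exact (congrArg (X.res _) (h3 _)).trans (X.res_comp _ _ _)

/-- Morphisms on the members of an open cover which agree on overlaps glue. -/
theorem exists_glue {ι : Type} (C : ι → Opens X.pt) (hC : ∀ x, ∃ i, x ∈ C i)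
    (F : ∀ i, Hom (X.restrict (C i)) Y)
    (compat : ∀ i j, (X.inclLE (inf_le_left : C i ⊓ C j ≤ C i)).comp (F i) =
      (X.inclLE (inf_le_right : C i ⊓ C j ≤ C j)).comp (F j)) :
    ∃ G : Hom X Y, ∀ i, (X.incl (C i)).comp G = F i := by
  -- the glued map on points
  choose c hc using hC
  let b : X.pt → Y.pt := fun x => (F (c x)).base ⟨x, hc x⟩
  have hb : ∀ i x (hx : x ∈ C i), b x = (F i).base ⟨x, hx⟩ := by
    intro i x hx
    have := Hom.congr_base (compat (c x) i) ⟨x, hc x, hx⟩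
    change (F (c x)).base ((X.inclLE _).base _) = (F i).base ((X.inclLE _).base _) at this
    rwa [X.base_inclLE, X.base_inclLE] at this
  have agree : ∀ (i j : ι) (V : Opens Y.pt) (W : Opens X.pt) (hi : W ≤ C i) (hj : W ≤ C j)
      (h : ∀ x ∈ W, b x ∈ V) (s : Y.O V),
      (F i).pullOn V W hi (fun x hx => hb i x (hi hx) ▸ h x hx) s =
        (F j).pullOn V W hj (fun x hx => hb j x (hj hx) ▸ h x hx) s := by
    intro i j V W hi hj h s
    have hi' : ∀ x (hx : x ∈ W), (F i).base ⟨x, hi hx⟩ ∈ V := fun x hx => hb i x (hi hx) ▸ h x hx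
    have hj' : ∀ x (hx : x ∈ W), (F j).base ⟨x, hj hx⟩ ∈ V := fun x hx => hb j x (hj hx) ▸ h x hx
    have ki : ∀ x (hx : x ∈ W), ((X.inclLE (inf_le_left : C i ⊓ C j ≤ C i)).comp (F i)).base
        ⟨x, (le_inf hi hj) hx⟩ ∈ V := fun x hx => by
      change (F i).base ((X.inclLE _).base _) ∈ V
      rw [X.base_inclLE]
      exact hi' x hx
    have kj : ∀ x (hx : x ∈ W), ((X.inclLE (inf_le_right : C i ⊓ C j ≤ C j)).comp (F j)).base
        ⟨x, (le_inf hi hj) hx⟩ ∈ V := fun x hx => by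
      change (F j).base ((X.inclLE _).base _) ∈ V
      rw [X.base_inclLE]
      exact hj' x hx
    have e1 := Hom.pullOn_inclLE (inf_le_left : C i ⊓ C j ≤ C i) (F i) V W (le_inf hi hj) hi' ki s
    have e2 := Hom.pullOn_inclLE (inf_le_right : C i ⊓ C j ≤ C j) (F j) V W (le_inf hi hj) hj' kj s
    refine e1.symm.trans (Eq.trans ?_ e2)
    exact congrArg (X.res _) (Hom.congr_pull (compat i j) (fun x hx => ki x.1 hx) s)
  -- the pullback of a section is glued from its pullbacks along the given morphisms
  have ex : ∀ (V : Opens Y.pt) (U : Opens X.pt) (h : ∀ x ∈ U, b x ∈ V) (s : Y.O V),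
      ∃! t : X.O U, ∀ i, X.res (inf_le_right : C i ⊓ U ≤ U) t =
        (F i).pullOn V (C i ⊓ U) inf_le_left
          (fun x hx => hb i x hx.1 ▸ h x hx.2) s := by
    intro V U h s
    refine X.glue U (fun i => C i ⊓ U) (fun i => inf_le_right) (fun x hx => ⟨c x, hc x, hx⟩) _ ?_
    intro i j W hi hj
    rw [Hom.res_pullOn, Hom.res_pullOn]
    exact agree i j V W _ _ (fun x hx => h x (hi hx).2) s
  choose p hp hpu using ex
  have hp' : ∀ V U h s i (W : Opens X.pt) (hW : W ≤ C i) (hW' : W ≤ U),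
      X.res hW' (p V U h s) = (F i).pullOn V W hW
        (fun x hx => hb i x (hW hx) ▸ h x (hW' hx)) s := by
    intro V U h s i W hW hW'
    have := congrArg (X.res (le_inf hW hW')) (hp V U h s i)
    rwa [X.res_comp, Hom.res_pullOn] at this
  have uniq : ∀ V U h s t, (∀ i, X.res (inf_le_right : C i ⊓ U ≤ U) t =
        (F i).pullOn V (C i ⊓ U) inf_le_left
          (fun x hx => hb i x hx.1 ▸ h x hx.2) s) → p V U h s = t :=
    fun V U h s t ht => (hpu V U h s t ht).symm
  let G : Hom X Y :=
    { base := b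
      cont := by
        rw [continuous_iff_continuousAt]
        intro x
        have h1 : ContinuousAt (fun y : C (c x) => b y.1) ⟨x, hc x⟩ := by
          rw [show (fun y : C (c x) => b y.1) = (F (c x)).base from
            funext fun y => hb (c x) y.1 y.2]
          exact (F (c x)).cont.continuousAt
        exact ((C (c x)).2.isOpenEmbedding_subtypeVal.continuousAt_iff
          (f := (Subtype.val : C (c x) → X.pt)) (g := b) (x := ⟨x, hc x⟩)).mp h1
      pull := fun V U h =>
        { toFun := p V U h
          map_one' := uniq _ _ _ _ _ fun i => by simp only [map_one]
          map_mul' := fun s t => uniq _ _ _ _ _ fun i => by simp only [map_mul, hp]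
          map_zero' := uniq _ _ _ _ _ fun i => by simp only [map_zero]
          map_add' := fun s t => uniq _ _ _ _ _ fun i => by simp only [map_add, hp]
          commutes' := fun r => uniq _ _ _ _ _ fun i => by simp only [AlgHom.commutes] }
      pull_gr := by
        intro V U h i s hs
        change p V U h s ∈ _
        refine gr_of_locally_gr i _ fun x hx => ⟨C (c x) ⊓ U, inf_le_right, ⟨hc x, hx⟩, ?_⟩
        rw [hp]
        exact (F _).pullOn_gr _ _ _ _ i s hs
      pull_res := by
        intro V V' U U' hV hU h h' s
        refine (uniq V' U' h' s _ fun i => ?_).symm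
        rw [X.res_comp]
        change X.res _ (p V U h _) = _
        rw [hp' V U h _ i (C i ⊓ U') inf_le_left (inf_le_right.trans hU), Hom.pullOn_res] }
  refine ⟨G, fun i => Hom.ext' (funext fun x => hb i x.1 x.2) fun V U h h' s => ?_⟩
  have hU : img (C i) U ≤ C i := by
    rintro _ ⟨x, hx, rfl⟩
    exact x.2
  have h1 : ∀ x ∈ img (C i) U, b x ∈ V := by
    rintro _ ⟨x, hx, rfl⟩
    exact h x hx
  have h2 : ((X.incl (C i)).comp G).pull V U h s = p V (img (C i) U) h1 s :=
    (X.incl (C i)).comp_pull G V (img (C i) U) U h (fun x hx => ⟨x, hx, rfl⟩) h1 s |>.trans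
      (X.res_id _)
  rw [h2, ← X.res_id (p V (img (C i) U) h1 s), hp' _ _ _ _ i _ hU le_rfl,
    Hom.pullOn_apply _ _ _ _ _ U le_rfl h']
  exact X.res_id _

end SuperSpace

/-! ### Grassmann algebras -/

namespace Grass

variable {q : ℕ}

/-- The body of an element of the Grassmann algebra: its component of degree `0`. -/
noncomputable def body (q : ℕ) : Grass q →ₐ[ℝ] ℝ := ExteriorAlgebra.algebraMapInv

theorem body_ι (v : Fin q → ℝ) : body q (ExteriorAlgebra.ι ℝ v) = 0 := by
  simp [body, ExteriorAlgebra.algebraMapInv]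

theorem body_algebraMap (r : ℝ) : body q (algebraMap ℝ _ r) = r := by
  rw [AlgHom.commutes]
  rfl

/-- The augmentation ideal, as a subspace. -/
noncomputable def aug (q : ℕ) : Submodule ℝ (Grass q) := LinearMap.ker (body q).toLinearMap

theorem mem_aug {z : Grass q} : z ∈ aug q ↔ body q z = 0 := Iff.rfl

theorem sub_body_mem_aug (z : Grass q) : z - algebraMap ℝ _ (body q z) ∈ aug q := by
  rw [mem_aug, map_sub, body_algebraMap, sub_self]

theorem mul_ι_eq (z : Grass q) (v : Fin q → ℝ) :
    z * ExteriorAlgebra.ι ℝ v = ExteriorAlgebra.ι ℝ v * CliffordAlgebra.involute z := by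
  induction z using CliffordAlgebra.left_induction with
  | algebraMap r => rw [AlgHom.commutes, Algebra.commutes]
  | add x y hx hy => rw [add_mul, hx, hy, map_add, mul_add]
  | ι_mul x w hx =>
    have h : ExteriorAlgebra.ι ℝ w * ExteriorAlgebra.ι ℝ v =
        -(ExteriorAlgebra.ι ℝ v * ExteriorAlgebra.ι ℝ w) :=
      eq_neg_of_add_eq_zero_left (ExteriorAlgebra.ι_add_mul_swap w v)
    change ExteriorAlgebra.ι ℝ w * x * _ = _ * CliffordAlgebra.involute (CliffordAlgebra.ι _ w * x)
    rw [mul_assoc, hx, ← mul_assoc, h, map_mul, CliffordAlgebra.involute_ι, neg_mul, neg_mul,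
      mul_neg, mul_assoc]

/-- The augmentation ideal is nilpotent: it is generated by the span `R` of the generators, and
`R ^ (q + 1) = 0`. -/
theorem aug_pow_eq_bot (q : ℕ) : aug q ^ (q + 1) = ⊥ := by
  let R : Submodule ℝ (Grass q) := LinearMap.range (ExteriorAlgebra.ι ℝ)
  have hR : R ^ (q + 1) = ⊥ := by
    have h := ExteriorAlgebra.ιMulti_span_fixedDegree (R := ℝ) (M := Fin q → ℝ) (q + 1)
    change _ = R ^ (q + 1) at h
    rw [← h, Submodule.span_eq_bot]
    rintro _ ⟨v, rfl⟩
    refine AlternatingMap.map_linearDependent _ v fun hv => ?_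
    have := hv.fintype_card_le_finrank
    simp at this
  have h1 : ⊤ * R ≤ R * ⊤ := by
    rw [Submodule.mul_le]
    rintro z - _ ⟨v, rfl⟩
    rw [mul_ι_eq]
    exact Submodule.mul_mem_mul ⟨v, rfl⟩ trivial
  have h2 : ∀ k, ⊤ * R ^ k ≤ R ^ k * ⊤ := by
    intro k
    induction k with
    | zero =>
      rw [pow_zero, mul_one, one_mul]
    | succ k ih =>
      rw [pow_succ, ← mul_assoc]
      calc ⊤ * R ^ k * R ≤ R ^ k * ⊤ * R := by gcongr
        _ = R ^ k * (⊤ * R) := mul_assoc _ _ _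
        _ ≤ R ^ k * (R * ⊤) := by gcongr
        _ = R ^ k * R * ⊤ := (mul_assoc _ _ _).symm
  have h3 : aug q ≤ R * ⊤ := by
    have key : ∀ z : Grass q, z - algebraMap ℝ _ (body q z) ∈ R * ⊤ := by
      intro z
      induction z using CliffordAlgebra.left_induction with
      | algebraMap r =>
        have : algebraMap ℝ (Grass q) r - algebraMap ℝ _ (body q (algebraMap ℝ _ r)) = 0 := by
          rw [body_algebraMap, sub_self]
        rw [this]
        exact zero_mem _
      | add x y hx hy =>
        rw [map_add, map_add, add_sub_add_comm]
        exact add_mem hx hy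
      | ι_mul x w hx =>
        have : body q (ExteriorAlgebra.ι ℝ w * x) = 0 := by rw [map_mul, body_ι, zero_mul]
        change ExteriorAlgebra.ι ℝ w * x - algebraMap ℝ _ (body q (ExteriorAlgebra.ι ℝ w * x)) ∈ _
        rw [this, map_zero, sub_zero]
        exact Submodule.mul_mem_mul ⟨w, rfl⟩ trivial
    intro z hz
    have := key z
    rwa [mem_aug.mp hz, map_zero, sub_zero] at this
  have h4 : ∀ k, aug q ^ k ≤ R ^ k * ⊤ := by
    intro k
    induction k with
    | zero => rw [pow_zero, pow_zero, one_mul]; exact le_top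
    | succ k ih =>
      rw [pow_succ, pow_succ]
      calc aug q ^ k * aug q ≤ (R ^ k * ⊤) * (R * ⊤) := by gcongr
        _ = R ^ k * (⊤ * R) * ⊤ := by simp only [mul_assoc]
        _ ≤ R ^ k * (R * ⊤) * ⊤ := (by gcongr)
        _ = R ^ k * R * (⊤ * ⊤) := by simp only [mul_assoc]
        _ ≤ R ^ k * R * ⊤ := mul_le_mul_right le_top _
  rw [eq_bot_iff]
  refine (h4 (q + 1)).trans ?_
  rw [hR, Submodule.bot_mul]

theorem aug_mul_mem {k : ℕ} {n z : Grass q} (hn : n ∈ aug q) (hz : z ∈ aug q ^ k) :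
    n * z ∈ aug q ^ (k + 1) := by
  rw [pow_succ']
  exact Submodule.mul_mem_mul hn hz

/-- An algebra map from a Grassmann algebra that sends the generators to odd elements preserves
the parity. -/
theorem map_mem_gr {B : Type} [Ring B] [Algebra ℝ B] [SuperAlgebra B] (f : Grass q →ₐ[ℝ] B)
    (hf : ∀ v, f (ExteriorAlgebra.ι ℝ v) ∈ gr (A := B) 1) (i : ZMod 2) (z : Grass q)
    (hz : z ∈ part q i) : f z ∈ gr (A := B) i := by
  induction z, hz using CliffordAlgebra.evenOdd_induction with
  | range_ι_pow v h =>
    have hi : i = 0 ∨ i = 1 := by clear h; revert i; decide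
    obtain rfl | rfl := hi
    · obtain ⟨r, rfl⟩ := Submodule.mem_one.mp h
      rw [AlgHom.commutes, Algebra.algebraMap_eq_smul_one]
      exact Submodule.smul_mem _ _ SuperAlgebra.one_mem
    · rw [ZMod.val_one, pow_one] at h
      obtain ⟨w, rfl⟩ := h
      exact hf w
  | add x y hx hy h1 h2 =>
    rw [map_add]
    exact add_mem h1 h2
  | ι_mul_ι_mul a b x hx h =>
    rw [map_mul, map_mul]
    have h2 := SuperAlgebra.mul_mem (hf a) (hf b)
    have := SuperAlgebra.mul_mem h2 h
    rwa [show (1 + 1 + i : ZMod 2) = i by rw [show (1 + 1 : ZMod 2) = 0 from rfl, zero_add]] at this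

/-- The parity as an eigenvalue of the grade involution. -/
theorem mem_part_iff_involute {i : ZMod 2} {z : Grass q} :
    z ∈ part q i ↔ CliffordAlgebra.involute z = (-1 : ℝ) ^ i.val • z := by
  have hi : i = 0 ∨ i = 1 := by revert i; decide
  have hC : IsCompl (part q 0) (part q 1) := CliffordAlgebra.evenOdd_isCompl _
  obtain ⟨a, ha, b, hb, rfl⟩ := Submodule.mem_sup.mp
    (show z ∈ part q 0 ⊔ part q 1 by rw [hC.sup_eq_top]; trivial)
  have e : CliffordAlgebra.involute (a + b) = a - b := by
    rw [map_add, CliffordAlgebra.involute_eq_of_mem_even ha,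
      CliffordAlgebra.involute_eq_of_mem_odd hb, sub_eq_add_neg]
  rw [e]
  obtain rfl | rfl := hi
  · rw [ZMod.val_zero, pow_zero, one_smul, Submodule.add_mem_iff_right _ ha]
    constructor
    · intro h
      rw [Submodule.disjoint_def.mp hC.disjoint b h hb, sub_zero, add_zero]
    · intro h
      have : (2 : ℝ) • b = 0 := by
        rw [two_smul]
        have := sub_eq_zero.mpr h
        rw [show a - b - (a + b) = -(b + b) by abel] at this
        exact neg_eq_zero.mp this
      rw [(smul_eq_zero.mp this).resolve_left two_ne_zero]
      exact zero_mem _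
  · rw [ZMod.val_one, pow_one, neg_one_smul, Submodule.add_mem_iff_left _ hb]
    constructor
    · intro h
      rw [Submodule.disjoint_def.mp hC.disjoint a ha h, zero_sub, zero_add]
    · intro h
      have : (2 : ℝ) • a = 0 := by
        rw [two_smul]
        have := sub_eq_zero.mpr h
        rwa [show a - b - -(a + b) = a + a by abel] at this
      rw [(smul_eq_zero.mp this).resolve_left two_ne_zero]
      exact zero_mem _

/-! ### Odd derivatives -/

/-- The odd derivative with respect to a linear functional on the generators, that is, the left
contraction with it. -/
noncomputable def oddDeriv (d : Module.Dual ℝ (Fin q → ℝ)) : Grass q →ₗ[ℝ] Grass q :=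
  CliffordAlgebra.contractLeft d

theorem oddDeriv_ι_mul (d : Module.Dual ℝ (Fin q → ℝ)) (v : Fin q → ℝ) (z : Grass q) :
    oddDeriv d (ExteriorAlgebra.ι ℝ v * z) = d v • z - ExteriorAlgebra.ι ℝ v * oddDeriv d z :=
  CliffordAlgebra.contractLeft_ι_mul _ _ _

theorem oddDeriv_algebraMap (d : Module.Dual ℝ (Fin q → ℝ)) (r : ℝ) :
    oddDeriv d (algebraMap ℝ _ r) = 0 :=
  CliffordAlgebra.contractLeft_algebraMap _ _ _

theorem oddDeriv_ι (d : Module.Dual ℝ (Fin q → ℝ)) (v : Fin q → ℝ) :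
    oddDeriv d (ExteriorAlgebra.ι ℝ v) = algebraMap ℝ _ (d v) :=
  CliffordAlgebra.contractLeft_ι _ _ _

theorem oddDeriv_oddDeriv (d : Module.Dual ℝ (Fin q → ℝ)) (z : Grass q) :
    oddDeriv d (oddDeriv d z) = 0 :=
  CliffordAlgebra.contractLeft_contractLeft _ _

theorem oddDeriv_mul (d : Module.Dual ℝ (Fin q → ℝ)) (a b : Grass q) :
    oddDeriv d (a * b) = oddDeriv d a * b + CliffordAlgebra.involute a * oddDeriv d b := by
  induction a using CliffordAlgebra.left_induction with
  | algebraMap r =>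
    have h1 : oddDeriv d (algebraMap ℝ _ r * b) = algebraMap ℝ _ r * oddDeriv d b :=
      CliffordAlgebra.contractLeft_algebraMap_mul _ _ _
    have h2 : CliffordAlgebra.involute (algebraMap ℝ (Grass q) r) = algebraMap ℝ (Grass q) r :=
      AlgHom.commutes _ _
    exact h1.trans (by rw [oddDeriv_algebraMap d r, h2, zero_mul, zero_add])
  | add x y hx hy => rw [add_mul, map_add, hx, hy, map_add, map_add, add_mul, add_mul]; abel
  | ι_mul x w hx =>
    change oddDeriv d (ExteriorAlgebra.ι ℝ w * x * b) = oddDeriv d (ExteriorAlgebra.ι ℝ w * x) * b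
      + CliffordAlgebra.involute (CliffordAlgebra.ι _ w * x) * oddDeriv d b
    rw [mul_assoc, oddDeriv_ι_mul, hx, oddDeriv_ι_mul, map_mul, CliffordAlgebra.involute_ι, sub_mul,
      smul_mul_assoc, mul_add, neg_mul, neg_mul, mul_assoc, mul_assoc]
    abel

theorem involute_oddDeriv (d : Module.Dual ℝ (Fin q → ℝ)) (z : Grass q) :
    CliffordAlgebra.involute (oddDeriv d z) = -oddDeriv d (CliffordAlgebra.involute z) := by
  induction z using CliffordAlgebra.left_induction with
  | algebraMap r =>
    have h2 : CliffordAlgebra.involute (algebraMap ℝ (Grass q) r) = algebraMap ℝ (Grass q) r :=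
      AlgHom.commutes _ _
    refine (congrArg CliffordAlgebra.involute (oddDeriv_algebraMap d r)).trans
      (((congrArg (fun z => -oddDeriv d z) h2).trans ?_).symm)
    rw [oddDeriv_algebraMap, neg_zero, map_zero]
  | add x y hx hy => rw [map_add, map_add, hx, hy, map_add, map_add, neg_add]
  | ι_mul x w hx =>
    have h : CliffordAlgebra.involute (ExteriorAlgebra.ι ℝ w * x) =
        -(ExteriorAlgebra.ι ℝ w * CliffordAlgebra.involute x) := by
      rw [map_mul, CliffordAlgebra.involute_ι, neg_mul]
    change CliffordAlgebra.involute (oddDeriv d (ExteriorAlgebra.ι ℝ w * x)) =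
      -oddDeriv d (CliffordAlgebra.involute (ExteriorAlgebra.ι ℝ w * x))
    rw [h, oddDeriv_ι_mul, map_neg, oddDeriv_ι_mul, map_sub, map_smul, map_mul,
      CliffordAlgebra.involute_ι, hx, neg_mul_neg, neg_neg]

theorem oddDeriv_mem_part (d : Module.Dual ℝ (Fin q → ℝ)) {i : ZMod 2} {z : Grass q}
    (hz : z ∈ part q i) : oddDeriv d z ∈ part q (1 + i) := by
  rw [mem_part_iff_involute] at hz ⊢
  rw [involute_oddDeriv, hz, map_smul, ← neg_smul]
  congr 1
  have hi : i = 0 ∨ i = 1 := by clear hz; revert i; decide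
  obtain rfl | rfl := hi
  · simp [ZMod.val_one]
  · rw [show (1 + 1 : ZMod 2) = 0 from rfl]
    simp [ZMod.val_one]

/-- The graded Leibniz rule for odd derivatives. -/
theorem oddDeriv_mul_of_mem (d : Module.Dual ℝ (Fin q → ℝ)) {i : ZMod 2} {a : Grass q}
    (ha : a ∈ part q i) (b : Grass q) :
    oddDeriv d (a * b) = oddDeriv d a * b + (-1 : ℝ) ^ i.val • (a * oddDeriv d b) := by
  rw [oddDeriv_mul, mem_part_iff_involute.mp ha, smul_mul_assoc]

/-! ### One more odd generator -/

/-- The inclusion `Λ[θ₁, …, θ_q] → Λ[θ₀, …, θ_q]` on generators. -/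
def inclGen (q : ℕ) : (Fin q → ℝ) →ₗ[ℝ] (Fin (q + 1) → ℝ) where
  toFun v := Fin.cons 0 v
  map_add' v w := by ext i; refine Fin.cases ?_ (fun j => ?_) i <;> simp
  map_smul' r v := by ext i; refine Fin.cases ?_ (fun j => ?_) i <;> simp

/-- The map `Λ[θ₀, …, θ_q] → Λ[θ₁, …, θ_q]` which kills `θ₀`, on generators. -/
def projGen (q : ℕ) : (Fin (q + 1) → ℝ) →ₗ[ℝ] (Fin q → ℝ) where
  toFun v := fun i => v i.succ
  map_add' _ _ := rfl
  map_smul' _ _ := rfl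

theorem projGen_inclGen (v : Fin q → ℝ) : projGen q (inclGen q v) = v := by
  ext i
  simp [projGen, inclGen]

/-- The generator `θ₀`. -/
noncomputable def theta (q : ℕ) : Grass (q + 1) := ExteriorAlgebra.ι ℝ (Fin.cons 1 0)

/-- The derivative with respect to `θ₀`. -/
noncomputable def dtheta (q : ℕ) : Grass (q + 1) →ₗ[ℝ] Grass (q + 1) :=
  oddDeriv (LinearMap.proj 0)

theorem dtheta_theta : dtheta q (theta q) = 1 := by
  rw [dtheta, theta, oddDeriv_ι]
  simp

theorem dtheta_map_inclGen (z : Grass q) : dtheta q (ExteriorAlgebra.map (inclGen q) z) = 0 := by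
  induction z using CliffordAlgebra.left_induction with
  | algebraMap r =>
    refine (congrArg (dtheta q) (AlgHom.commutes _ r)).trans ?_
    exact oddDeriv_algebraMap _ _
  | add x y hx hy => rw [map_add, map_add, hx, hy, add_zero]
  | ι_mul x w hx =>
    change dtheta q (ExteriorAlgebra.map (inclGen q) (ExteriorAlgebra.ι ℝ w * x)) = 0
    rw [map_mul, ExteriorAlgebra.map_apply_ι, dtheta, oddDeriv_ι_mul]
    rw [dtheta] at hx
    rw [hx, mul_zero, sub_zero]
    simp [inclGen]

theorem map_projGen_map_inclGen (z : Grass q) :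
    ExteriorAlgebra.map (projGen q) (ExteriorAlgebra.map (inclGen q) z) = z := by
  have : (projGen q).comp (inclGen q) = LinearMap.id := LinearMap.ext projGen_inclGen
  rw [← AlgHom.comp_apply, ExteriorAlgebra.map_comp_map, this, ExteriorAlgebra.map_id]
  rfl

theorem ι_eq_add (w : Fin (q + 1) → ℝ) : ExteriorAlgebra.ι ℝ w =
    ExteriorAlgebra.ι ℝ (inclGen q (projGen q w)) + w 0 • theta q := by
  rw [theta, ← map_smul, ← map_add]
  congr 1
  ext i
  refine Fin.cases ?_ (fun j => ?_) i <;> simp [inclGen, projGen]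

/-- Taylor's formula in the odd variable `θ₀`. -/
theorem eq_add_theta_mul_dtheta (z : Grass (q + 1)) :
    z = ExteriorAlgebra.map (inclGen q) (ExteriorAlgebra.map (projGen q) z) +
      theta q * dtheta q z := by
  induction z using CliffordAlgebra.left_induction with
  | algebraMap r =>
    have h : dtheta q (algebraMap ℝ _ r) = 0 := oddDeriv_algebraMap _ r
    have h2 : ExteriorAlgebra.map (inclGen q) (ExteriorAlgebra.map (projGen q)
      (algebraMap ℝ (Grass (q + 1)) r)) = algebraMap ℝ _ r := by
      rw [AlgHom.commutes, AlgHom.commutes]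
    refine Eq.symm (Eq.trans ?_ (add_zero _))
    exact congrArg₂ _ h2 ((congrArg (theta q * ·) h).trans (mul_zero _))
  | add x y hx hy =>
    conv_lhs => rw [hx, hy]
    simp only [map_add, mul_add]
    abel
  | ι_mul x w hx =>
    change ExteriorAlgebra.ι ℝ w * x = ExteriorAlgebra.map (inclGen q) (ExteriorAlgebra.map
      (projGen q) (ExteriorAlgebra.ι ℝ w * x)) + theta q * dtheta q (ExteriorAlgebra.ι ℝ w * x)
    have h2 : dtheta q (ExteriorAlgebra.ι ℝ w * x) =
        w 0 • x - ExteriorAlgebra.ι ℝ w * dtheta q x := oddDeriv_ι_mul _ _ _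
    have h3 : theta q * ExteriorAlgebra.ι ℝ w = -(ExteriorAlgebra.ι ℝ w * theta q) :=
      eq_neg_of_add_eq_zero_left (ExteriorAlgebra.ι_add_mul_swap _ w)
    have h4 : theta q * theta q = 0 := ExteriorAlgebra.ι_sq_zero _
    rw [h2, map_mul, map_mul, ExteriorAlgebra.map_apply_ι, ExteriorAlgebra.map_apply_ι, mul_sub,
      ← mul_assoc, h3]
    set z := ExteriorAlgebra.map (inclGen q) (ExteriorAlgebra.map (projGen q) x)
    have h5 : ExteriorAlgebra.ι ℝ (inclGen q (projGen q w)) =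
        ExteriorAlgebra.ι ℝ w - w 0 • theta q := by rw [ι_eq_add w, add_sub_cancel_right]
    have h6 : theta q * x = theta q * z := by
      conv_lhs => rw [hx, mul_add, ← mul_assoc, h4, zero_mul, add_zero]
    rw [h5, mul_smul_comm, h6]
    conv_lhs => rw [hx]
    rw [sub_mul, mul_add, smul_mul_assoc, neg_mul, mul_assoc]
    abel

end Grass

/-! ### Hadamard's lemma -/

section Hadamard

variable {E F : Type} [NormedAddCommGroup E] [NormedSpace ℝ E] [FiniteDimensional ℝ E]
  [NormedAddCommGroup F] [NormedSpace ℝ F]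

theorem hasFDerivAt_integral_param [CompleteSpace F] {G : E × ℝ → F} (hG : ContDiff ℝ 1 G)
    (x₀ : E) :
    HasFDerivAt (fun x => ∫ s in (0 : ℝ)..1, G (x, s))
      (∫ s in (0 : ℝ)..1, (fderiv ℝ G (x₀, s)).comp (ContinuousLinearMap.inl ℝ E ℝ)) x₀ := by
  have hc : Continuous fun p : E × ℝ => (fderiv ℝ G p).comp (ContinuousLinearMap.inl ℝ E ℝ) :=
    (hG.continuous_fderiv one_ne_zero).clm_comp continuous_const
  have : ProperSpace E := FiniteDimensional.proper ℝ E
  obtain ⟨C, hC⟩ := ((isCompact_closedBall x₀ 1).prod (isCompact_Icc (a := (0 : ℝ)) (b := 1))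
    ).exists_bound_of_continuousOn hc.continuousOn
  refine (intervalIntegral.hasFDerivAt_integral_of_dominated_of_fderiv_le
    (F := fun x s => G (x, s))
    (F' := fun x s => (fderiv ℝ G (x, s)).comp (ContinuousLinearMap.inl ℝ E ℝ))
    (bound := fun _ => C) (s := Metric.ball x₀ 1) (Metric.ball_mem_nhds x₀ one_pos) ?_ ?_ ?_ ?_
    ?_ ?_)
  · exact Filter.Eventually.of_forall fun x =>
      (hG.continuous.comp (Continuous.prodMk_right x)).aestronglyMeasurable
  · exact (hG.continuous.comp (Continuous.prodMk_right x₀)).intervalIntegrable _ _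
  · exact (hc.comp (Continuous.prodMk_right x₀)).aestronglyMeasurable
  · refine Filter.Eventually.of_forall fun s hs x hx => hC (x, s)
      ⟨Metric.ball_subset_closedBall hx, ?_⟩
    rw [Set.uIoc_of_le zero_le_one] at hs
    exact ⟨hs.1.le, hs.2⟩
  · exact intervalIntegrable_const
  · refine Filter.Eventually.of_forall fun s _ x _ => ?_
    exact ((hG.differentiable one_ne_zero).differentiableAt.hasFDerivAt).comp x
      (hasFDerivAt_prodMk_left x s)

/-- An integral depending smoothly on a parameter is a smooth function of the parameter. -/
theorem contDiff_integral_param (n : ℕ) : ∀ {F : Type} [NormedAddCommGroup F] [NormedSpace ℝ F]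
    [CompleteSpace F] {G : E × ℝ → F}, ContDiff ℝ n G →
    ContDiff ℝ n fun x => ∫ s in (0 : ℝ)..1, G (x, s) := by
  induction n with
  | zero =>
    intro F _ _ _ G hG
    rw [Nat.cast_zero, contDiff_zero] at hG ⊢
    exact intervalIntegral.continuous_parametric_intervalIntegral_of_continuous'
      (f := fun x s => G (x, s)) hG 0 1
  | succ n ih =>
    intro F _ _ _ G hG
    have h1 : ContDiff ℝ 1 G := hG.of_le (by exact_mod_cast Nat.le_add_left 1 n)
    rw [Nat.cast_succ, contDiff_succ_iff_hasFDerivAt]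
    refine ⟨fun x => ∫ s in (0 : ℝ)..1, (fderiv ℝ G (x, s)).comp
      (ContinuousLinearMap.inl ℝ E ℝ), ?_, fun x => hasFDerivAt_integral_param h1 x⟩
    refine ih (G := fun p => (fderiv ℝ G p).comp (ContinuousLinearMap.inl ℝ E ℝ)) ?_
    exact (hG.fderiv_right (by simp)).clm_comp contDiff_const

/-- Hadamard's lemma: near `x₀`, a smooth function `g` is `g x₀ + ∑ᵢ (x - x₀)ᵢ hᵢ` with smooth
functions `hᵢ`. -/
theorem exists_hadamard {ι : Type} [Fintype ι] (b : Module.Basis ι ℝ E) {g : E → ℝ} {x₀ : E}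
    (hg : ∀ᶠ x in nhds x₀, ContDiffAt ℝ ∞ g x) :
    ∃ h : ι → E → ℝ, (∀ i, ContDiff ℝ ∞ (h i)) ∧
      ∀ᶠ x in nhds x₀, g x = g x₀ + ∑ i, b.coord i (x - x₀) * h i x := by
  obtain ⟨r, hr, hball⟩ := Metric.eventually_nhds_iff_ball.mp hg
  -- a cutoff makes `g` globally smooth without changing it near `x₀`
  let χ : ContDiffBump x₀ := ⟨r / 3, r / 2, by positivity, by linarith⟩
  let G : E → ℝ := fun x => χ x * g x
  have hG : ContDiff ℝ ∞ G := by
    rw [contDiff_iff_contDiffAt]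
    intro x
    by_cases hx : x ∈ Metric.ball x₀ r
    · exact χ.contDiffAt.mul (hball x hx)
    · have : x ∉ tsupport χ := by
        rw [χ.tsupport_eq]
        intro h
        exact hx (lt_of_le_of_lt (Metric.mem_closedBall.mp h) (by change r / 2 < r; linarith))
      have h0 := notMem_tsupport_iff_eventuallyEq.mp this
      refine (contDiffAt_const (c := (0 : ℝ))).congr_of_eventuallyEq ?_
      filter_upwards [h0] with y hy
      simp only [G, hy, Pi.zero_apply, zero_mul]
  have hGg : ∀ᶠ x in nhds x₀, G x = g x := by
    filter_upwards [χ.eventuallyEq_one] with x hx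
    simp only [G, hx, Pi.one_apply, one_mul]
  -- integrate the derivative of `G` along the segment from `x₀` to `x`
  refine ⟨fun i x => ∫ s in (0 : ℝ)..1, fderiv ℝ G (x₀ + s • (x - x₀)) (b i), fun i => ?_, ?_⟩
  · rw [contDiff_infty]
    intro n
    refine contDiff_integral_param n
      (G := fun p : E × ℝ => fderiv ℝ G (x₀ + p.2 • (p.1 - x₀)) (b i)) ?_
    have h1 : ContDiff ℝ n (fderiv ℝ G) := hG.fderiv_right (by exact_mod_cast le_top)
    exact (h1.comp (contDiff_const.add (contDiff_snd.smul (contDiff_fst.sub contDiff_const)))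
      ).clm_apply contDiff_const
  · have hx₀ := hGg.self_of_nhds
    filter_upwards [hGg] with x hx
    rw [← hx, ← hx₀]
    have hd : ∀ s : ℝ, HasDerivAt (fun s : ℝ => G (x₀ + s • (x - x₀)))
        (fderiv ℝ G (x₀ + s • (x - x₀)) (x - x₀)) s := by
      intro s
      have h1 : HasDerivAt (fun s : ℝ => x₀ + s • (x - x₀)) (x - x₀) s := by
        simpa using ((hasDerivAt_id s).smul_const (x - x₀)).const_add x₀
      exact ((hG.differentiable (by simp)).differentiableAt.hasFDerivAt).comp_hasDerivAt s h1
    have hcont : ∀ v, Continuous fun s : ℝ => fderiv ℝ G (x₀ + s • (x - x₀)) v := fun v =>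
      ((hG.continuous_fderiv (by simp)).comp (by fun_prop)).clm_apply continuous_const
    have hint := intervalIntegral.integral_eq_sub_of_hasDerivAt (a := 0) (b := 1)
      (fun s _ => hd s) ((hcont (x - x₀)).intervalIntegrable 0 1)
    simp only [one_smul, zero_smul, add_zero, add_sub_cancel] at hint
    have hcont' := fun i => hcont (b i)
    have hx : x - x₀ = ∑ i, b.coord i (x - x₀) • b i := (b.sum_repr _).symm
    rw [← sub_eq_iff_eq_add', ← hint]
    have e : ∀ s : ℝ, fderiv ℝ G (x₀ + s • (x - x₀)) (x - x₀) =
        ∑ i, b.coord i (x - x₀) * fderiv ℝ G (x₀ + s • (x - x₀)) (b i) := by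
      intro s
      conv_lhs => rw [hx, map_sum, ← hx]
      simp only [map_smul, smul_eq_mul]
    simp only [e]
    rw [intervalIntegral.integral_finsetSum
      (fun i _ => ((hcont' i).const_mul _).intervalIntegrable 0 1)]
    simp only [intervalIntegral.integral_const_mul]

end Hadamard

/-! ### Smooth sections -/

section Sections

variable {E : Type} [NormedAddCommGroup E] [NormedSpace ℝ E] {q : ℕ}

/-- The basis of the Grassmann algebra formed by the monomials in the generators. -/
noncomputable def Grass.monomials (q : ℕ) : Module.Basis (Finset (Fin q)) ℝ (Grass q) :=
  (Pi.basisFun ℝ (Fin q)).ExteriorAlgebra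

namespace smoothSections

variable {W : Opens E}

-- Without this shortcut, instance search tries at length to see these algebras as the sections of
-- some superspace.
noncomputable instance : Algebra ℝ (smoothSections E q W) := Subalgebra.algebra _

/-- A smooth real function as a smooth section. -/
noncomputable def scalar (g : E → ℝ) (hg : ∀ x ∈ W, ContDiffAt ℝ ∞ g x) :
    smoothSections E q W :=
  ⟨fun x => algebraMap ℝ _ (g x), IsSmoothSection.congr fun l x hx =>
    ⟨fun y => g y * l 1, (hg x hx).mul contDiffAt_const, Filter.Eventually.of_forall fun y _ => by
      rw [Algebra.algebraMap_eq_smul_one, map_smul, smul_eq_mul]⟩⟩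

variable (E q W) in
/-- Constant sections. -/
noncomputable def const : Grass q →ₐ[ℝ] smoothSections E q W where
  toFun z := ⟨fun _ => z, IsSmoothSection.congr fun l _ _ =>
    ⟨fun _ => l z, contDiffAt_const, Filter.Eventually.of_forall fun _ _ => rfl⟩⟩
  map_one' := rfl
  map_mul' _ _ := rfl
  map_zero' := rfl
  map_add' _ _ := rfl
  commutes' _ := rfl

/-- The value of a section at a point. -/
noncomputable def eval (x : W) : smoothSections E q W →ₐ[ℝ] Grass q where
  toFun f := f.1 x
  map_one' := rfl
  map_mul' _ _ := rfl
  map_zero' := rfl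
  map_add' _ _ := rfl
  commutes' _ := rfl

@[ext]
theorem ext {f g : smoothSections E q W} (h : ∀ x, f.1 x = g.1 x) : f = g :=
  Subtype.ext (funext h)

theorem sum_apply {ι : Type} (s : Finset ι) (f : ι → smoothSections E q W) (x : W) :
    (∑ i ∈ s, f i).1 x = ∑ i ∈ s, (f i).1 x := map_sum (eval x) f s

theorem contDiffAt (f : smoothSections E q W) (l : Grass q →ₗ[ℝ] ℝ) {x : E} (hx : x ∈ W) :
    ContDiffAt ℝ ∞ (fun y => l (extZero f.1 y)) x := f.2 l x hx

theorem differentiableAt (f : smoothSections E q W) (l : Grass q →ₗ[ℝ] ℝ) {x : E} (hx : x ∈ W) :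
    DifferentiableAt ℝ (fun y => l (extZero f.1 y)) x :=
  (contDiffAt f l hx).differentiableAt (by simp)

/-- Expansion of a section into monomials, with smooth real functions as coefficients. -/
theorem eq_sum_monomials (f : smoothSections E q W) :
    f = ∑ I, scalar (fun y => (Grass.monomials q).coord I (extZero f.1 y))
      (fun _ hx => contDiffAt f _ hx) * const E q W (Grass.monomials q I) := by
  ext x
  rw [sum_apply]
  change f.1 x = ∑ I, algebraMap ℝ _ ((Grass.monomials q).coord I (extZero f.1 x)) *
    Grass.monomials q I
  rw [extZero_apply f.1 x.2]
  conv_lhs => rw [← (Grass.monomials q).sum_repr (f.1 x)]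
  simp only [Algebra.smul_def, Module.Basis.coord_apply]

/-- An element of a Grassmann algebra is determined by its real components. -/
theorem _root_.Grass.ext_components {a b : Grass q} (h : ∀ l : Grass q →ₗ[ℝ] ℝ, l a = l b) :
    a = b :=
  (Grass.monomials q).ext_elem fun I => h ((Grass.monomials q).coord I)

theorem map_sum_fderiv (f : smoothSections E q W) (l : Grass q →ₗ[ℝ] ℝ) (x : W) (v : E) :
    l (∑ I, fderiv ℝ (fun y => (Grass.monomials q).coord I (extZero f.1 y)) x v •
      Grass.monomials q I) = fderiv ℝ (fun y => l (extZero f.1 y)) x v := by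
  have e : (fun y => l (extZero f.1 y)) = fun y => ∑ I,
      (Grass.monomials q).coord I (extZero f.1 y) * l (Grass.monomials q I) := by
    funext y
    conv_lhs => rw [← (Grass.monomials q).sum_repr (extZero f.1 y)]
    simp only [map_sum, map_smul, smul_eq_mul, Module.Basis.coord_apply]
  have hd := fun I => differentiableAt f ((Grass.monomials q).coord I) x.2
  rw [e, fderiv_fun_sum fun I _ => (hd I).mul_const _]
  simp only [map_sum, map_smul, smul_eq_mul, _root_.sum_apply]
  refine Finset.sum_congr rfl fun I _ => ?_
  rw [fderiv_mul_const (hd I)]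
  simp [mul_comm]

/-- The partial derivative in the direction `v`. -/
noncomputable def pd (v : E) : smoothSections E q W →ₗ[ℝ] smoothSections E q W where
  toFun f := ⟨fun x => ∑ I, fderiv ℝ
      (fun y => (Grass.monomials q).coord I (extZero f.1 y)) x v • Grass.monomials q I,
    IsSmoothSection.congr fun l x hx => ⟨fun y => fderiv ℝ (fun y => l (extZero f.1 y)) y v,
      ((contDiffAt f l hx).fderiv_right (by simp)).clm_apply contDiffAt_const,
      Filter.Eventually.of_forall fun y hy => map_sum_fderiv f l ⟨y, hy⟩ v⟩⟩
  map_add' f g := by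
    ext x
    refine Grass.ext_components fun l => ?_
    change l _ = l (_ + _)
    rw [map_sum_fderiv, map_add, map_sum_fderiv, map_sum_fderiv, ← add_apply,
      ← fderiv_fun_add (differentiableAt f _ x.2) (differentiableAt g _ x.2)]
    congr 1
    refine Filter.EventuallyEq.fderiv_eq ?_
    filter_upwards [W.2.mem_nhds x.2] with y hy
    rw [extZero_apply _ hy, extZero_apply _ hy, extZero_apply _ hy, ← map_add]
    rfl
  map_smul' r f := by
    ext x
    refine Grass.ext_components fun l => ?_
    change l _ = l (r • _)
    rw [map_sum_fderiv, map_smul, map_sum_fderiv, ← smul_apply,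
      ← fderiv_fun_const_smul (differentiableAt f _ x.2)]
    congr 1
    refine Filter.EventuallyEq.fderiv_eq ?_
    filter_upwards [W.2.mem_nhds x.2] with y hy
    rw [extZero_apply _ hy, extZero_apply _ hy, ← map_smul]
    rfl

/-- Partial derivatives are computed on real components. -/
theorem map_pd (v : E) (f : smoothSections E q W) (l : Grass q →ₗ[ℝ] ℝ) (x : W) :
    l ((pd v f).1 x) = fderiv ℝ (fun y => l (extZero f.1 y)) x v :=
  map_sum_fderiv f l x v

theorem pd_mul (v : E) (f g : smoothSections E q W) :
    pd v (f * g) = pd v f * g + f * pd v g := by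
  ext x
  refine Grass.ext_components fun l => ?_
  have expand : ∀ a b : Grass q, l (a * b) = ∑ I, ∑ J, ((Grass.monomials q).coord I a *
      (Grass.monomials q).coord J b) * l (Grass.monomials q I * Grass.monomials q J) := by
    intro a b
    conv_lhs => rw [← (Grass.monomials q).sum_repr a, ← (Grass.monomials q).sum_repr b]
    simp only [Finset.sum_mul_sum, map_sum, smul_mul_smul_comm, map_smul, smul_eq_mul,
      Module.Basis.coord_apply]
  have e : (fun y => l (extZero (f * g).1 y)) =ᶠ[nhds x.1] fun y => ∑ I, ∑ J,
      ((Grass.monomials q).coord I (extZero f.1 y) * (Grass.monomials q).coord J (extZero g.1 y)) *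
        l (Grass.monomials q I * Grass.monomials q J) := by
    filter_upwards [W.2.mem_nhds x.2] with y hy
    rw [extZero_apply _ hy, extZero_apply _ hy, extZero_apply _ hy, ← expand]
    rfl
  have hf := fun I => differentiableAt f ((Grass.monomials q).coord I) x.2
  have hg := fun I => differentiableAt g ((Grass.monomials q).coord I) x.2
  rw [map_pd, e.fderiv_eq, fderiv_fun_sum fun I _ => DifferentiableAt.fun_sum fun J _ =>
    ((hf I).fun_mul (hg J)).mul_const _]
  change _ = l ((pd v f).1 x * g.1 x + f.1 x * (pd v g).1 x)
  rw [map_add, expand, expand, ← Finset.sum_add_distrib, _root_.sum_apply]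
  refine Finset.sum_congr rfl fun I _ => ?_
  rw [fderiv_fun_sum fun J _ => ((hf I).fun_mul (hg J)).mul_const _, ← Finset.sum_add_distrib,
    _root_.sum_apply]
  refine Finset.sum_congr rfl fun J _ => ?_
  rw [fderiv_mul_const ((hf I).fun_mul (hg J)), fderiv_fun_mul (hf I) (hg J), map_pd, map_pd,
    extZero_apply _ x.2, extZero_apply _ x.2]
  simp only [smul_apply, add_apply, smul_eq_mul]
  ring

/-- A partial derivative of a section with values in a subspace has values in that subspace. -/
theorem pd_mem (p : Submodule ℝ (Grass q)) (v : E) (f : smoothSections E q W)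
    (hf : ∀ x, f.1 x ∈ p) (x : W) : (pd v f).1 x ∈ p := by
  by_contra h
  obtain ⟨l, hl, hp⟩ := Submodule.exists_le_ker_of_notMem h
  refine hl ?_
  rw [map_pd]
  have e : (fun y => l (extZero f.1 y)) =ᶠ[nhds x.1] fun _ => 0 := by
    filter_upwards [W.2.mem_nhds x.2] with y hy
    rw [extZero_apply _ hy]
    exact hp (hf ⟨y, hy⟩)
  rw [e.fderiv_eq, fderiv_fun_const]
  rfl

/-- Postcomposition of a section with a linear map. -/
noncomputable def mapLin {q' : ℕ} (P : Grass q →ₗ[ℝ] Grass q') :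
    smoothSections E q W →ₗ[ℝ] smoothSections E q' W where
  toFun f := ⟨fun x => P (f.1 x), IsSmoothSection.congr fun l x hx =>
    ⟨_, contDiffAt f (l.comp P) hx, Filter.Eventually.of_forall fun y hy => by
      simp [extZero_apply _ hy]⟩⟩
  map_add' f g := by
    ext x
    exact map_add P _ _
  map_smul' r f := by
    ext x
    exact map_smul P _ _

theorem pd_mapLin (v : E) {q' : ℕ} (P : Grass q →ₗ[ℝ] Grass q') (f : smoothSections E q W) :
    pd v (mapLin P f) = mapLin P (pd v f) := by
  ext x
  refine Grass.ext_components fun l => ?_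
  change _ = (l.comp P) ((pd v f).1 x)
  rw [map_pd, map_pd]
  congr 1
  refine Filter.EventuallyEq.fderiv_eq ?_
  filter_upwards [W.2.mem_nhds x.2] with y hy
  rw [extZero_apply _ hy, extZero_apply _ hy]
  rfl

/-- Restriction of sections. -/
noncomputable def restr {U : Opens E} (h : U ≤ W) :
    smoothSections E q W →ₐ[ℝ] smoothSections E q U := (modelSpace E q).res h

theorem restr_apply {U : Opens E} (h : U ≤ W) (f : smoothSections E q W) (x : U) :
    (restr h f).1 x = f.1 ⟨x.1, h x.2⟩ := rfl

theorem pd_restr (v : E) {U : Opens E} (h : U ≤ W) (f : smoothSections E q W) :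
    pd v (restr h f) = restr h (pd v f) := by
  ext x
  refine Grass.ext_components fun l => ?_
  rw [restr_apply, map_pd, map_pd]
  congr 1
  refine Filter.EventuallyEq.fderiv_eq ?_
  filter_upwards [U.2.mem_nhds x.2] with y hy
  rw [extZero_apply _ hy, extZero_apply _ (h hy)]
  rfl

theorem pd_scalar (v : E) (g : E → ℝ) (hg : ∀ x ∈ W, ContDiffAt ℝ ∞ g x) (x : W) :
    (pd v (scalar (q := q) g hg)).1 x = algebraMap ℝ _ (fderiv ℝ g x v) := by
  refine Grass.ext_components fun l => ?_
  have e : (fun y => l (extZero (scalar (q := q) g hg).1 y)) =ᶠ[nhds x.1] fun y => g y * l 1 := by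
    filter_upwards [W.2.mem_nhds x.2] with y hy
    rw [extZero_apply _ hy]
    change l (algebraMap ℝ _ (g y)) = _
    rw [Algebra.algebraMap_eq_smul_one, map_smul, smul_eq_mul]
  rw [map_pd, e.fderiv_eq, fderiv_mul_const ((hg x x.2).differentiableAt (by simp)),
    Algebra.algebraMap_eq_smul_one, map_smul, smul_apply, smul_eq_mul, smul_eq_mul, mul_comm]

/-- A section whose values have nonzero body is invertible: it is the sum of its body and a nilpotent
section. -/
theorem isUnit_of_body_ne_zero (f : smoothSections E q W)
    (hf : ∀ x, Grass.body q (f.1 x) ≠ 0) : IsUnit f := by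
  have hsm : ∀ x ∈ W, ContDiffAt ℝ ∞ (fun y => Grass.body q (extZero f.1 y)) x :=
    fun x hx => contDiffAt f (Grass.body q).toLinearMap hx
  have hne : ∀ x ∈ W, Grass.body q (extZero f.1 x) ≠ 0 := fun x hx => by
    rw [extZero_apply _ hx]
    exact hf _
  let c : smoothSections E q W := scalar _ hsm
  let d : smoothSections E q W := scalar (fun y => (Grass.body q (extZero f.1 y))⁻¹)
    fun x hx => (hsm x hx).inv (hne x hx)
  have hcd : c * d = 1 := by
    ext x
    change algebraMap ℝ (Grass q) _ * algebraMap ℝ (Grass q) _ = 1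
    rw [← map_mul, mul_inv_cancel₀ (hne x x.2), map_one]
  have hcomm : ∀ g : smoothSections E q W, Commute c g := fun g => by
    ext x
    exact Algebra.commutes (A := Grass q) _ _
  have hc : IsUnit c := ⟨⟨c, d, hcd, (hcomm d).symm.trans hcd⟩, rfl⟩
  have hn : IsNilpotent (f - c) := by
    refine ⟨q + 1, ?_⟩
    ext x
    change (eval x) ((f - c) ^ (q + 1)) = 0
    rw [map_pow]
    have h1 : eval x (f - c) ∈ Grass.aug q := by
      change f.1 x - algebraMap ℝ (Grass q) (Grass.body q (extZero f.1 x)) ∈ _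
      rw [extZero_apply _ x.2]
      exact Grass.sub_body_mem_aug _
    have := Submodule.pow_mem_pow _ h1 (q + 1)
    rwa [Grass.aug_pow_eq_bot, Submodule.mem_bot] at this
  have := hn.isUnit_add_left_of_commute hc (hcomm _).symm
  simpa using this

theorem mem_gr_iff {i : ZMod 2} {f : smoothSections E q W} :
    f ∈ gr (A := smoothSections E q W) i ↔ ∀ x, f.1 x ∈ Grass.part q i := Iff.rfl

end smoothSections

end Sections

/-! ### Values of functions on supermanifolds -/

namespace SuperSpace

section ValAt

variable {E : Type} [NormedAddCommGroup E] [NormedSpace ℝ E] {q : ℕ} {U : Opens E}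
  {X Y : SuperSpace}

/-- The value at `y`, in the Grassmann algebra, of the pullback of a section along a morphism from
a domain in `E^{|q}`. -/
noncomputable def valAt (F : Hom ((modelSpace E q).restrict U) X) (y : U) (W : Opens X.pt)
    (h : F.base y ∈ W) : X.O W →ₐ[ℝ] Grass q :=
  (smoothSections.eval (W := img U (F.pre W)) ⟨y.1, y, h, rfl⟩).comp
    (F.pull W (F.pre W) fun _ hx => hx)

theorem valAt_eq (F : Hom ((modelSpace E q).restrict U) X) (y : U) (W : Opens X.pt)
    (h : F.base y ∈ W) (C : Opens U) (hC : ∀ x ∈ C, F.base x ∈ W) (hy : y ∈ C) (f : X.O W) :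
    valAt F y W h f =
      smoothSections.eval (W := img U C) ⟨y.1, y, hy, rfl⟩ (F.pull W C hC f) := by
  have hle : C ≤ F.pre W := fun x hx => hC x hx
  have := F.res_pull (V := W) hle (fun _ hx => hx) f
  rw [← this]
  rfl

theorem valAt_res (F : Hom ((modelSpace E q).restrict U) X) (y : U) {W W' : Opens X.pt}
    (hW : W' ≤ W) (h : F.base y ∈ W') (f : X.O W) :
    valAt F y W' h (X.res hW f) = valAt F y W (hW h) f := by
  rw [valAt_eq F y W (hW h) (F.pre W') (fun x hx => hW hx) h]
  exact congrArg (smoothSections.eval (W := img U (F.pre W')) ⟨y.1, y, h, rfl⟩)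
    (F.pull_res' hW (fun _ hx => hx) f)

theorem valAt_pull (F : Hom ((modelSpace E q).restrict U) X) (G : Hom X Y) (y : U)
    (V : Opens Y.pt) (W : Opens X.pt) (h : F.base y ∈ W) (hG : ∀ x ∈ W, G.base x ∈ V) (f : Y.O V) :
    valAt F y W h (G.pull V W hG f) = valAt (F.comp G) y V (hG _ h) f := by
  have hx : ∀ x ∈ F.pre W, (F.comp G).base x ∈ V := fun x hx => hG _ hx
  rw [valAt_eq (F.comp G) y V (hG _ h) (F.pre W) hx h,
    F.comp_pull G V W (F.pre W) hx (fun _ hx => hx) hG]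
  rfl

end ValAt

end SuperSpace

namespace SuperMfd

open SuperSpace

/-- A local chart of a supermanifold. -/
structure Patch (T : SuperMfd) where
  E : Type
  [normed : NormedAddCommGroup E]
  [space : NormedSpace ℝ E]
  [finite : FiniteDimensional ℝ E]
  q : ℕ
  U : Opens E
  φ : Hom ((modelSpace E q).restrict U) T.X
  emb : φ.IsOpenEmb

attribute [instance] Patch.normed Patch.space Patch.finite

variable {T : SuperMfd}

theorem exists_patch (x : T.X.pt) : ∃ c : Patch T, ∃ y : c.U, c.φ.base y = x := by
  obtain ⟨E, i1, i2, i3, q, U, φ, hφ, y, hy⟩ := T.chart x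
  exact ⟨⟨E, q, U, φ, hφ⟩, y, hy⟩

/-- The open set covered by a chart. -/
def Patch.range (c : Patch T) : Opens T.X.pt := ⟨Set.range c.φ.base, c.emb.1.isOpen_range⟩

theorem Patch.ext_on (c : Patch T) {W : Opens T.X.pt} (hW : W ≤ c.range) (f g : T.X.O W)
    (h : ∀ (y : c.U) (hy : c.φ.base y ∈ W), valAt c.φ y W hy f = valAt c.φ y W hy g) : f = g := by
  refine (c.emb.2 W hW).1 ?_
  refine smoothSections.ext (W := img c.U (c.φ.pre W)) ?_
  rintro ⟨_, y, hy, rfl⟩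
  exact h y hy

/-- Sections over a supermanifold are determined by their values in charts. -/
theorem section_ext {W : Opens T.X.pt} (f g : T.X.O W)
    (h : ∀ (c : Patch T) (y : c.U) (hy : c.φ.base y ∈ W),
      valAt c.φ y W hy f = valAt c.φ y W hy g) : f = g := by
  refine eq_of_locally_eq f g fun x hx => ?_
  obtain ⟨c, y, rfl⟩ := exists_patch x
  refine ⟨c.range ⊓ W, inf_le_right, ⟨⟨y, rfl⟩, hx⟩, ?_⟩
  refine c.ext_on inf_le_left _ _ fun y' hy' => ?_
  rw [valAt_res, valAt_res]
  exact h c y' hy'.2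

/-- A section whose value at a point has nonzero body is invertible near that point. -/
theorem Patch.exists_isUnit (c : Patch T) (y : c.U) {W : Opens T.X.pt} (hy : c.φ.base y ∈ W)
    (f : T.X.O W) (hf : Grass.body c.q (valAt c.φ y W hy f) ≠ 0) :
    ∃ (W' : Opens T.X.pt) (h : W' ≤ W), c.φ.base y ∈ W' ∧ IsUnit (T.X.res h f) := by
  let g : smoothSections c.E c.q (img c.U (c.φ.pre W)) := c.φ.pull W (c.φ.pre W) (fun _ hx => hx) f
  let A : Set c.U := {z | z ∈ c.φ.pre W ∧ Grass.body c.q (extZero g.1 z.1) ≠ 0}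
  have hA : IsOpen A := by
    rw [isOpen_iff_mem_nhds]
    rintro z ⟨hz, hz'⟩
    have h1 : ContinuousAt (fun w => Grass.body c.q (extZero g.1 w)) z.1 :=
      (smoothSections.contDiffAt g (Grass.body c.q).toLinearMap ⟨z, hz, rfl⟩).continuousAt
    have h2 := (h1.comp continuous_subtype_val.continuousAt).eventually_ne hz'
    filter_upwards [h2, (c.φ.pre W).2.mem_nhds hz] with w hw hw'
    exact ⟨hw', hw⟩
  -- `W'` is the part of `W` inside the chart on which the body of `f` does not vanish
  let W' : Opens T.X.pt := ⟨c.φ.base '' A, c.emb.1.isOpenMap _ hA⟩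
  have hW' : W' ≤ W := by
    rintro _ ⟨z, hz, rfl⟩
    exact hz.1
  have hyA : y ∈ A := by
    refine ⟨hy, ?_⟩
    rw [extZero_apply (W := img c.U (c.φ.pre W)) _ ⟨y, hy, rfl⟩]
    exact hf
  refine ⟨W', hW', ⟨y, hyA, rfl⟩, ?_⟩
  have hbij := c.emb.2 W' (Set.image_subset_range _ _)
  let e := AlgEquiv.ofBijective (c.φ.pull W' (c.φ.pre W') fun _ hx => hx) hbij
  rw [← MulEquiv.isUnit_map e]
  refine smoothSections.isUnit_of_body_ne_zero (W := img c.U (c.φ.pre W')) _ ?_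
  rintro ⟨_, z, hz, rfl⟩
  have hzA : z ∈ A := by
    obtain ⟨w, hw, e⟩ := hz
    rwa [← c.emb.1.injective e]
  have h3 : (e (T.X.res hW' f) : smoothSections c.E c.q (img c.U (c.φ.pre W'))).1 ⟨z.1, z, hz, rfl⟩
      = valAt c.φ z W (hW' hz) f := valAt_res c.φ z hW' hz f
  refine fun h0 => ?_
  have h4 := (congrArg (Grass.body c.q) h3).symm.trans h0
  have := hzA.2
  rw [extZero_apply (W := img c.U (c.φ.pre W)) _ ⟨z, hzA.1, rfl⟩] at this
  exact this h4

/-- A chosen chart around a point. -/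
noncomputable def patchAt (x : T.X.pt) : Patch T := (exists_patch x).choose

/-- The point of the chosen chart that corresponds to the given point. -/
noncomputable def patchPt (x : T.X.pt) : (patchAt x).U := (exists_patch x).choose_spec.choose

theorem base_patchPt (x : T.X.pt) : (patchAt x).φ.base (patchPt x) = x :=
  (exists_patch x).choose_spec.choose_spec

/-- The value of a section at a point, as a real number. It is computed in the chosen chart; by
`eq_ev` the chart does not matter. -/
noncomputable def ev (x : T.X.pt) (W : Opens T.X.pt) (h : x ∈ W) : T.X.O W →ₐ[ℝ] ℝ :=
  (Grass.body _).comp (valAt (patchAt x).φ (patchPt x) W ((base_patchPt x).symm ▸ h))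

theorem ev_res (x : T.X.pt) {W W' : Opens T.X.pt} (hW : W' ≤ W) (h : x ∈ W') (f : T.X.O W) :
    ev x W' h (T.X.res hW f) = ev x W (hW h) f :=
  congrArg (Grass.body _) (valAt_res _ _ hW ((base_patchPt x).symm ▸ h) f)

/-- A section with nonzero value at a point is invertible near that point. -/
theorem exists_isUnit_of_ev_ne_zero {x : T.X.pt} {W : Opens T.X.pt} (hx : x ∈ W) {f : T.X.O W}
    (hf : ev x W hx f ≠ 0) :
    ∃ (W' : Opens T.X.pt) (h : W' ≤ W), x ∈ W' ∧ IsUnit (T.X.res h f) := by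
  obtain ⟨W', h, h', hu⟩ := Patch.exists_isUnit _ _ ((base_patchPt x).symm ▸ hx) f hf
  exact ⟨W', h, base_patchPt x ▸ h', hu⟩

/-- There is only one way to evaluate germs of functions at a point, because a germ with nonzero
value is invertible. -/
theorem eq_ev (x : T.X.pt) (e : ∀ W : Opens T.X.pt, x ∈ W → T.X.O W →ₐ[ℝ] ℝ)
    (he : ∀ (W W' : Opens T.X.pt) (hW : W' ≤ W) (h : x ∈ W') (f : T.X.O W),
      e W' h (T.X.res hW f) = e W (hW h) f) (W : Opens T.X.pt) (h : x ∈ W) (f : T.X.O W) :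
    e W h f = ev x W h f := by
  by_contra hne
  have h1 : ev x W h (f - algebraMap ℝ _ (e W h f)) ≠ 0 := by
    rw [map_sub, AlgHom.commutes, sub_ne_zero]
    exact fun h => hne h.symm
  obtain ⟨W', hW', hx, hu⟩ := exists_isUnit_of_ev_ne_zero h h1
  have h2 := hu.map (e W' hx)
  rw [he, map_sub, AlgHom.commutes, Algebra.algebraMap_self, RingHom.id_apply, sub_self] at h2
  exact not_isUnit_zero h2

theorem ev_pull {S : SuperMfd} (F : Hom T.X S.X) (x : T.X.pt) (V : Opens S.X.pt)
    (W : Opens T.X.pt) (hx : x ∈ W) (h : ∀ x ∈ W, F.base x ∈ V) (f : S.X.O V) :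
    ev x W hx (F.pull V W h f) = ev (F.base x) V (h x hx) f := by
  have key := eq_ev (F.base x) (fun V hV => (ev x (F.pre V) hV).comp (F.pull V (F.pre V)
    fun _ hx => hx)) (by
      intro V V' hV hx f
      have hle : F.pre V' ≤ F.pre V := fun _ hx => hV hx
      have a1 := F.pull_res' hV (U := F.pre V') (fun _ hx => hx) f
      have a2 := F.res_pull (V := V) hle (fun _ hx => hx) f
      exact (congrArg (ev x (F.pre V') hx) (a1.trans a2.symm)).trans (ev_res x hle hx _)) V (h x hx) f
  rw [← key]
  have hle : W ≤ F.pre V := fun x hx => h x hx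
  rw [← F.res_pull (V := V) hle (fun _ hx => hx), ev_res]
  rfl

/-- The set of points where a function does not vanish. -/
def nonvanishing (f : T.Fun) : Opens T.X.pt where
  carrier := {x | ev x ⊤ trivial f ≠ 0}
  is_open' := by
    rw [isOpen_iff_mem_nhds]
    intro x hx
    obtain ⟨W, hW, hxW, hu⟩ := exists_isUnit_of_ev_ne_zero (T := T) (W := ⊤) trivial hx
    filter_upwards [W.2.mem_nhds hxW] with y hy
    have := hu.map (ev y W hy)
    rw [ev_res] at this
    exact this.ne_zero

/-! ### Open sub-supermanifolds -/

/-- The open sub-supermanifold on an open set. -/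
def restrict (T : SuperMfd) (W : Opens T.X.pt) : SuperMfd where
  X := T.X.restrict W
  t2 := have := T.t2; inferInstanceAs (T2Space W)
  sc := have := T.sc; inferInstanceAs (SecondCountableTopology W)
  chart x := by
    obtain ⟨c, y, hy⟩ := exists_patch x.1
    let U' : Opens c.E := img c.U (c.φ.pre W)
    have hU : U' ≤ c.U := by
      rintro _ ⟨z, hz, rfl⟩
      exact z.2
    let F : Hom ((modelSpace c.E c.q).restrict U') T.X :=
      ((modelSpace c.E c.q).inclLE hU).comp c.φ
    have hF : F.IsOpenEmb := ((modelSpace c.E c.q).inclLE_isOpenEmb hU).comp c.emb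
    have base : ∀ z : U', F.base z = c.φ.base ⟨z.1, hU z.2⟩ := fun z =>
      congrArg c.φ.base ((modelSpace c.E c.q).base_inclLE hU z)
    have hr : ∀ z, F.base z ∈ Set.range (T.X.incl W).base := by
      rintro ⟨_, z, hz, rfl⟩
      exact ⟨⟨c.φ.base z, hz⟩, (base ⟨z.1, z, hz, rfl⟩).symm⟩
    refine ⟨c.E, inferInstance, inferInstance, inferInstance, c.q, U',
      (T.X.incl_isOpenEmb W).lift F hr, ?_, ⟨⟨y.1, y, ?_, rfl⟩, ?_⟩⟩
    · refine (T.X.incl_isOpenEmb W).of_comp ?_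
      rw [Hom.IsOpenEmb.lift_comp]
      exact hF
    · change c.φ.base y ∈ W
      rw [hy]
      exact x.2
    · refine Subtype.ext ?_
      refine ((T.X.incl_isOpenEmb W).base_lift F hr _).trans ?_
      exact (base _).trans hy

/-- The model supermanifold `E^{|q}`. -/
noncomputable def model (E : Type) [NormedAddCommGroup E] [NormedSpace ℝ E]
    [FiniteDimensional ℝ E] (q : ℕ) : SuperMfd where
  X := modelSpace E q
  t2 := inferInstanceAs (T2Space E)
  sc := have : ProperSpace E := FiniteDimensional.proper ℝ E
    inferInstanceAs (SecondCountableTopology E)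
  chart x := ⟨E, inferInstance, inferInstance, inferInstance, q, ⊤,
    SuperSpace.incl (modelSpace E q) ⊤, SuperSpace.incl_isOpenEmb _ _, ⟨⟨x, trivial⟩, rfl⟩⟩

theorem ev_model {E : Type} [NormedAddCommGroup E] [NormedSpace ℝ E] [FiniteDimensional ℝ E]
    {q : ℕ} (x : E) (W : Opens E) (h : x ∈ W) (f : smoothSections E q W) :
    ev (T := model E q) (x : (modelSpace E q).pt) W h f = Grass.body q (f.1 ⟨x, h⟩) :=
  (eq_ev (T := model E q) (x : (modelSpace E q).pt)
    (fun W h => (Grass.body q).comp (smoothSections.eval (E := E) (q := q) (W := W) ⟨x, h⟩))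
    (fun _ _ _ _ _ => rfl) W h f).symm

end SuperMfd

/-! ### Algebra maps from germs of functions are determined by the coordinates -/

namespace smoothSections

variable {E : Type} [NormedAddCommGroup E] [NormedSpace ℝ E] {q : ℕ} {ι : Type}

theorem contDiffAt_coord [FiniteDimensional ℝ E] (b : Module.Basis ι ℝ E) (i : ι) (x : E) :
    ContDiffAt ℝ ∞ (fun y => b.coord i y) x :=
  (LinearMap.toContinuousLinearMap (b.coord i)).contDiff.contDiffAt

/-- The coordinate functions on `E`, as smooth sections. -/
noncomputable def coord [FiniteDimensional ℝ E] (q : ℕ) (b : Module.Basis ι ℝ E) (i : ι)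
    (V : Opens E) : smoothSections E q V :=
  scalar (fun y => b.coord i y) fun x _ => contDiffAt_coord b i x

/-- The real part of an algebra map from the germs of functions at a point to a Grassmann algebra
is the evaluation at the point. -/
theorem body_germ [FiniteDimensional ℝ E] {q' : ℕ} {x₀ : E}
    (χ : ∀ V : Opens E, x₀ ∈ V → smoothSections E q V →ₐ[ℝ] Grass q')
    (hχ : ∀ (V V' : Opens E) (h : V' ≤ V) (hx : x₀ ∈ V') (f : smoothSections E q V),
      χ V' hx (restr h f) = χ V (h hx) f) (V : Opens E) (hx : x₀ ∈ V)
    (f : smoothSections E q V) : Grass.body q' (χ V hx f) = Grass.body q (f.1 ⟨x₀, hx⟩) := by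
  rw [← SuperMfd.ev_model]
  exact SuperMfd.eq_ev (T := SuperMfd.model E q) (x₀ : (modelSpace E q).pt)
    (fun V h => (Grass.body q').comp (χ V h))
    (fun V V' h hx f => congrArg (Grass.body q') (hχ V V' h hx f)) V hx f

/-- Algebra maps from the germs of functions at a point to a Grassmann algebra are determined by
their values on the coordinates: by Hadamard's lemma, two maps with the same values on the
coordinates agree modulo every power of the augmentation ideal. -/
theorem germ_hom_unique [FiniteDimensional ℝ E] [Fintype ι] (b : Module.Basis ι ℝ E) {q' : ℕ}
    {x₀ : E} (χ₁ χ₂ : ∀ V : Opens E, x₀ ∈ V → smoothSections E q V →ₐ[ℝ] Grass q')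
    (h₁ : ∀ (V V' : Opens E) (h : V' ≤ V) (hx : x₀ ∈ V') (f : smoothSections E q V),
      χ₁ V' hx (restr h f) = χ₁ V (h hx) f)
    (h₂ : ∀ (V V' : Opens E) (h : V' ≤ V) (hx : x₀ ∈ V') (f : smoothSections E q V),
      χ₂ V' hx (restr h f) = χ₂ V (h hx) f)
    (hx : ∀ i, χ₁ ⊤ trivial (coord q b i ⊤) = χ₂ ⊤ trivial (coord q b i ⊤))
    (hθ : ∀ v, χ₁ ⊤ trivial (const E q ⊤ (ExteriorAlgebra.ι ℝ v)) =
      χ₂ ⊤ trivial (const E q ⊤ (ExteriorAlgebra.ι ℝ v)))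
    (V : Opens E) (hV : x₀ ∈ V) (f : smoothSections E q V) : χ₁ V hV f = χ₂ V hV f := by
  have hx' : ∀ i V hV, χ₁ V hV (coord q b i V) = χ₂ V hV (coord q b i V) := fun i V hV => by
    have := hx i
    rwa [← h₁ ⊤ V le_top hV, ← h₂ ⊤ V le_top hV] at this
  have hc : ∀ (V : Opens E) (hV : x₀ ∈ V) (z : Grass q),
      χ₁ V hV (const E q V z) = χ₂ V hV (const E q V z) := by
    intro V hV z
    have : (χ₁ V hV).comp (const E q V) = (χ₂ V hV).comp (const E q V) := by
      refine ExteriorAlgebra.hom_ext (LinearMap.ext fun v => ?_)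
      have := hθ v
      rw [← h₁ ⊤ V le_top hV, ← h₂ ⊤ V le_top hV] at this
      exact this
    exact DFunLike.congr_fun this z
  -- for functions without odd variables, Hadamard's lemma gains one power of the augmentation ideal
  have key : ∀ (k : ℕ) (V : Opens E) (hV : x₀ ∈ V) (g : E → ℝ)
      (hg : ∀ x ∈ V, ContDiffAt ℝ ∞ g x),
      χ₁ V hV (scalar g hg) - χ₂ V hV (scalar g hg) ∈ Grass.aug q' ^ (k + 1) := by
    intro k
    induction k with
    | zero =>
      intro V hV g hg
      rw [zero_add, pow_one, Grass.mem_aug, map_sub, body_germ χ₁ h₁, body_germ χ₂ h₂, sub_self]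
    | succ k ih =>
      intro V hV g hg
      obtain ⟨h, hh, hgh⟩ := exists_hadamard b (x₀ := x₀)
        (Filter.eventually_of_mem (V.2.mem_nhds hV) hg)
      obtain ⟨A, hA, hAo, hxA⟩ := eventually_nhds_iff.mp hgh
      let V' : Opens E := ⟨A, hAo⟩ ⊓ V
      have hV' : x₀ ∈ V' := ⟨hxA, hV⟩
      have hle : V' ≤ V := inf_le_right
      have e : restr hle (scalar (q := q) g hg) = algebraMap ℝ _ (g x₀) +
          ∑ i, (coord q b i V' - algebraMap ℝ _ (b.coord i x₀)) *
            scalar (h i) fun x _ => (hh i).contDiffAt := by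
        ext x
        refine Eq.trans (congrArg (algebraMap ℝ (Grass q)) (hA x.1 x.2.1)) ?_
        rw [map_add, map_sum]
        refine congrArg₂ (· + ·) rfl (Eq.trans ?_ (sum_apply _ _ _).symm)
        refine Finset.sum_congr rfl fun i _ => ?_
        rw [map_mul, map_sub, map_sub]
        rfl
      rw [← h₁ V V' hle hV', ← h₂ V V' hle hV', e, map_add, map_add, AlgHom.commutes,
        AlgHom.commutes, add_sub_add_left_eq_sub, map_sum, map_sum, ← Finset.sum_sub_distrib]
      refine Submodule.sum_mem _ fun i _ => ?_
      rw [map_mul, map_mul, map_sub, map_sub, AlgHom.commutes, AlgHom.commutes, hx' i V' hV',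
        ← mul_sub]
      refine Grass.aug_mul_mem ?_ (ih V' hV' _ _)
      rw [Grass.mem_aug, map_sub, body_germ χ₂ h₂, Grass.body_algebraMap]
      exact sub_eq_zero.mpr (Grass.body_algebraMap _)
  have hs : ∀ (V : Opens E) (hV : x₀ ∈ V) (g : E → ℝ) (hg : ∀ x ∈ V, ContDiffAt ℝ ∞ g x),
      χ₁ V hV (scalar g hg) = χ₂ V hV (scalar g hg) := fun V hV g hg => by
    have := key q' V hV g hg
    rwa [Grass.aug_pow_eq_bot, Submodule.mem_bot, sub_eq_zero] at this
  rw [eq_sum_monomials f, map_sum, map_sum]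
  refine Finset.sum_congr rfl fun I _ => ?_
  rw [map_mul, map_mul, hs, hc]

end smoothSections

/-! ### Exponentials of nilpotent derivations -/

/-- The exponential of a nilpotent derivation, as an algebra map. -/
noncomputable def expDerivation {B : Type} [Ring B] [Algebra ℝ B] (D : B →ₗ[ℝ] B)
    (hD : ∀ x y, D (x * y) = x * D y + D x * y) (n : ℕ) (hn : D ^ n = 0) : B →ₐ[ℝ] B :=
  AlgHom.ofLinearMap (∑ k ∈ Finset.range n, ((k.factorial : ℝ)⁻¹) • D ^ k)
    (by
      have h1 : D 1 = 0 := by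
        have := hD 1 1
        simpa using this
      have : D ^ (n + 1) = 0 := by rw [pow_succ, hn, zero_mul]
      rw [LinearMap.sum_apply]
      rcases n with _ | n
      · have h : (1 : B →ₗ[ℝ] B) = 0 := by rwa [pow_zero] at hn
        have h2 : (1 : B) = 0 := LinearMap.congr_fun h 1
        rw [Finset.range_zero, Finset.sum_empty, h2]
      · rw [Finset.sum_range_succ', Finset.sum_eq_zero]
        · simp
        · intro k _
          rw [LinearMap.smul_apply, pow_succ, Module.End.mul_apply, h1, map_zero, smul_zero])
    (by
      intro x y
      let _ : Module ℚ B := Module.compHom B (algebraMap ℚ ℝ)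
      have e : ∑ k ∈ Finset.range n, ((k.factorial : ℝ)⁻¹) • D ^ k = IsNilpotent.exp D := by
        rw [IsNilpotent.exp_eq_sum hn]
        refine Finset.sum_congr rfl fun k _ => LinearMap.ext fun z => ?_
        change (k.factorial : ℝ)⁻¹ • (D ^ k) z =
          (algebraMap ℚ ℝ (k.factorial : ℚ)⁻¹) • (D ^ k) z
        simp
      rw [e]
      exact Module.End.exp_mul_of_derivation ℝ B D hD ⟨n, hn⟩ x y)

theorem expDerivation_apply {B : Type} [Ring B] [Algebra ℝ B] (D : B →ₗ[ℝ] B)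
    (hD : ∀ x y, D (x * y) = x * D y + D x * y) (n : ℕ) (hn : D ^ n = 0) (x : B) :
    expDerivation D hD n hn x = ∑ k ∈ Finset.range n, ((k.factorial : ℝ)⁻¹) • (D ^ k) x := by
  simp [expDerivation]

theorem expDerivation_eq_add {B : Type} [Ring B] [Algebra ℝ B] (D : B →ₗ[ℝ] B)
    (hD : ∀ x y, D (x * y) = x * D y + D x * y) (n : ℕ) (hn : D ^ n = 0) (x : B)
    (hx : D (D x) = 0) : expDerivation D hD n hn x = x + D x := by
  have h : ∀ k, (D ^ (k + 2)) x = 0 := fun k => by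
    rw [pow_add, Module.End.mul_apply, pow_two, Module.End.mul_apply, hx, map_zero]
  rw [expDerivation_apply]
  have hext : ∑ k ∈ Finset.range n, ((k.factorial : ℝ)⁻¹) • (D ^ k) x =
      ∑ k ∈ Finset.range (n + 2), ((k.factorial : ℝ)⁻¹) • (D ^ k) x := by
    rw [Finset.sum_range_add]
    refine (add_eq_left.mpr (Finset.sum_eq_zero fun k _ => ?_)).symm
    rw [add_comm, pow_add, hn, mul_zero, LinearMap.zero_apply, smul_zero]
  rw [hext, Finset.sum_range_succ', Finset.sum_range_succ', Finset.sum_eq_zero fun k _ => by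
    rw [h k, smul_zero]]
  simp [add_comm]

/-! ### Points of the model spaces with coordinates in a superalgebra -/

/-- Points of `E^{|q}` with coordinates in a superalgebra `A`, for a basis of `E` indexed by `ι`:
families of even elements and of odd elements. -/
structure ModelPt (ι : Type) (q : ℕ) (A : Type) [Ring A] [Algebra ℝ A] [SuperAlgebra A] where
  x : ι → A
  θ : (Fin q → ℝ) →ₗ[ℝ] A
  even : ∀ i, x i ∈ gr (A := A) 0
  odd : ∀ v, θ v ∈ gr (A := A) 1

/-- The action of a parity preserving algebra map on points. -/
def ModelPt.map {ι : Type} {q : ℕ} {A B : Type} [Ring A] [Algebra ℝ A] [SuperAlgebra A] [Ring B]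
    [Algebra ℝ B] [SuperAlgebra B] (p : ModelPt ι q A) (f : A →ₐ[ℝ] B)
    (hf : ∀ i, ∀ a ∈ gr (A := A) i, f a ∈ gr (A := B) i) : ModelPt ι q B where
  x i := f (p.x i)
  θ := f.toLinearMap.comp p.θ
  even i := hf 0 _ (p.even i)
  odd v := hf 1 _ (p.odd v)

/-- The algebra map from the Grassmann algebra given by the odd coordinates of a point. -/
noncomputable def ModelPt.gen {ι : Type} {q : ℕ} {A : Type} [Ring A] [Algebra ℝ A]
    [SuperAlgebra A] (p : ModelPt ι q A) : Grass q →ₐ[ℝ] A :=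
  ExteriorAlgebra.lift ℝ ⟨p.θ, fun v => SuperAlgebra.odd_sq (p.odd v)⟩

theorem ModelPt.gen_ι {ι : Type} {q : ℕ} {A : Type} [Ring A] [Algebra ℝ A]
    [SuperAlgebra A] (p : ModelPt ι q A) (v : Fin q → ℝ) :
    p.gen (ExteriorAlgebra.ι ℝ v) = p.θ v := ExteriorAlgebra.lift_ι_apply ℝ _ _ _

theorem ModelPt.gen_map {ι : Type} {q : ℕ} {A B : Type} [Ring A] [Algebra ℝ A] [SuperAlgebra A]
    [Ring B] [Algebra ℝ B] [SuperAlgebra B] (p : ModelPt ι q A) (f : A →ₐ[ℝ] B)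
    (hf : ∀ i, ∀ a ∈ gr (A := A) i, f a ∈ gr (A := B) i) (z : Grass q) :
    (p.map f hf).gen z = f (p.gen z) := by
  have : (p.map f hf).gen = f.comp p.gen :=
    ExteriorAlgebra.hom_ext (LinearMap.ext fun v => by
      change (p.map f hf).gen (ExteriorAlgebra.ι ℝ v) = f (p.gen (ExteriorAlgebra.ι ℝ v))
      rw [ModelPt.gen_ι, ModelPt.gen_ι]
      rfl)
  rw [this]
  rfl

namespace smoothSections

section Comap

variable {E E' : Type} [NormedAddCommGroup E] [NormedSpace ℝ E] [NormedAddCommGroup E']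
  [NormedSpace ℝ E'] {q : ℕ}

/-- Composition of sections with a smooth map. -/
noncomputable def comap (β : E' → E) (V : Opens E) (W : Opens E')
    (hβ : ∀ y ∈ W, ContDiffAt ℝ ∞ β y) (h : ∀ y ∈ W, β y ∈ V) :
    smoothSections E q V →ₐ[ℝ] smoothSections E' q W where
  toFun f := ⟨fun y => f.1 ⟨β y, h _ y.2⟩, IsSmoothSection.congr fun l y hy =>
    ⟨fun y => l (extZero f.1 (β y)), (contDiffAt f l (h y hy)).comp y (hβ y hy),
      Filter.Eventually.of_forall fun z hz => by
      change _ = l (extZero f.1 (β z))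
      rw [extZero_apply _ (h z hz)]⟩⟩
  map_one' := rfl
  map_mul' _ _ := rfl
  map_zero' := rfl
  map_add' _ _ := rfl
  commutes' _ := rfl

/-- The product of two open sets. -/
def prodOpens (V : Opens E) (W : Opens E') : Opens (E × E') :=
  ⟨(V : Set E) ×ˢ (W : Set E'), V.2.prod W.2⟩

/-- Sections in the second variable as sections on a product. -/
noncomputable def comapSnd (V : Opens E) (W : Opens E') :
    smoothSections E' q W →ₐ[ℝ] smoothSections (E × E') q (prodOpens V W) :=
  comap Prod.snd W (prodOpens V W) (fun _ _ => contDiffAt_snd) fun _ hy => hy.2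

theorem pd_comapSnd (V : Opens E) (W : Opens E') (f : smoothSections E' q W) (v : E) :
    pd ((v, 0) : E × E') (comapSnd V W f) = 0 := by
  ext y
  refine Grass.ext_components fun l => ?_
  rw [map_pd]
  have e : (fun z : E × E' => l (extZero (comapSnd V W f).1 z)) =ᶠ[nhds y.1]
      fun z => l (extZero f.1 z.2) := by
    filter_upwards [(prodOpens V W).2.mem_nhds y.2] with z hz
    rw [extZero_apply _ hz, extZero_apply _ hz.2]
    rfl
  have h2 : HasFDerivAt (fun z : E × E' => l (extZero f.1 z.2)) _ y.1 :=
    (differentiableAt f l y.2.2).hasFDerivAt.comp y.1 hasFDerivAt_snd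
  rw [e.fderiv_eq, h2.fderiv]
  change fderiv ℝ _ _ (0 : E') = l 0
  rw [map_zero, map_zero]

end Comap

/-! ### Evaluating superfunctions at superfunctions -/

section Taylor

variable {E E' : Type} [NormedAddCommGroup E] [NormedSpace ℝ E] [NormedAddCommGroup E']
  [NormedSpace ℝ E'] {q q' : ℕ} {ι : Type}

variable {W : Opens E'} (p : ModelPt ι q (smoothSections E' q' W))

/-- Substitution of the odd coordinates of a point: `f(x, θ) ↦ f(x, p.θ(y))`. The even variable `x`
is kept as an independent variable, so that the result can be differentiated in it. -/
noncomputable def substOdd (V : Opens E) :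
    smoothSections E q V →ₐ[ℝ] smoothSections (E × E') q' (prodOpens V W) where
  toFun f := ⟨fun z => (p.gen (f.1 ⟨z.1.1, z.2.1⟩)).1 ⟨z.1.2, z.2.2⟩,
    IsSmoothSection.congr fun l z hz =>
      ⟨fun z => ∑ I, (Grass.monomials q).coord I (extZero f.1 z.1) *
          l (extZero (p.gen (Grass.monomials q I)).1 z.2),
        ContDiffAt.sum fun I _ =>
          ((contDiffAt f ((Grass.monomials q).coord I) hz.1).comp z contDiffAt_fst).mul
            ((contDiffAt (p.gen (Grass.monomials q I)) l hz.2).comp z contDiffAt_snd),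
        Filter.Eventually.of_forall fun y hy => by
          conv_lhs => rw [← (Grass.monomials q).sum_repr (f.1 ⟨y.1, hy.1⟩)]
          rw [map_sum, sum_apply, map_sum]
          refine Finset.sum_congr rfl fun I _ => ?_
          rw [extZero_apply _ hy.1, extZero_apply _ hy.2, map_smul]
          exact map_smul l _ _⟩⟩
  map_one' := by
    ext z
    change (p.gen 1).1 _ = 1
    rw [map_one]
    rfl
  map_mul' f g := by
    ext z
    change (p.gen (f.1 _ * g.1 _)).1 _ = _
    rw [map_mul]
    rfl
  map_zero' := by
    ext z
    change (p.gen 0).1 _ = 0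
    rw [map_zero]
    rfl
  map_add' f g := by
    ext z
    change (p.gen (f.1 _ + g.1 _)).1 _ = _
    rw [map_add]
    rfl
  commutes' r := by
    ext z
    change (p.gen (algebraMap ℝ _ r)).1 _ = _
    rw [AlgHom.commutes]
    rfl

theorem substOdd_apply (V : Opens E) (f : smoothSections E q V) (z : prodOpens V W) :
    (substOdd p V f).1 z = (p.gen (f.1 ⟨z.1.1, z.2.1⟩)).1 ⟨z.1.2, z.2.2⟩ := rfl

/-- The body of a section. -/
noncomputable def bodySection (f : smoothSections E' q' W) : smoothSections E' q' W :=
  scalar (fun y => Grass.body q' (extZero f.1 y))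
    fun _ hy => contDiffAt f (Grass.body q').toLinearMap hy

theorem bodySection_apply (f : smoothSections E' q' W) (y : W) :
    (bodySection f).1 y = algebraMap ℝ _ (Grass.body q' (f.1 y)) := by
  change algebraMap ℝ _ (Grass.body q' (extZero f.1 y)) = _
  rw [extZero_apply _ y.2]

theorem nilpotentPart_even (i : ι) :
    p.x i - bodySection (p.x i) ∈ gr (A := smoothSections E' q' W) 0 := by
  refine sub_mem (p.even i) fun y => ?_
  rw [bodySection_apply, Algebra.algebraMap_eq_smul_one]
  exact Submodule.smul_mem _ _ (Grass.superAlgebra q').one_mem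

theorem restr_gr {W' : Opens E'} (hW : W' ≤ W) (i : ZMod 2) (s : smoothSections E' q' W)
    (hs : s ∈ gr (A := smoothSections E' q' W) i) :
    restr hW s ∈ gr (A := smoothSections E' q' W') i := fun _ => hs _

/-- Restriction of a point with values in smooth sections. -/
noncomputable def _root_.ModelPt.restr {W' : Opens E'} (hW : W' ≤ W) :
    ModelPt ι q (smoothSections E' q' W') :=
  p.map (smoothSections.restr hW) (restr_gr hW)

variable [Fintype ι]

/-- The derivation `∑ᵢ nᵢ ∂ᵢ`, where `nᵢ` is the nilpotent part of the `i`-th even coordinate. Its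
exponential is the Taylor expansion at the body of the point. -/
noncomputable def taylorDer (b : Module.Basis ι ℝ E) (V : Opens E) :
    smoothSections (E × E') q' (prodOpens V W) →ₗ[ℝ] smoothSections (E × E') q' (prodOpens V W) :=
  ∑ i, (LinearMap.mulLeft ℝ (comapSnd V W (p.x i - bodySection (p.x i)))).comp (pd (b i, 0))

variable (b : Module.Basis ι ℝ E) (V : Opens E)

theorem taylorDer_apply (f : smoothSections (E × E') q' (prodOpens V W)) :
    taylorDer p b V f =
      ∑ i, comapSnd V W (p.x i - bodySection (p.x i)) * pd (b i, 0) f := by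
  simp [taylorDer]

theorem comapSnd_gr (i : ZMod 2) (f : smoothSections E' q' W)
    (hf : f ∈ gr (A := smoothSections E' q' W) i) :
    comapSnd V W f ∈ gr (A := smoothSections (E × E') q' (prodOpens V W)) i := fun _ => hf _

theorem taylorDer_mul (f g : smoothSections (E × E') q' (prodOpens V W)) :
    taylorDer p b V (f * g) = f * taylorDer p b V g + taylorDer p b V f * g := by
  rw [taylorDer_apply, taylorDer_apply, taylorDer_apply, Finset.mul_sum, Finset.sum_mul,
    ← Finset.sum_add_distrib]
  refine Finset.sum_congr rfl fun i _ => ?_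
  have h := SuperAlgebra.even_comm (comapSnd_gr V 0 _ (nilpotentPart_even p i)) f
  rw [pd_mul, mul_add, ← mul_assoc, ← mul_assoc, ← mul_assoc, h, add_comm]

theorem pow_taylorDer_mem (k : ℕ) (f : smoothSections (E × E') q' (prodOpens V W))
    (z : prodOpens V W) : ((taylorDer p b V ^ (k + 1)) f).1 z ∈ Grass.aug q' ^ (k + 1) := by
  have hn : ∀ i (z : prodOpens V W),
      (comapSnd V W (p.x i - bodySection (p.x i))).1 z ∈ Grass.aug q' := by
    intro i z
    change (p.x i).1 _ - (bodySection (p.x i)).1 _ ∈ _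
    rw [bodySection_apply]
    exact Grass.sub_body_mem_aug _
  induction k generalizing z with
  | zero =>
    rw [zero_add, pow_one, pow_one, taylorDer_apply, sum_apply]
    refine Submodule.sum_mem _ fun i _ => ?_
    have := hn i z
    rw [Grass.mem_aug] at this ⊢
    change Grass.body q' ((comapSnd V W (p.x i - bodySection (p.x i))).1 z * _) = 0
    rw [map_mul, this, zero_mul]
  | succ k ih =>
    rw [pow_succ' (taylorDer p b V), Module.End.mul_apply, taylorDer_apply, sum_apply,
      pow_succ' (Grass.aug q')]
    refine Submodule.sum_mem _ fun i _ => ?_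
    rw [← pow_succ']
    have h1 := pd_mem (Grass.aug q' ^ (k + 1)) (b i, 0) _ ih z
    exact Grass.aug_mul_mem (hn i z) h1

theorem taylorDer_pow : taylorDer p b V ^ (q' + 1) = 0 := by
  refine LinearMap.ext fun f => smoothSections.ext fun z => ?_
  have := pow_taylorDer_mem p b V q' f z
  rwa [Grass.aug_pow_eq_bot, Submodule.mem_bot] at this

/-- The map `y ↦ ∑ᵢ xᵢ(y) bᵢ` underlying a point with values in smooth sections. -/
noncomputable def baseMap (y : E') : E := ∑ i, Grass.body q' (extZero (p.x i).1 y) • b i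

theorem contDiffAt_baseMap {y : E'} (hy : y ∈ W) : ContDiffAt ℝ ∞ (baseMap p b) y :=
  ContDiffAt.sum fun i _ =>
    (contDiffAt (p.x i) (Grass.body q').toLinearMap hy).smul contDiffAt_const

theorem coord_baseMap (y : W) (i : ι) :
    b.coord i (baseMap p b y) = Grass.body q' ((p.x i).1 y) := by
  classical
  simp [baseMap, extZero_apply _ y.2, Finsupp.single_apply]

/-- The value of a superfunction `f` at the superfunctions that are the coordinates of `p`,
by the (finite) Taylor expansion in the nilpotent parts of these superfunctions: the odd coordinates
are substituted, the exponential of `taylorDer` is applied, and the result is restricted to the graph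
of `baseMap`. -/
noncomputable def evalAt (h : ∀ y ∈ W, baseMap p b y ∈ V) :
    smoothSections E q V →ₐ[ℝ] smoothSections E' q' W :=
  (comap (fun y => (baseMap p b y, y)) (prodOpens V W) W
    (fun _ hy => (contDiffAt_baseMap p b hy).prodMk contDiffAt_id) fun y hy => ⟨h y hy, hy⟩).comp
  ((expDerivation (taylorDer p b V) (taylorDer_mul p b V) (q' + 1) (taylorDer_pow p b V)).comp
    (substOdd p V))

theorem evalAt_coord [FiniteDimensional ℝ E] (h : ∀ y ∈ W, baseMap p b y ∈ V) (i : ι) :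
    evalAt p b V h (coord q b i V) = p.x i := by
  have hsm : ∀ z ∈ prodOpens V W, ContDiffAt ℝ ∞ (fun z : E × E' => b.coord i z.1) z :=
    fun z _ => ContDiffAt.comp (g := fun y => b.coord i y) (f := Prod.fst) z
      (contDiffAt_coord b i z.1) contDiffAt_fst
  have h1 : substOdd p V (coord q b i V) = scalar (fun z => b.coord i z.1) hsm := by
    ext z
    rw [substOdd_apply]
    change (p.gen (algebraMap ℝ _ (b.coord i z.1.1))).1 _ = _
    rw [AlgHom.commutes]
    rfl
  have h2 : taylorDer p b V (substOdd p V (coord q b i V)) =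
      comapSnd V W (p.x i - bodySection (p.x i)) := by
    classical
    rw [taylorDer_apply, h1]
    have hpd : ∀ j, pd ((b j, 0) : E × E') (scalar (q := q') (W := prodOpens V W)
        (fun z : E × E' => b.coord i z.1) hsm) =
          if j = i then 1 else 0 := by
      intro j
      ext z
      rw [pd_scalar]
      have h3 : HasFDerivAt (fun z : E × E' => b.coord i z.1)
          ((LinearMap.toContinuousLinearMap (b.coord i)).comp (ContinuousLinearMap.fst ℝ E E')) z.1 :=
        ((LinearMap.toContinuousLinearMap (b.coord i)).comp
          (ContinuousLinearMap.fst ℝ E E')).hasFDerivAt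
      rw [h3.fderiv]
      change algebraMap ℝ (Grass q') (b.coord i (b j)) = _
      rw [Module.Basis.coord_apply, b.repr_self, Finsupp.single_apply]
      split_ifs
      · exact map_one _
      · exact map_zero _
    simp only [hpd, mul_ite, mul_one, mul_zero]
    rw [Finset.sum_ite_eq' Finset.univ i, if_pos (Finset.mem_univ i)]
  have h3 : taylorDer p b V (taylorDer p b V (substOdd p V (coord q b i V))) = 0 := by
    rw [h2, taylorDer_apply]
    exact Finset.sum_eq_zero fun j _ => by rw [pd_comapSnd, mul_zero]
  ext y
  change (expDerivation (taylorDer p b V) (taylorDer_mul p b V) (q' + 1) (taylorDer_pow p b V)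
    (substOdd p V (coord q b i V))).1 ⟨(baseMap p b y, y), _⟩ = _
  rw [expDerivation_eq_add _ _ _ _ _ h3, h2, h1]
  change algebraMap ℝ _ (b.coord i (baseMap p b y)) + ((p.x i).1 y - (bodySection (p.x i)).1 y) = _
  rw [bodySection_apply, coord_baseMap]
  abel

theorem evalAt_const (h : ∀ y ∈ W, baseMap p b y ∈ V) (v : Fin q → ℝ) :
    evalAt p b V h (const E q V (ExteriorAlgebra.ι ℝ v)) = p.θ v := by
  have h1 : substOdd p V (const E q V (ExteriorAlgebra.ι ℝ v)) = comapSnd V W (p.θ v) := by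
    ext z
    rw [substOdd_apply]
    change (p.gen (ExteriorAlgebra.ι ℝ v)).1 _ = _
    rw [ModelPt.gen_ι]
    rfl
  have h2 : taylorDer p b V (substOdd p V (const E q V (ExteriorAlgebra.ι ℝ v))) = 0 := by
    rw [h1, taylorDer_apply]
    exact Finset.sum_eq_zero fun j _ => by rw [pd_comapSnd, mul_zero]
  ext y
  change (expDerivation (taylorDer p b V) (taylorDer_mul p b V) (q' + 1) (taylorDer_pow p b V)
    (substOdd p V (const E q V (ExteriorAlgebra.ι ℝ v)))).1 ⟨(baseMap p b y, y), _⟩ = _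
  rw [expDerivation_eq_add _ _ _ _ _ (by rw [h2, map_zero]), h2, h1, add_zero]
  rfl

theorem evalAt_gr (h : ∀ y ∈ W, baseMap p b y ∈ V) (i : ZMod 2) (f : smoothSections E q V)
    (hf : f ∈ gr (A := smoothSections E q V) i) :
    evalAt p b V h f ∈ gr (A := smoothSections E' q' W) i := by
  have h1 : substOdd p V f ∈ gr (A := smoothSections (E × E') q' (prodOpens V W)) i := fun z =>
    Grass.map_mem_gr p.gen (fun v => by rw [ModelPt.gen_ι]; exact p.odd v) i _ (hf _) _
  have h2 : ∀ k, (taylorDer p b V ^ k) (substOdd p V f) ∈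
      gr (A := smoothSections (E × E') q' (prodOpens V W)) i := by
    intro k
    induction k with
    | zero => exact h1
    | succ k ih =>
      rw [pow_succ', Module.End.mul_apply, taylorDer_apply]
      refine Submodule.sum_mem _ fun j _ => ?_
      have := SuperAlgebra.mul_mem (comapSnd_gr V 0 _ (nilpotentPart_even p j))
        (show pd (b j, 0) ((taylorDer p b V ^ k) (substOdd p V f)) ∈
          gr (A := smoothSections (E × E') q' (prodOpens V W)) i from
          fun z => pd_mem _ _ _ (fun z => ih z) z)
      rwa [zero_add] at this
  have h3 : expDerivation (taylorDer p b V) (taylorDer_mul p b V) (q' + 1) (taylorDer_pow p b V)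
      (substOdd p V f) ∈ gr (A := smoothSections (E × E') q' (prodOpens V W)) i := by
    rw [expDerivation_apply]
    exact Submodule.sum_mem _ fun k _ => Submodule.smul_mem _ _ (h2 k)
  exact fun y => h3 _

theorem baseMap_restr {W' : Opens E'} (hW : W' ≤ W) {y : E'} (hy : y ∈ W') :
    baseMap (p.restr hW) b y = baseMap p b y := by
  unfold baseMap
  refine Finset.sum_congr rfl fun i _ => ?_
  rw [extZero_apply _ hy, extZero_apply _ (hW hy)]
  rfl

/-- Evaluation is compatible with restriction, both of the superfunction and of the point. -/
theorem evalAt_restr {V' : Opens E} {W' : Opens E'} (hV : V ≤ V') (hW : W' ≤ W)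
    (h : ∀ y ∈ W, baseMap p b y ∈ V) (h' : ∀ y ∈ W', baseMap (p.restr hW) b y ∈ V')
    (f : smoothSections E q V') :
    restr hW (evalAt p b V h (restr hV f)) = evalAt (p.restr hW) b V' h' f := by
  -- both sides are restrictions of the evaluation with values on the small open set
  let P : Opens (E × E') := prodOpens V W'
  have hP : P ≤ prodOpens V W := fun z hz => ⟨hz.1, hW hz.2⟩
  have hP' : P ≤ prodOpens V' W' := fun z hz => ⟨hV hz.1, hz.2⟩
  have c1 : ∀ g : smoothSections (E × E') q' (prodOpens V W),
      restr hP (taylorDer p b V g) = taylorDer (p.restr hW) b V (restr hP g) := by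
    intro g
    rw [taylorDer_apply, taylorDer_apply, map_sum]
    refine Finset.sum_congr rfl fun i _ => ?_
    rw [map_mul, pd_restr]
    congr 1
    ext z
    change (p.x i).1 _ - (bodySection (p.x i)).1 _ =
      ((p.restr hW).x i).1 _ - (bodySection ((p.restr hW).x i)).1 _
    rw [bodySection_apply, bodySection_apply]
    rfl
  have c2 : ∀ g : smoothSections (E × E') q' (prodOpens V' W'),
      restr hP' (taylorDer (p.restr hW) b V' g) = taylorDer (p.restr hW) b V (restr hP' g) := by
    intro g
    rw [taylorDer_apply, taylorDer_apply, map_sum]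
    refine Finset.sum_congr rfl fun i _ => ?_
    rw [map_mul, pd_restr]
    rfl
  have c1' : ∀ k g, restr hP ((taylorDer p b V ^ k) g) =
      (taylorDer (p.restr hW) b V ^ k) (restr hP g) := by
    intro k g
    induction k with
    | zero => rfl
    | succ k ih => rw [pow_succ', pow_succ', Module.End.mul_apply, Module.End.mul_apply, c1, ih]
  have c2' : ∀ k g, restr hP' ((taylorDer (p.restr hW) b V' ^ k) g) =
      (taylorDer (p.restr hW) b V ^ k) (restr hP' g) := by
    intro k g
    induction k with
    | zero => rfl
    | succ k ih => rw [pow_succ', pow_succ', Module.End.mul_apply, Module.End.mul_apply, c2, ih]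
  have e0 : restr hP (substOdd p V (restr hV f)) = restr hP' (substOdd (p.restr hW) V' f) := by
    ext z
    change (p.gen (f.1 _)).1 _ = ((p.restr hW).gen (f.1 _)).1 _
    unfold ModelPt.restr
    rw [ModelPt.gen_map p (smoothSections.restr hW) (restr_gr hW)]
    rfl
  have e1 : restr hP (expDerivation _ (taylorDer_mul p b V) (q' + 1) (taylorDer_pow p b V)
      (substOdd p V (restr hV f))) = restr hP' (expDerivation _ (taylorDer_mul (p.restr hW) b V')
        (q' + 1) (taylorDer_pow (p.restr hW) b V') (substOdd (p.restr hW) V' f)) := by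
    rw [expDerivation_apply, expDerivation_apply, map_sum, map_sum]
    refine Finset.sum_congr rfl fun k _ => ?_
    rw [map_smul, map_smul, c1', c2', e0]
  ext y
  have hb := baseMap_restr p b hW y.2
  have hz : (baseMap p b y, y.1) ∈ P := ⟨h y (hW y.2), y.2⟩
  have e2 := congrFun (congrArg Subtype.val e1) ⟨_, hz⟩
  refine Eq.trans e2 ?_
  change (expDerivation (taylorDer (p.restr hW) b V') (taylorDer_mul (p.restr hW) b V') (q' + 1)
      (taylorDer_pow (p.restr hW) b V') (substOdd (p.restr hW) V' f)).1
        ⟨(baseMap p b y, y.1), _⟩ =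
    (expDerivation (taylorDer (p.restr hW) b V') (taylorDer_mul (p.restr hW) b V') (q' + 1)
      (taylorDer_pow (p.restr hW) b V') (substOdd (p.restr hW) V' f)).1
        ⟨(baseMap (p.restr hW) b y, y.1), _⟩
  exact congrArg _ (Subtype.ext (congrArg (fun x => (x, y.1)) hb.symm))

end Taylor

end smoothSections

/-! ### Maps to the model spaces -/

namespace SuperMfd

open SuperSpace

section ToModel

variable {E E' : Type} [NormedAddCommGroup E] [NormedSpace ℝ E] [NormedAddCommGroup E']
  [NormedSpace ℝ E'] {q q' : ℕ} {ι : Type} [Fintype ι]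

theorem img_le {X : Type} [TopologicalSpace X] (U : Opens X) (C : Opens U) : img U C ≤ U := by
  rintro _ ⟨x, -, rfl⟩
  exact x.2

theorem le_img_top {X : Type} [TopologicalSpace X] (U : Opens X) : U ≤ img U ⊤ :=
  fun x hx => ⟨⟨x, hx⟩, trivial, rfl⟩

/-- The map from a domain in `E'^{|q'}` to `E^{|q}` with given coordinates. -/
noncomputable def toModel (b : Module.Basis ι ℝ E) (U : Opens E')
    (p : ModelPt ι q (smoothSections E' q' U)) :
    Hom ((modelSpace E' q').restrict U) (modelSpace E q) where
  base y := smoothSections.baseMap (E := E) p b y.1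
  cont := show Continuous fun y : U => smoothSections.baseMap p b y.1 from
    continuous_iff_continuousAt.mpr fun y =>
      ContinuousAt.comp (f := Subtype.val)
        ((smoothSections.contDiffAt_baseMap p b y.2).continuousAt)
        continuous_subtype_val.continuousAt
  pull V C h := smoothSections.evalAt (p.restr (img_le U C)) b V (by
    rintro _ ⟨y, hy, rfl⟩
    rw [smoothSections.baseMap_restr p b _ (⟨y, hy, rfl⟩ : y.1 ∈ img U C)]
    exact h y hy)
  pull_gr V C h i s hs := smoothSections.evalAt_gr _ b V _ i s hs
  pull_res {V V' C C'} hV hC h h' s :=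
    smoothSections.evalAt_restr (p.restr (img_le U C)) b V hV (img_mono U hC) _ _ s

theorem toModel_coord [FiniteDimensional ℝ E] (b : Module.Basis ι ℝ E) (U : Opens E')
    (p : ModelPt ι q (smoothSections E' q' U)) (i : ι) :
    (toModel b U p).pull ⊤ ⊤ (fun _ _ => trivial) (smoothSections.coord q b i ⊤) =
      (smoothSections.restr (img_le U ⊤) (p.x i) : smoothSections E' q' (img U ⊤)) :=
  smoothSections.evalAt_coord (p.restr (img_le U ⊤)) b ⊤ (fun _ _ => trivial) i

theorem toModel_const (b : Module.Basis ι ℝ E) (U : Opens E')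
    (p : ModelPt ι q (smoothSections E' q' U)) (v : Fin q → ℝ) :
    (toModel b U p).pull ⊤ ⊤ (fun _ _ => trivial)
        (smoothSections.const E q ⊤ (ExteriorAlgebra.ι ℝ v)) =
      (smoothSections.restr (img_le U ⊤) (p.θ v) : smoothSections E' q' (img U ⊤)) :=
  smoothSections.evalAt_const (p.restr (img_le U ⊤)) b ⊤ (fun _ _ => trivial) v

end ToModel

variable {T : SuperMfd} {E : Type} [NormedAddCommGroup E] [NormedSpace ℝ E]
  [FiniteDimensional ℝ E] {q : ℕ} {ι : Type} [Fintype ι]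

/-- A map to `E^{|q}` is determined by its coordinates, by `smoothSections.germ_hom_unique`. -/
theorem hom_model_ext (b : Module.Basis ι ℝ E) {F G : Hom T.X (modelSpace E q)}
    (hx : ∀ i, F.pull ⊤ ⊤ (fun _ _ => trivial) (smoothSections.coord q b i ⊤) =
      G.pull ⊤ ⊤ (fun _ _ => trivial) (smoothSections.coord q b i ⊤))
    (hθ : ∀ v, F.pull ⊤ ⊤ (fun _ _ => trivial) (smoothSections.const E q ⊤
        (ExteriorAlgebra.ι ℝ v)) =
      G.pull ⊤ ⊤ (fun _ _ => trivial) (smoothSections.const E q ⊤ (ExteriorAlgebra.ι ℝ v))) :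
    F = G := by
  have hc : ∀ (H : Hom T.X (modelSpace E q)) (x : T.X.pt) (i : ι),
      ev x ⊤ trivial (H.pull ⊤ ⊤ (fun _ _ => trivial) (smoothSections.coord q b i ⊤)) =
        b.coord i (H.base x) := by
    intro H x i
    refine (ev_pull (S := model E q) H x ⊤ ⊤ trivial (fun _ _ => trivial) _).trans ?_
    refine (ev_model (E := E) (H.base x) ⊤ trivial _).trans ?_
    exact Grass.body_algebraMap (b.coord i (H.base x))
  have hb : F.base = G.base := funext fun x => Module.Basis.ext_elem (M := E) b fun i => by
    have h1 := hc F x i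
    rw [hx i, hc G x i] at h1
    exact h1.symm
  refine Hom.ext' hb fun V U h h' s => section_ext _ _ fun c y hy => ?_
  rw [valAt_pull c.φ F y V U hy h, valAt_pull c.φ G y V U hy h']
  have hb' : (c.φ.comp F).base y = (c.φ.comp G).base y := congrFun hb (c.φ.base y)
  refine smoothSections.germ_hom_unique b (x₀ := (c.φ.comp F).base y)
    (fun V hV => valAt (c.φ.comp F) y V hV) (fun V hV => valAt (c.φ.comp G) y V (hb' ▸ hV))
    (fun V V' h hx f => valAt_res (c.φ.comp F) y h hx f)
    (fun V V' h hx f => valAt_res (c.φ.comp G) y h (hb' ▸ hx) f) (fun i => ?_) (fun v => ?_) V _ s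
  · refine (valAt_pull c.φ F y ⊤ ⊤ trivial (fun _ _ => trivial) _).symm.trans ?_
    rw [hx i]
    exact valAt_pull c.φ G y ⊤ ⊤ trivial (fun _ _ => trivial) _
  · refine (valAt_pull c.φ F y ⊤ ⊤ trivial (fun _ _ => trivial) _).symm.trans ?_
    rw [hθ v]
    exact valAt_pull c.φ G y ⊤ ⊤ trivial (fun _ _ => trivial) _

/-- There is a map to `E^{|q}` with prescribed coordinates. It is unique, hence it can be
constructed in charts. -/
theorem exists_hom_model (b : Module.Basis ι ℝ E) (p : ModelPt ι q T.Fun) :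
    ∃ F : Hom T.X (modelSpace E q),
      (∀ i, F.pull ⊤ ⊤ (fun _ _ => trivial) (smoothSections.coord q b i ⊤) = p.x i) ∧
      ∀ v, F.pull ⊤ ⊤ (fun _ _ => trivial) (smoothSections.const E q ⊤ (ExteriorAlgebra.ι ℝ v)) =
        p.θ v := by
  -- in a chart, superfunctions can be evaluated at superfunctions
  have loc : ∀ c : Patch T, ∃ F : Hom (T.X.restrict c.range) (modelSpace E q),
      (∀ i, F.pull ⊤ ⊤ (fun _ _ => trivial) (smoothSections.coord q b i ⊤) =
        (T.X.incl c.range).pull ⊤ ⊤ (fun _ _ => trivial) (p.x i)) ∧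
      ∀ v, F.pull ⊤ ⊤ (fun _ _ => trivial) (smoothSections.const E q ⊤ (ExteriorAlgebra.ι ℝ v)) =
        (T.X.incl c.range).pull ⊤ ⊤ (fun _ _ => trivial) (p.θ v) := by
    intro c
    let e : Hom (T.X.restrict c.range) ((modelSpace c.E c.q).restrict c.U) :=
      c.emb.lift (T.X.incl c.range) fun z => z.2
    have he : e.comp c.φ = T.X.incl c.range := c.emb.lift_comp _ _
    let r : T.Fun →ₐ[ℝ] smoothSections c.E c.q c.U :=
      (smoothSections.restr (le_img_top c.U)).comp (c.φ.pull ⊤ ⊤ fun _ _ => trivial)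
    have hr : ∀ i, ∀ a ∈ gr (A := T.Fun) i, r a ∈ gr (A := smoothSections c.E c.q c.U) i :=
      fun i a ha => smoothSections.restr_gr (le_img_top c.U) i _ (c.φ.pull_gr _ _ _ i a ha)
    have key : ∀ a : T.Fun, e.pull ⊤ ⊤ (fun _ _ => trivial)
        (smoothSections.restr (img_le c.U ⊤) (r a) : smoothSections c.E c.q (img c.U ⊤)) =
          (T.X.incl c.range).pull ⊤ ⊤ (fun _ _ => trivial) a := fun a =>
      (e.comp_pull c.φ ⊤ ⊤ ⊤ (fun _ _ => trivial) (fun _ _ => trivial)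
        (fun _ _ => trivial) a).symm.trans
        (Hom.congr_pull he (V := ⊤) (fun _ _ => trivial) a)
    refine ⟨e.comp (toModel b c.U (p.map r hr)), fun i => ?_, fun v => ?_⟩
    · refine (e.comp_pull _ ⊤ ⊤ ⊤ _ (fun _ _ => trivial) (fun _ _ => trivial) _).trans ?_
      exact (congrArg _ (toModel_coord b c.U (p.map r hr) i)).trans (key (p.x i))
    · refine (e.comp_pull _ ⊤ ⊤ ⊤ _ (fun _ _ => trivial) (fun _ _ => trivial) _).trans ?_
      exact (congrArg _ (toModel_const b c.U (p.map r hr) v)).trans (key (p.θ v))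
  choose F hF hF' using loc
  -- on overlaps the local maps have the same coordinates, hence they agree
  have compat : ∀ {C D : Opens T.X.pt} (h : D ≤ C) (H : Hom (T.X.restrict C) (modelSpace E q))
      (s : smoothSections E q ⊤) (a : T.Fun),
      H.pull ⊤ ⊤ (fun _ _ => trivial) s = (T.X.incl C).pull ⊤ ⊤ (fun _ _ => trivial) a →
      ((T.X.inclLE h).comp H).pull ⊤ ⊤ (fun _ _ => trivial) s =
        (T.X.incl D).pull ⊤ ⊤ (fun _ _ => trivial) a := by
    intro C D h H s a hs
    refine ((T.X.inclLE h).comp_pull H ⊤ ⊤ ⊤ _ (fun _ _ => trivial) (fun _ _ => trivial) s).trans ?_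
    refine (congrArg _ hs).trans ?_
    refine ((T.X.inclLE h).comp_pull (T.X.incl C) ⊤ ⊤ ⊤ (fun _ _ => trivial) (fun _ _ => trivial)
      (fun _ _ => trivial) a).symm.trans ?_
    exact Hom.congr_pull (T.X.inclLE_comp h) _ a
  obtain ⟨G, hG⟩ := T.X.exists_glue (fun x : T.X.pt => (patchAt x).range)
    (fun x => ⟨x, ⟨patchPt x, base_patchPt x⟩⟩) (fun x => F (patchAt x)) (by
      intro i j
      refine hom_model_ext (T := T.restrict ((patchAt i).range ⊓ (patchAt j).range)) b ?_ ?_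
      · intro k
        exact (compat inf_le_left _ _ _ (hF _ k)).trans (compat inf_le_right _ _ _ (hF _ k)).symm
      · intro k
        exact (compat inf_le_left _ _ _ (hF' _ k)).trans (compat inf_le_right _ _ _ (hF' _ k)).symm)
  have glob : ∀ (s : smoothSections E q ⊤) (a : T.Fun),
      (∀ c, (F c).pull ⊤ ⊤ (fun _ _ => trivial) s =
        (T.X.incl c.range).pull ⊤ ⊤ (fun _ _ => trivial) a) →
      G.pull ⊤ ⊤ (fun _ _ => trivial) s = a := by
    intro s a h
    refine eq_of_locally_eq _ _ fun x _ => ⟨img (patchAt x).range ⊤, le_top,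
      le_img_top _ ⟨patchPt x, base_patchPt x⟩, ?_⟩
    refine Eq.trans ?_ (h (patchAt x))
    refine Eq.trans ?_ (Hom.congr_pull (hG x) (V := ⊤) (fun _ _ => trivial) s)
    exact (((T.X.incl _).comp_pull G ⊤ ⊤ ⊤ (fun _ _ => trivial) (fun _ _ => trivial)
      (fun _ _ => trivial) s)).symm
  exact ⟨G, fun i => glob _ _ fun c => hF c i, fun v => glob _ _ fun c => hF' c v⟩

end SuperMfd

/-! ### Maps to the superline and to its isometry group -/

namespace SuperSpace

/-- Morphisms which agree on the members of an open cover are equal. -/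
theorem Hom.ext_cover {X Y : SuperSpace} {ι : Type} (C : ι → Opens X.pt) (hC : ∀ x, ∃ i, x ∈ C i)
    {F G : Hom X Y} (h : ∀ i, (X.incl (C i)).comp F = (X.incl (C i)).comp G) : F = G := by
  refine Hom.ext_locally (funext fun x => ?_) fun V s x hx => ?_
  · obtain ⟨i, hi⟩ := hC x
    exact Hom.congr_base (h i) ⟨x, hi⟩
  · obtain ⟨i, hi⟩ := hC x
    have hb : ∀ z (hz : z ∈ C i), F.base z = G.base z := fun z hz => Hom.congr_base (h i) ⟨z, hz⟩
    let D : Opens (C i) := trace (C i) (F.pre V)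
    have h1 : ∀ z ∈ D, ((X.incl (C i)).comp F).base z ∈ V := fun z hz => hz
    have hD : ∀ z ∈ img (C i) D, F.base z ∈ V := by
      rintro _ ⟨z, hz, rfl⟩
      exact hz
    have hD' : ∀ z ∈ img (C i) D, G.base z ∈ V := by
      rintro _ ⟨z, hz, rfl⟩
      rw [← hb z.1 z.2]
      exact hz
    refine ⟨img (C i) D, ⟨⟨x, hi⟩, hx, rfl⟩, hD, hD', ?_⟩
    have e := Hom.congr_pull (h i) (V := V) (U := D) h1 s
    have e1 := (X.incl (C i)).comp_pull F V (img (C i) D) D h1 (fun z hz => ⟨z, hz, rfl⟩) hD s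
    have e2 := (X.incl (C i)).comp_pull G V (img (C i) D) D (fun z hz => hD' z.1 ⟨z, hz, rfl⟩)
      (fun z hz => ⟨z, hz, rfl⟩) hD' s
    have e3 := e1.symm.trans (e.trans e2)
    exact ((X.res_id _).symm.trans e3).trans (X.res_id _)

end SuperSpace

namespace SuperMfd

open SuperSpace CategoryTheory

variable {T T' : SuperMfd}

theorem pullback_comp {N : SuperMfd} (F : T ⟶ T') (G : T' ⟶ N) (a : N.Fun) :
    pullback (F ≫ G) a = pullback F (pullback G a) :=
  Hom.comp_pull (X := T.X) (Y := T'.X) (Z := N.X) F G ⊤ ⊤ ⊤ (fun _ _ => trivial)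
    (fun _ _ => trivial) (fun _ _ => trivial) a

/-- The value of a global function at a point. -/
noncomputable abbrev gev (x : T.X.pt) : T.Fun →ₐ[ℝ] ℝ := ev x ⊤ trivial

theorem gev_pullback {N : SuperMfd} (F : T ⟶ N) (x : T.X.pt) (a : N.Fun) :
    gev x (pullback F a) = gev (Hom.base F x) a :=
  ev_pull (S := N) F x ⊤ ⊤ trivial (fun _ _ => trivial) a

/-- The inclusion of an open sub-supermanifold. -/
def inclM (T : SuperMfd) (C : Opens T.X.pt) : T.restrict C ⟶ T := T.X.incl C

theorem eq_of_cover {κ : Type} (C : κ → Opens T.X.pt) (hC : ∀ x, ∃ i, x ∈ C i) (a a' : T.Fun)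
    (h : ∀ i, pullback (T.inclM (C i)) a = pullback (T.inclM (C i)) a') : a = a' := by
  refine eq_of_locally_eq _ _ fun x _ => ?_
  obtain ⟨i, hi⟩ := hC x
  exact ⟨img (C i) ⊤, le_top, le_img_top _ hi, h i⟩

theorem coords_comp (F : T ⟶ T') (G : T' ⟶ R11) :
    coords (F ≫ G) = R11Pt.map (pullback F) (pullback_gr F) (coords G) :=
  R11Pt.ext (pullback_comp F G _) (pullback_comp F G _)

theorem isomCoords_comp (F : T ⟶ T') (g : T' ⟶ IsomR11) :
    isomCoords (F ≫ g) = IsomPt.map (pullback F) (pullback_gr F) (isomCoords g) :=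
  SemidirectProduct.ext (R11Pt.ext (pullback_comp F g _) (pullback_comp F g _))
    (SignPt.ext (pullback_comp F g _))

/-- The standard basis of `ℝ`. -/
noncomputable def realBasis : Module.Basis Unit ℝ ℝ := Module.Basis.singleton Unit ℝ

theorem coord_realBasis (i : Unit) :
    smoothSections.coord 1 realBasis i ⊤ = stdCoords.t := by
  refine smoothSections.ext fun x => ?_
  change algebraMap ℝ (Grass 1) (realBasis.coord i x.1) = algebraMap ℝ (Grass 1) x.1
  simp [realBasis]

theorem const_ι_eq_smul (v : Fin 1 → ℝ) :
    smoothSections.const ℝ 1 ⊤ (ExteriorAlgebra.ι ℝ v) = v 0 • stdCoords.θ := by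
  have hv : v = v 0 • fun _ => (1 : ℝ) := by
    ext i
    rw [Subsingleton.elim i 0]
    simp
  conv_lhs => rw [hv, map_smul]
  rw [map_smul]
  rfl

theorem coords_injective : Function.Injective (coords : (T ⟶ R11) → R11Pt T.Fun) := by
  intro F G h
  refine hom_model_ext realBasis (fun i => ?_) fun v => ?_
  · rw [coord_realBasis]
    exact congrArg R11Pt.t h
  · rw [const_ι_eq_smul]
    change pullback F (v 0 • stdCoords.θ) = pullback G (v 0 • stdCoords.θ)
    rw [map_smul, map_smul]
    exact congrArg (v 0 • ·) (congrArg R11Pt.θ h)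

theorem coords_surjective : Function.Surjective (coords : (T ⟶ R11) → R11Pt T.Fun) := by
  intro p
  obtain ⟨F, hF, hF'⟩ := exists_hom_model (T := T) realBasis (q := 1)
    { x := fun _ => p.t
      θ := (LinearMap.proj 0).smulRight p.θ
      even := fun _ => p.even
      odd := fun v => Submodule.smul_mem _ _ p.odd }
  refine ⟨F, R11Pt.ext ?_ ?_⟩
  · have := hF ()
    rw [coord_realBasis] at this
    exact this
  · have := hF' fun _ => 1
    rw [const_ι_eq_smul] at this
    have h1 : pullback (F : T ⟶ R11) ((1 : ℝ) • stdCoords.θ) = (1 : ℝ) • p.θ := this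
    rwa [one_smul, one_smul] at h1

/-- The inclusion of the component of the unit. -/
noncomputable def inlM : R11 ⟶ IsomR11 := SuperSpace.inl R11space R11space

/-- The inclusion of the component of the reflection. -/
noncomputable def inrM : R11 ⟶ IsomR11 := SuperSpace.inr R11space R11space

theorem pullback_inlM (a : IsomR11.Fun) : pullback inlM a = a.1 := rfl

theorem pullback_inrM (a : IsomR11.Fun) : pullback inrM a = a.2 := rfl

theorem isomCoords_inlM (m : T ⟶ R11) : isomCoords (m ≫ inlM) = ⟨coords m, 1⟩ := by
  refine SemidirectProduct.ext (R11Pt.ext ?_ ?_) (SignPt.ext ?_)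
  · exact (pullback_comp m inlM _).trans (congrArg (pullback m) (pullback_inlM _))
  · exact (pullback_comp m inlM _).trans (congrArg (pullback m) (pullback_inlM _))
  · exact ((pullback_comp m inlM _).trans (congrArg (pullback m) (pullback_inlM _))).trans
      (map_one (pullback m))

theorem isomCoords_inrM (m : T ⟶ R11) : isomCoords (m ≫ inrM) =
    ⟨coords m, ⟨-1, neg_mem SuperAlgebra.one_mem, by rw [neg_mul_neg, one_mul]⟩⟩ := by
  refine SemidirectProduct.ext (R11Pt.ext ?_ ?_) (SignPt.ext ?_)
  · exact (pullback_comp m inrM _).trans (congrArg (pullback m) (pullback_inrM _))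
  · exact (pullback_comp m inrM _).trans (congrArg (pullback m) (pullback_inrM _))
  · refine ((pullback_comp m inrM _).trans (congrArg (pullback m) (pullback_inrM _))).trans ?_
    exact (map_neg (pullback m) 1).trans (congrArg _ (map_one (pullback m)))

theorem gev_right_inl (g : T ⟶ IsomR11) (x : T.X.pt) (y : ℝ) (h : Hom.base g x = Sum.inl y) :
    gev x (isomCoords g).right.val = 1 := by
  refine (gev_pullback g x _).trans ?_
  rw [h]
  refine (gev_pullback inlM (y : R11.X.pt) _).symm.trans ?_
  exact map_one _

theorem gev_right_inr (g : T ⟶ IsomR11) (x : T.X.pt) (y : ℝ) (h : Hom.base g x = Sum.inr y) :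
    gev x (isomCoords g).right.val = -1 := by
  refine (gev_pullback g x _).trans ?_
  rw [h]
  refine (gev_pullback inrM (y : R11.X.pt) _).symm.trans ?_
  exact (map_neg _ _).trans (congrArg _ (map_one _))

/-- The two open sets `a ≠ -1` and `a ≠ 1`. They cover if `a² = 1`, and `a` is then constant on each
of them. -/
def signCover (a : T.Fun) : Bool → Opens T.X.pt
  | true => nonvanishing (a + 1)
  | false => nonvanishing (a - 1)

theorem gev_sq (a : SignPt T.Fun) (x : T.X.pt) : gev x a.val = 1 ∨ gev x a.val = -1 := by
  have h : gev x a.val * gev x a.val = 1 := by rw [← map_mul, a.sq, map_one]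
  exact mul_self_eq_one_iff.mp h

theorem exists_mem_signCover (a : SignPt T.Fun) (x : T.X.pt) : ∃ i, x ∈ signCover a.val i := by
  rcases gev_sq a x with h | h
  · refine ⟨true, ?_⟩
    change gev x (a.val + 1) ≠ 0
    rw [map_add, map_one, h]
    norm_num
  · refine ⟨false, ?_⟩
    change gev x (a.val - 1) ≠ 0
    rw [map_sub, map_one, h]
    norm_num

theorem eq_zero_of_mul_eq_zero_of_gev_ne_zero (a b : T.Fun) (h : a * b = 0)
    (ha : ∀ x, gev x a ≠ 0) : b = 0 := by
  refine eq_of_locally_eq _ _ fun x _ => ?_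
  obtain ⟨W, hW, hx, hu⟩ := exists_isUnit_of_ev_ne_zero (T := T) (W := ⊤) trivial (ha x)
  refine ⟨W, hW, hx, ?_⟩
  rw [map_zero]
  refine (hu.mul_right_eq_zero).mp ?_
  rw [← map_mul, h, map_zero]

/-- On the open set where `a + 1` is invertible, `(a + 1) (a - 1) = 0` gives `a = 1`. -/
theorem pullback_signCover_true (a : SignPt T.Fun) :
    pullback (T.inclM (signCover a.val true)) a.val = 1 := by
  refine sub_eq_zero.mp (eq_zero_of_mul_eq_zero_of_gev_ne_zero
    (pullback (T.inclM (signCover a.val true)) (a.val + 1)) _ ?_ fun x => ?_)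
  · rw [map_add, map_one]
    have : pullback (T.inclM (signCover a.val true)) a.val *
        pullback (T.inclM (signCover a.val true)) a.val = 1 := by rw [← map_mul, a.sq, map_one]
    rw [add_mul, mul_sub, this]
    noncomm_ring
  · rw [gev_pullback]
    exact x.2

theorem pullback_signCover_false (a : SignPt T.Fun) :
    pullback (T.inclM (signCover a.val false)) a.val = -1 := by
  refine eq_neg_of_add_eq_zero_left (eq_zero_of_mul_eq_zero_of_gev_ne_zero
    (pullback (T.inclM (signCover a.val false)) (a.val - 1)) _ ?_ fun x => ?_)
  · rw [map_sub, map_one]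
    have : pullback (T.inclM (signCover a.val false)) a.val *
        pullback (T.inclM (signCover a.val false)) a.val = 1 := by rw [← map_mul, a.sq, map_one]
    rw [sub_mul, mul_add, this]
    noncomm_ring
  · rw [gev_pullback]
    exact x.2

theorem exists_eq_comp_inlM (g : T ⟶ IsomR11) (h : ∀ x, gev x (isomCoords g).right.val ≠ -1) :
    ∃ m : T ⟶ R11, g = m ≫ inlM := by
  refine ⟨(SuperSpace.inl_isOpenEmb R11space R11space).lift g fun x => ?_,
    ((SuperSpace.inl_isOpenEmb R11space R11space).lift_comp g _).symm⟩
  rcases hx : Hom.base g x with y | y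
  · exact ⟨y, rfl⟩
  · exact absurd (gev_right_inr g x y hx) (h x)

theorem exists_eq_comp_inrM (g : T ⟶ IsomR11) (h : ∀ x, gev x (isomCoords g).right.val ≠ 1) :
    ∃ m : T ⟶ R11, g = m ≫ inrM := by
  refine ⟨(SuperSpace.inr_isOpenEmb R11space R11space).lift g fun x => ?_,
    ((SuperSpace.inr_isOpenEmb R11space R11space).lift_comp g _).symm⟩
  rcases hx : Hom.base g x with y | y
  · exact absurd (gev_right_inl g x y hx) (h x)
  · exact ⟨y, rfl⟩

/-- A map to the isometry group is determined by its coordinates: on the open sets of `signCover` it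
factors through a single component. -/
theorem isomCoords_injective : Function.Injective (isomCoords : (T ⟶ IsomR11) → IsomPt T.Fun) := by
  intro g g' h
  refine Hom.ext_cover (signCover (isomCoords g).right.val) (exists_mem_signCover _) fun i => ?_
  change T.inclM _ ≫ g = T.inclM _ ≫ g'
  have h' : isomCoords (T.inclM (signCover (isomCoords g).right.val i) ≫ g) =
      isomCoords (T.inclM (signCover (isomCoords g).right.val i) ≫ g') := by
    rw [isomCoords_comp, isomCoords_comp, h]
  have hr : (isomCoords (T.inclM (signCover (isomCoords g).right.val i) ≫ g)).right.val =
      pullback (T.inclM (signCover (isomCoords g).right.val i)) (isomCoords g).right.val := by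
    rw [isomCoords_comp]
    rfl
  cases i with
  | true =>
    rw [pullback_signCover_true] at hr
    obtain ⟨m, hm⟩ := exists_eq_comp_inlM (T.inclM (signCover (isomCoords g).right.val true) ≫ g)
      fun x => by
        rw [hr, map_one]
        norm_num
    obtain ⟨m', hm'⟩ := exists_eq_comp_inlM (T.inclM (signCover (isomCoords g).right.val true) ≫ g')
      fun x => by
        rw [← h', hr, map_one]
        norm_num
    rw [hm, hm', isomCoords_inlM, isomCoords_inlM] at h'
    rw [hm, hm', coords_injective (congrArg SemidirectProduct.left h')]
  | false =>
    rw [pullback_signCover_false] at hr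
    obtain ⟨m, hm⟩ := exists_eq_comp_inrM (T.inclM (signCover (isomCoords g).right.val false) ≫ g)
      fun x => by
        rw [hr, map_neg, map_one]
        norm_num
    obtain ⟨m', hm'⟩ := exists_eq_comp_inrM
      (T.inclM (signCover (isomCoords g).right.val false) ≫ g') fun x => by
        rw [← h', hr, map_neg, map_one]
        norm_num
    rw [hm, hm', isomCoords_inrM, isomCoords_inrM] at h'
    rw [hm, hm', coords_injective (congrArg SemidirectProduct.left h')]

theorem isomCoords_surjective :
    Function.Surjective (isomCoords : (T ⟶ IsomR11) → IsomPt T.Fun) := by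
  intro p
  have loc : ∀ i, ∃ g : T.restrict (signCover p.right.val i) ⟶ IsomR11,
      isomCoords g = IsomPt.map (pullback (T.inclM _)) (pullback_gr (T.inclM _)) p := by
    rintro (_ | _)
    · obtain ⟨m, hm⟩ := coords_surjective
        (R11Pt.map (pullback (T.inclM (signCover p.right.val false))) (pullback_gr (T.inclM _)) p.left)
      refine ⟨m ≫ inrM, ?_⟩
      rw [isomCoords_inrM, hm]
      exact SemidirectProduct.ext rfl (SignPt.ext (pullback_signCover_false p.right).symm)
    · obtain ⟨m, hm⟩ := coords_surjective
        (R11Pt.map (pullback (T.inclM (signCover p.right.val true))) (pullback_gr (T.inclM _)) p.left)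
      refine ⟨m ≫ inlM, ?_⟩
      rw [isomCoords_inlM, hm]
      exact SemidirectProduct.ext rfl (SignPt.ext (pullback_signCover_true p.right).symm)
  choose F hF using loc
  have compat : ∀ (i : Bool) (D : Opens T.X.pt) (h : D ≤ signCover p.right.val i)
      (k : T.restrict D ⟶ T.restrict (signCover p.right.val i)),
      k ≫ T.inclM _ = T.inclM D → isomCoords (k ≫ F i) =
        IsomPt.map (pullback (T.inclM D)) (pullback_gr (T.inclM D)) p := by
    intro i D h k hk
    rw [isomCoords_comp, hF]
    refine SemidirectProduct.ext (R11Pt.ext ?_ ?_) (SignPt.ext ?_)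
    all_goals exact (pullback_comp k (T.inclM _) _).symm.trans (by rw [hk]; rfl)
  obtain ⟨G, hG⟩ := T.X.exists_glue (signCover p.right.val) (exists_mem_signCover p.right) F (by
    intro i j
    refine isomCoords_injective
      (T := T.restrict (signCover p.right.val i ⊓ signCover p.right.val j)) ?_
    exact (compat i _ inf_le_left (T.X.inclLE inf_le_left) (T.X.inclLE_comp _)).trans
      (compat j _ inf_le_right (T.X.inclLE inf_le_right) (T.X.inclLE_comp _)).symm)
  have hG' : ∀ i, isomCoords (T.inclM (signCover p.right.val i) ≫ (G : T ⟶ IsomR11)) =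
      IsomPt.map (pullback (T.inclM _)) (pullback_gr (T.inclM _)) p := fun i =>
    (congrArg isomCoords (hG i)).trans (hF i)
  refine ⟨G, SemidirectProduct.ext (R11Pt.ext ?_ ?_) (SignPt.ext ?_)⟩
  all_goals
    refine eq_of_cover _ (exists_mem_signCover p.right) _ _ fun i => ?_
    have := hG' i
    rw [isomCoords_comp] at this
  · exact congrArg (fun z => z.left.t) this
  · exact congrArg (fun z => z.left.θ) this
  · exact congrArg (fun z => z.right.val) this

end SuperMfd

/-! ### Products of the model spaces with the superline -/

namespace SuperSpace

theorem Hom.comp_assoc {X Y Z Z' : SuperSpace} (F : Hom X Y) (G : Hom Y Z) (H : Hom Z Z') :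
    (F.comp G).comp H = F.comp (G.comp H) := Hom.ext' rfl fun _ _ _ _ _ => rfl

theorem Hom.id_comp {X Y : SuperSpace} (F : Hom X Y) : (Hom.id X).comp F = F :=
  CategoryTheory.Category.id_comp (obj := SuperSpace) F

/-- The morphism of models given by a smooth map and an algebra map of Grassmann algebras. -/
noncomputable def smoothMap {E E' : Type} [NormedAddCommGroup E] [NormedSpace ℝ E]
    [NormedAddCommGroup E'] [NormedSpace ℝ E'] {q q' : ℕ} (β : E' → E) (hβ : ContDiff ℝ ∞ β)
    (m : (Fin q → ℝ) →ₗ[ℝ] (Fin q' → ℝ)) : Hom (modelSpace E' q') (modelSpace E q) where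
  base := β
  cont := hβ.continuous
  pull V C h :=
    { toFun := fun f => smoothSections.mapLin (ExteriorAlgebra.map m).toLinearMap
        (smoothSections.comap β V C (fun _ _ => hβ.contDiffAt) h f)
      map_one' := smoothSections.ext fun _ => map_one (ExteriorAlgebra.map m)
      map_mul' := fun _ _ => smoothSections.ext fun _ => map_mul (ExteriorAlgebra.map m) _ _
      map_zero' := smoothSections.ext fun _ => map_zero (ExteriorAlgebra.map m)
      map_add' := fun _ _ => smoothSections.ext fun _ => map_add (ExteriorAlgebra.map m) _ _
      commutes' := fun r => smoothSections.ext fun _ => AlgHom.commutes (ExteriorAlgebra.map m) r }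
  pull_gr V C h i s hs := fun y =>
    Grass.map_mem_gr (B := Grass q') (ExteriorAlgebra.map m) (fun v => by
      rw [ExteriorAlgebra.map_apply_ι]
      exact CliffordAlgebra.ι_mem_evenOdd_one _ _) i _ (smoothSections.mem_gr_iff.mp hs _)
  pull_res hV hC h h' s := rfl

theorem smoothMap_coord {E E' : Type} [NormedAddCommGroup E] [NormedSpace ℝ E]
    [NormedAddCommGroup E'] [NormedSpace ℝ E'] [FiniteDimensional ℝ E] [FiniteDimensional ℝ E']
    {q q' : ℕ} {ι ι' : Type} (b : Module.Basis ι ℝ E) (b' : Module.Basis ι' ℝ E') (β : E' → E)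
    (hβ : ContDiff ℝ ∞ β) (m : (Fin q → ℝ) →ₗ[ℝ] (Fin q' → ℝ)) (i : ι) (i' : ι')
    (h : ∀ y, b.coord i (β y) = b'.coord i' y) :
    (smoothMap β hβ m).pull ⊤ ⊤ (fun _ _ => trivial) (smoothSections.coord q b i ⊤) =
      smoothSections.coord q' b' i' ⊤ := by
  refine smoothSections.ext fun y => ?_
  change ExteriorAlgebra.map m (algebraMap ℝ _ (b.coord i (β y.1))) =
    algebraMap ℝ _ (b'.coord i' y.1)
  rw [AlgHom.commutes, h]

theorem smoothMap_const {E E' : Type} [NormedAddCommGroup E] [NormedSpace ℝ E]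
    [NormedAddCommGroup E'] [NormedSpace ℝ E'] {q q' : ℕ} (β : E' → E)
    (hβ : ContDiff ℝ ∞ β) (m : (Fin q → ℝ) →ₗ[ℝ] (Fin q' → ℝ)) (v : Fin q → ℝ) :
    (smoothMap β hβ m).pull ⊤ ⊤ (fun _ _ => trivial)
        (smoothSections.const E q ⊤ (ExteriorAlgebra.ι ℝ v)) =
      smoothSections.const E' q' ⊤ (ExteriorAlgebra.ι ℝ (m v)) :=
  smoothSections.ext fun _ => ExteriorAlgebra.map_apply_ι m v

section Product

variable (E : Type) [NormedAddCommGroup E] [NormedSpace ℝ E] (q : ℕ)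

/-- The projection `E × ℝ^{|q+1} → E^{|q}`. -/
noncomputable def modelFst : Hom (modelSpace (E × ℝ) (q + 1)) (modelSpace E q) :=
  smoothMap Prod.fst contDiff_fst (Grass.inclGen q)

/-- The generator of the Grassmann algebra of `ℝ^{1|1}` is sent to the first generator. -/
def thetaGen : (Fin 1 → ℝ) →ₗ[ℝ] (Fin (q + 1) → ℝ) :=
  (LinearMap.proj 0).smulRight (Fin.cons 1 0)

/-- The projection `E × ℝ^{|q+1} → ℝ^{1|1}`. -/
noncomputable def modelSnd : Hom (modelSpace (E × ℝ) (q + 1)) SuperMfd.R11space :=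
  smoothMap Prod.snd contDiff_snd (thetaGen q)

end Product

end SuperSpace

namespace SuperMfd

open SuperSpace CategoryTheory

section Model

variable {T : SuperMfd} {E : Type} [NormedAddCommGroup E] [NormedSpace ℝ E]
  [FiniteDimensional ℝ E] {q : ℕ} {ι : Type}

/-- The basis of `E × ℝ` that extends a basis of `E`. -/
noncomputable def prodBasis (b : Module.Basis ι ℝ E) : Module.Basis (ι ⊕ Unit) ℝ (E × ℝ) :=
  b.prod realBasis

theorem modelFst_coord (b : Module.Basis ι ℝ E) (i : ι) :
    (modelFst E q).pull ⊤ ⊤ (fun _ _ => trivial) (smoothSections.coord q b i ⊤) =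
      smoothSections.coord (q + 1) (prodBasis b) (Sum.inl i) ⊤ :=
  smoothMap_coord b (prodBasis b) _ _ _ i (Sum.inl i) fun y => by simp [prodBasis]

theorem modelFst_const {E : Type} [NormedAddCommGroup E] [NormedSpace ℝ E] (v : Fin q → ℝ) :
    (modelFst E q).pull ⊤ ⊤ (fun _ _ => trivial)
        (smoothSections.const E q ⊤ (ExteriorAlgebra.ι ℝ v)) =
      smoothSections.const (E × ℝ) (q + 1) ⊤ (ExteriorAlgebra.ι ℝ (Grass.inclGen q v)) :=
  smoothMap_const _ _ _ v

theorem modelSnd_t (b : Module.Basis ι ℝ E) :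
    (modelSnd E q).pull ⊤ ⊤ (fun _ _ => trivial) stdCoords.t =
      smoothSections.coord (q + 1) (prodBasis b) (Sum.inr ()) ⊤ := by
  rw [← coord_realBasis ()]
  exact smoothMap_coord realBasis (prodBasis b) _ _ _ () (Sum.inr ()) fun y => by simp [prodBasis]

theorem modelSnd_θ {E : Type} [NormedAddCommGroup E] [NormedSpace ℝ E] :
    (modelSnd E q).pull ⊤ ⊤ (fun _ _ => trivial) stdCoords.θ =
      smoothSections.const (E × ℝ) (q + 1) ⊤ (Grass.theta q) := by
  refine (smoothMap_const (q := 1) _ _ (thetaGen q) fun _ => 1).trans ?_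
  congr 2
  simp [thetaGen]

/-- A map to `E × ℝ^{|q+1}` is determined by its two projections. -/
theorem hom_model_prod_ext {F G : Hom T.X (modelSpace (E × ℝ) (q + 1))}
    (h1 : F.comp (modelFst E q) = G.comp (modelFst E q))
    (h2 : F.comp (modelSnd E q) = G.comp (modelSnd E q)) : F = G := by
  let b := Module.finBasis ℝ E
  have e1 : ∀ (H : Hom T.X (modelSpace (E × ℝ) (q + 1))) (s : smoothSections E q ⊤),
      (H.comp (modelFst E q)).pull ⊤ ⊤ (fun _ _ => trivial) s =
        H.pull ⊤ ⊤ (fun _ _ => trivial) ((modelFst E q).pull ⊤ ⊤ (fun _ _ => trivial) s) :=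
    fun H s => H.comp_pull (modelFst E q) ⊤ ⊤ ⊤ (fun _ _ => trivial) (fun _ _ => trivial)
      (fun _ _ => trivial) s
  have e2 : ∀ (H : Hom T.X (modelSpace (E × ℝ) (q + 1))) (s : smoothSections ℝ 1 ⊤),
      (H.comp (modelSnd E q)).pull ⊤ ⊤ (fun _ _ => trivial) s =
        H.pull ⊤ ⊤ (fun _ _ => trivial) ((modelSnd E q).pull ⊤ ⊤ (fun _ _ => trivial) s) :=
    fun H s => H.comp_pull (modelSnd E q) ⊤ ⊤ ⊤ (fun _ _ => trivial) (fun _ _ => trivial)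
      (fun _ _ => trivial) s
  have f1 : ∀ s : smoothSections E q ⊤,
      F.pull ⊤ ⊤ (fun _ _ => trivial) ((modelFst E q).pull ⊤ ⊤ (fun _ _ => trivial) s) =
        G.pull ⊤ ⊤ (fun _ _ => trivial) ((modelFst E q).pull ⊤ ⊤ (fun _ _ => trivial) s) :=
    fun s => by rw [← e1, ← e1, h1]
  have f2 : ∀ s : smoothSections ℝ 1 ⊤,
      F.pull ⊤ ⊤ (fun _ _ => trivial) ((modelSnd E q).pull ⊤ ⊤ (fun _ _ => trivial) s) =
        G.pull ⊤ ⊤ (fun _ _ => trivial) ((modelSnd E q).pull ⊤ ⊤ (fun _ _ => trivial) s) :=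
    fun s => by rw [← e2, ← e2, h2]
  refine hom_model_ext (prodBasis b) ?_ fun v => ?_
  · rintro (i | i)
    · rw [← modelFst_coord]
      exact f1 _
    · rw [← modelSnd_t]
      exact f2 _
  · have a1 := f1 (smoothSections.const E q ⊤ (ExteriorAlgebra.ι ℝ (Grass.projGen q v)))
    have a2 := f2 stdCoords.θ
    rw [modelFst_const] at a1
    rw [modelSnd_θ] at a2
    rw [Grass.ι_eq_add, map_add, map_smul]
    exact (map_add _ _ _).trans ((congrArg₂ (· + ·) a1 ((map_smul _ _ _).trans
      ((congrArg (v 0 • ·) a2).trans (map_smul _ _ _).symm))).trans (map_add _ _ _).symm)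

/-- A map to `E × ℝ^{|q+1}` is given by maps to the two factors. -/
theorem exists_hom_model_prod (F₁ : Hom T.X (modelSpace E q)) (F₂ : Hom T.X R11space) :
    ∃ F : Hom T.X (modelSpace (E × ℝ) (q + 1)),
      F.comp (modelFst E q) = F₁ ∧ F.comp (modelSnd E q) = F₂ := by
  let b := Module.finBasis ℝ E
  let p : ModelPt (Fin (Module.finrank ℝ E) ⊕ Unit) (q + 1) T.Fun :=
    { x := Sum.elim (fun i => F₁.pull ⊤ ⊤ (fun _ _ => trivial) (smoothSections.coord q b i ⊤))
        fun _ => (coords (T := T) F₂).t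
      θ := (F₁.pull ⊤ ⊤ (fun _ _ => trivial)).toLinearMap.comp
          ((smoothSections.const E q ⊤).toLinearMap.comp
            ((ExteriorAlgebra.ι ℝ).comp (Grass.projGen q))) +
        (LinearMap.proj 0).smulRight (coords (T := T) F₂).θ
      even := by
        rintro (i | i)
        · refine F₁.pull_gr _ _ _ 0 _ (smoothSections.mem_gr_iff.mpr fun y => ?_)
          change algebraMap ℝ (Grass q) _ ∈ _
          rw [Algebra.algebraMap_eq_smul_one]
          exact Submodule.smul_mem _ _ (Grass.superAlgebra q).one_mem
        · exact (coords (T := T) F₂).even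
      odd := fun v => add_mem (F₁.pull_gr _ _ _ 1 _ (smoothSections.mem_gr_iff.mpr fun y =>
        CliffordAlgebra.ι_mem_evenOdd_one _ _)) (Submodule.smul_mem _ _ (coords (T := T) F₂).odd) }
  obtain ⟨F, hF, hF'⟩ := exists_hom_model (prodBasis b) p
  refine ⟨F, hom_model_ext b (fun i => ?_) fun v => ?_, coords_injective (T := T) ?_⟩
  · refine (F.comp_pull _ ⊤ ⊤ ⊤ _ (fun _ _ => trivial) (fun _ _ => trivial) _).trans ?_
    exact (congrArg _ (modelFst_coord b i)).trans (hF (Sum.inl i))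
  · refine (F.comp_pull _ ⊤ ⊤ ⊤ _ (fun _ _ => trivial) (fun _ _ => trivial) _).trans ?_
    refine ((congrArg _ (modelFst_const v)).trans (hF' (Grass.inclGen q v))).trans ?_
    change F₁.pull ⊤ ⊤ _ (smoothSections.const E q ⊤ (ExteriorAlgebra.ι ℝ
      (Grass.projGen q (Grass.inclGen q v)))) + (0 : ℝ) • (coords (T := T) F₂).θ = _
    rw [Grass.projGen_inclGen, zero_smul, add_zero]
  · refine R11Pt.ext ?_ ?_
    · refine (F.comp_pull (modelSnd E q) ⊤ ⊤ ⊤ (fun _ _ => trivial) (fun _ _ => trivial)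
        (fun _ _ => trivial) _).trans ?_
      exact (congrArg _ (modelSnd_t b)).trans (hF (Sum.inr ()))
    · refine (F.comp_pull (modelSnd E q) ⊤ ⊤ ⊤ (fun _ _ => trivial) (fun _ _ => trivial)
        (fun _ _ => trivial) _).trans ?_
      refine ((congrArg _ modelSnd_θ).trans (hF' (Fin.cons 1 0))).trans ?_
      change F₁.pull ⊤ ⊤ _ (smoothSections.const E q ⊤ (ExteriorAlgebra.ι ℝ (0 : Fin q → ℝ))) +
        (1 : ℝ) • (coords (T := T) F₂).θ = _
      rw [map_zero, map_zero, one_smul]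
      exact (congrArg (· + _) (map_zero _)).trans (zero_add _)

end Model

/-! ### Products of supermanifolds -/

namespace Prd

variable {S N T : SuperMfd} (Q : Prd S N)

theorem exists_lift (f : T ⟶ S) (g : T ⟶ N) : ∃ h : T ⟶ Q.tot, h ≫ Q.fst = f ∧ h ≫ Q.snd = g :=
  let l := Q.isProd.some
  ⟨l.lift (Limits.BinaryFan.mk f g), l.fac (Limits.BinaryFan.mk f g) ⟨Limits.WalkingPair.left⟩,
    l.fac (Limits.BinaryFan.mk f g) ⟨Limits.WalkingPair.right⟩⟩

theorem hom_ext {f g : T ⟶ Q.tot} (h1 : f ≫ Q.fst = g ≫ Q.fst) (h2 : f ≫ Q.snd = g ≫ Q.snd) :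
    f = g :=
  Limits.BinaryFan.IsLimit.hom_ext Q.isProd.some h1 h2

end Prd

section ProductChart

variable {S N : SuperMfd}

/-- The product of the domain of a chart with the open set `V` of the superline. -/
noncomputable def box (c : Patch S) (V : Opens ℝ) : SuperMfd :=
  (model (c.E × ℝ) (c.q + 1)).restrict (smoothSections.prodOpens c.U V)

/-- The projection of a product domain to the domain of the chart. -/
noncomputable def boxFst (c : Patch S) (V : Opens ℝ) :
    Hom (box c V).X ((modelSpace c.E c.q).restrict c.U) :=
  ((modelSpace c.E c.q).incl_isOpenEmb c.U).lift
    (((modelSpace (c.E × ℝ) (c.q + 1)).incl (smoothSections.prodOpens c.U V)).comp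
      (modelFst c.E c.q)) fun z => ⟨⟨z.1.1, z.2.1⟩, rfl⟩

theorem boxFst_comp (c : Patch S) (V : Opens ℝ) :
    (boxFst c V).comp ((modelSpace c.E c.q).incl c.U) =
      ((modelSpace (c.E × ℝ) (c.q + 1)).incl (smoothSections.prodOpens c.U V)).comp
        (modelFst c.E c.q) := Hom.IsOpenEmb.lift_comp _ _ _

/-- The projection of a product domain to the superline. -/
noncomputable def boxSnd (c : Patch S) (V : Opens ℝ) : Hom (box c V).X R11space :=
  ((modelSpace (c.E × ℝ) (c.q + 1)).incl (smoothSections.prodOpens c.U V)).comp (modelSnd c.E c.q)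

/-- A chart of the product of `S` and `N` over a chart of `S`, compatible with the projections, for
`j : N ⟶ ℝ^{1|1}` with range `V`. -/
structure BoxChart (Q : Prd S N) (j : N ⟶ R11) (V : Opens ℝ) (c : Patch S) where
  ψ : Hom (box c V).X Q.tot.X
  emb : ψ.IsOpenEmb
  comp_fst : ψ.comp Q.fst = (boxFst c V).comp c.φ
  comp_snd : (ψ.comp Q.snd).comp j = boxSnd c V
  mem_range : ∀ z, Hom.base Q.fst z ∈ c.range → z ∈ Set.range ψ.base

/-- A chart of `S` and an open embedding of `N` in the superline give a chart of the product of `S`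
and `N`. -/
theorem nonempty_boxChart (Q : Prd S N) (j : N ⟶ R11) (hj : IsOpenEmb j) (V : Opens ℝ)
    (hV : ∀ t : ℝ, t ∈ V ↔ t ∈ Set.range (Hom.base j)) (c : Patch S) :
    Nonempty (BoxChart Q j V c) := by
  have hj' : Hom.IsOpenEmb j := hj
  let B := smoothSections.prodOpens c.U V
  let iB : Hom (box c V).X (modelSpace (c.E × ℝ) (c.q + 1)) :=
    (modelSpace (c.E × ℝ) (c.q + 1)).incl B
  have hiB : iB.IsOpenEmb := (modelSpace (c.E × ℝ) (c.q + 1)).incl_isOpenEmb B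
  let iU := (modelSpace c.E c.q).incl c.U
  let s2 : Hom (box c V).X N.X := hj'.lift (boxSnd c V) fun z => (hV _).mp z.2.2
  have hs2 : s2.comp j = boxSnd c V := hj'.lift_comp _ _
  obtain ⟨ψ, hψ1, hψ2⟩ := Q.exists_lift (T := box c V) ((boxFst c V).comp c.φ) s2
  have hψ1' : Hom.comp ψ Q.fst = (boxFst c V).comp c.φ := hψ1
  have hψ2' : Hom.comp ψ Q.snd = s2 := hψ2
  let W : Opens Q.tot.X.pt := Hom.pre Q.fst c.range
  let iW : Hom (Q.tot.restrict W).X Q.tot.X := Q.tot.X.incl W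
  have hiW : iW.IsOpenEmb := Q.tot.X.incl_isOpenEmb W
  let f1 : Hom (Q.tot.restrict W).X ((modelSpace c.E c.q).restrict c.U) :=
    c.emb.lift (iW.comp Q.fst) fun z => z.2
  have hf1 : f1.comp c.φ = iW.comp Q.fst := c.emb.lift_comp _ _
  let f2 : Hom (Q.tot.restrict W).X R11space := (iW.comp Q.snd).comp j
  obtain ⟨k0, hk1, hk2⟩ := exists_hom_model_prod (T := Q.tot.restrict W) (f1.comp iU) f2
  have hk0 : ∀ z, k0.base z ∈ Set.range iB.base := by
    intro z
    have b1 : (k0.base z).1 = (f1.base z).1 := Hom.congr_base hk1 z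
    have b2 : (k0.base z).2 = f2.base z := Hom.congr_base hk2 z
    refine ⟨⟨k0.base z, ?_, ?_⟩, rfl⟩
    · change (k0.base z).1 ∈ c.U
      rw [b1]
      exact (f1.base z).2
    · change (k0.base z).2 ∈ V
      rw [b2]
      exact (hV _).mpr ⟨_, rfl⟩
  let k : Hom (Q.tot.restrict W).X (box c V).X := hiB.lift k0 hk0
  have hk : k.comp iB = k0 := hiB.lift_comp _ _
  have k1 : k.comp (boxFst c V) = f1 := by
    refine ((modelSpace c.E c.q).incl_isOpenEmb c.U).cancel ?_
    exact (k.comp_assoc _ _).trans ((congrArg k.comp (boxFst_comp c V)).trans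
      ((k.comp_assoc iB _).symm.trans ((congrArg (fun F => F.comp (modelFst c.E c.q)) hk).trans hk1)))
  have k2 : k.comp (boxSnd c V) = f2 := by
    exact (k.comp_assoc iB _).symm.trans
      ((congrArg (fun F => F.comp (modelSnd c.E c.q)) hk).trans hk2)
  -- `k` is the inverse of `ψ` on the part `W` of the product over the chart
  have kψ : k.comp ψ = iW := by
    refine Q.hom_ext (T := Q.tot.restrict W) ?_ ?_
    · exact (k.comp_assoc ψ Q.fst).trans ((congrArg k.comp hψ1').trans
        ((k.comp_assoc _ c.φ).symm.trans ((congrArg (fun F => F.comp c.φ) k1).trans hf1)))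
    · refine hj'.cancel ?_
      exact (k.comp_assoc _ _).trans ((congrArg k.comp ((congrArg (fun F => Hom.comp F j)
        hψ2').trans hs2)).trans k2)
  have hψW : ∀ z, Hom.base ψ z ∈ Set.range iW.base := by
    intro z
    have b1 := Hom.congr_base hψ1' z
    refine ⟨⟨Hom.base ψ z, ?_⟩, rfl⟩
    change Hom.base (Hom.comp ψ Q.fst) z ∈ c.range
    rw [hψ1']
    exact ⟨_, rfl⟩
  let ψ' : Hom (box c V).X (Q.tot.restrict W).X := hiW.lift ψ hψW
  have hψ' : ψ'.comp iW = ψ := hiW.lift_comp _ _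
  have e1 : ψ'.comp k = Hom.id _ := by
    refine hiB.cancel ?_
    refine (ψ'.comp_assoc k iB).trans ((congrArg ψ'.comp hk).trans ?_)
    refine Eq.trans ?_ (Hom.id_comp iB).symm
    have g1 : ψ'.comp f1 = boxFst c V := by
      refine c.emb.cancel ?_
      exact (ψ'.comp_assoc _ _).trans ((congrArg ψ'.comp hf1).trans
        ((ψ'.comp_assoc iW Q.fst).symm.trans ((congrArg (fun F => F.comp Q.fst) hψ').trans hψ1')))
    refine hom_model_prod_ext (T := box c V) ?_ ?_
    · exact (ψ'.comp_assoc _ _).trans ((congrArg ψ'.comp hk1).trans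
        ((ψ'.comp_assoc f1 iU).symm.trans ((congrArg (fun F => F.comp iU) g1).trans
          (boxFst_comp c V))))
    · refine (ψ'.comp_assoc _ _).trans ((congrArg ψ'.comp hk2).trans ?_)
      refine (congrArg (fun F => (Hom.comp F Q.snd).comp j) hψ').trans ?_
      exact (congrArg (fun F => Hom.comp F j) hψ2').trans hs2
  have e2 : k.comp ψ' = Hom.id _ := by
    refine hiW.cancel ?_
    exact (k.comp_assoc _ _).trans ((congrArg k.comp hψ').trans (kψ.trans (Hom.id_comp iW).symm))
  refine ⟨ψ, ?_, hψ1', ?_, fun z hz => ⟨k.base ⟨z, hz⟩, Hom.congr_base kψ ⟨z, hz⟩⟩⟩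
  · rw [← hψ']
    exact (Hom.IsOpenEmb.of_inverse e1 e2).comp hiW
  · rw [hψ2', hs2]

end ProductChart

end SuperMfd

/-! ### Vertical vector fields from charts -/

/-- A homogeneous derivation of parity `i` of the sheaf of functions on `E^{|q}`. -/
structure ModelDer (E : Type) [NormedAddCommGroup E] [NormedSpace ℝ E] (q : ℕ) (i : ZMod 2) where
  D : ∀ C : Opens E, smoothSections E q C →ₗ[ℝ] smoothSections E q C
  restr_D : ∀ {C C' : Opens E} (h : C ≤ C') (f : smoothSections E q C'),
    smoothSections.restr h (D C' f) = D C (smoothSections.restr h f)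
  D_gr : ∀ (C : Opens E) (j : ZMod 2) (f : smoothSections E q C),
    f ∈ gr (A := smoothSections E q C) j → D C f ∈ gr (A := smoothSections E q C) (i + j)
  leibniz : ∀ (C : Opens E) (j : ZMod 2) (f g : smoothSections E q C),
    f ∈ gr (A := smoothSections E q C) j →
      D C (f * g) = D C f * g + (-1 : ℝ) ^ (i.val * j.val) • (f * D C g)

/-- The derivation `∂/∂t` on `E × ℝ^{|q}`, where `t` is the coordinate on the factor `ℝ`. -/
noncomputable def partialT (E : Type) [NormedAddCommGroup E] [NormedSpace ℝ E] (q : ℕ) :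
    ModelDer (E × ℝ) q 0 where
  D C := smoothSections.pd (0, 1)
  restr_D h f := (smoothSections.pd_restr _ h f).symm
  D_gr C j f hf := by
    rw [zero_add]
    exact smoothSections.mem_gr_iff.mpr (smoothSections.pd_mem _ _ f (smoothSections.mem_gr_iff.mp hf))
  leibniz C j f g hf := by
    rw [ZMod.val_zero, zero_mul, pow_zero, one_smul]
    exact smoothSections.pd_mul _ f g

/-- The derivation `∂/∂θ` on `E × ℝ^{|q+1}`, where `θ` is the generator `θ₀`. -/
noncomputable def partialTheta (E : Type) [NormedAddCommGroup E] [NormedSpace ℝ E] (q : ℕ) :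
    ModelDer (E × ℝ) (q + 1) 1 where
  D C := smoothSections.mapLin (Grass.dtheta q)
  restr_D h f := rfl
  D_gr C j f hf := smoothSections.mem_gr_iff.mpr fun x =>
    Grass.oddDeriv_mem_part _ (smoothSections.mem_gr_iff.mp hf x)
  leibniz C j f g hf := smoothSections.ext fun x => by
    rw [ZMod.val_one, one_mul]
    exact Grass.oddDeriv_mul_of_mem _ (smoothSections.mem_gr_iff.mp hf x) _

namespace SuperSpace

variable {E : Type} [NormedAddCommGroup E] [NormedSpace ℝ E] {q : ℕ} {B : Opens E}
  {X : SuperSpace}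

/-- Sections over an open subset of a chart as smooth functions on an open subset of the model. -/
noncomputable def chartEquiv (ψ : Hom ((modelSpace E q).restrict B) X) (hψ : ψ.IsOpenEmb)
    (V : Opens X.pt) (hV : (V : Set X.pt) ⊆ Set.range ψ.base) :
    X.O V ≃ₐ[ℝ] smoothSections E q (img B (ψ.pre V)) :=
  AlgEquiv.ofBijective (ψ.pull V (ψ.pre V) fun _ hx => hx) (hψ.2 V hV)

theorem chartEquiv_res (ψ : Hom ((modelSpace E q).restrict B) X) (hψ : ψ.IsOpenEmb)
    {V V' : Opens X.pt} (h : V ≤ V') (hV' : (V' : Set X.pt) ⊆ Set.range ψ.base) (f : X.O V') :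
    chartEquiv ψ hψ V (fun _ hx => hV' (h hx)) (X.res h f) =
      smoothSections.restr (img_mono B (show ψ.pre V ≤ ψ.pre V' from fun _ hx => h hx))
        (chartEquiv ψ hψ V' hV' f) :=
  (ψ.pull_res' h _ f).trans (ψ.res_pull (V := V') (show ψ.pre V ≤ ψ.pre V' from fun _ hx => h hx)
    (fun _ hx => hx) f).symm

theorem chartEquiv_gr (ψ : Hom ((modelSpace E q).restrict B) X) (hψ : ψ.IsOpenEmb)
    (V : Opens X.pt) (hV : (V : Set X.pt) ⊆ Set.range ψ.base) (i : ZMod 2) (f : X.O V) :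
    f ∈ gr (A := X.O V) i ↔
      chartEquiv ψ hψ V hV f ∈ gr (A := smoothSections E q (img B (ψ.pre V))) i :=
  ⟨fun h => ψ.pull_gr _ _ _ i f h, fun h => gr_of_map_gr (ψ.pull V (ψ.pre V) fun _ hx => hx)
    (hψ.2 V hV).1 (ψ.pull_gr _ _ _) i f h⟩

end SuperSpace

namespace SuperMfd

open SuperSpace CategoryTheory

/-- The vertical vector field on the range of a chart given by a derivation on the model. -/
noncomputable def _root_.ModelDer.toVField {E : Type} [NormedAddCommGroup E] [NormedSpace ℝ E]
    {q : ℕ} {i : ZMod 2} (d : ModelDer E q i) {B : Opens E} {P S : SuperMfd} (π : P ⟶ S)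
    (ψ : Hom ((modelSpace E q).restrict B) P.X) (hψ : ψ.IsOpenEmb) (W : Opens P.X.pt)
    (hW : (W : Set P.X.pt) ⊆ Set.range ψ.base)
    (hvert : ∀ (C : Opens B) (T : Opens S.X.pt) (hT : ∀ x ∈ C, (ψ.comp π).base x ∈ T) (f : S.X.O T),
      d.D (img B C) ((ψ.comp π).pull T C hT f) = 0) : VField π W i where
  D V h := (chartEquiv ψ hψ V (fun _ hx => hW (h hx))).symm.toLinearMap.comp
    ((d.D _).comp (chartEquiv ψ hψ V (fun _ hx => hW (h hx))).toLinearMap)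
  D_res {V V'} h h' f := by
    apply (chartEquiv ψ hψ V fun _ hx => hW (h' (h hx))).injective
    refine (chartEquiv_res ψ hψ h (fun _ hx => hW (h' hx)) _).trans ?_
    refine (congrArg _ (AlgEquiv.apply_symm_apply _ _)).trans ?_
    refine (d.restr_D _ _).trans ?_
    refine Eq.trans ?_ (AlgEquiv.apply_symm_apply _ _).symm
    exact congrArg (d.D _) (chartEquiv_res ψ hψ h (fun _ hx => hW (h' hx)) f).symm
  D_gr V h j f hf := by
    refine (chartEquiv_gr ψ hψ V (fun _ hx => hW (h hx)) _ _).mpr ?_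
    have h1 := d.D_gr _ j _ ((chartEquiv_gr ψ hψ V (fun _ hx => hW (h hx)) j f).mp hf)
    exact Eq.mpr (congrArg (fun s => s ∈ gr (A := smoothSections E q (img B (ψ.pre V))) (i + j))
      (AlgEquiv.apply_symm_apply (chartEquiv ψ hψ V (fun _ hx => hW (h hx))) _)) h1
  leibniz V h j f g hf := by
    let e := chartEquiv ψ hψ V (fun _ hx => hW (h hx))
    have h1 := d.leibniz _ j (e f) (e g) ((chartEquiv_gr ψ hψ V (fun _ hx => hW (h hx)) j f).mp hf)
    change e.symm (d.D _ (e (f * g))) = e.symm (d.D _ (e f)) * g +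
      (-1 : ℝ) ^ (i.val * j.val) • (f * e.symm (d.D _ (e g)))
    apply e.injective
    rw [map_add, map_smul, map_mul e (e.symm _) g, map_mul e f (e.symm _), AlgEquiv.apply_symm_apply,
      AlgEquiv.apply_symm_apply, AlgEquiv.apply_symm_apply, map_mul, h1]
  vert V h T hT f := by
    apply (chartEquiv ψ hψ V fun _ hx => hW (h hx)).injective
    refine (AlgEquiv.apply_symm_apply _ _).trans (Eq.trans ?_ (map_zero _).symm)
    have h1 := ψ.comp_pull π T V (ψ.pre V) (fun x hx => hT _ hx) (fun _ hx => hx) hT f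
    exact (congrArg (d.D _) h1.symm).trans (hvert (ψ.pre V) T (fun x hx => hT _ hx) f)

theorem _root_.ModelDer.chartEquiv_toVField {E : Type} [NormedAddCommGroup E] [NormedSpace ℝ E]
    {q : ℕ} {i : ZMod 2} (d : ModelDer E q i) {B : Opens E} {P S : SuperMfd} (π : P ⟶ S)
    (ψ : Hom ((modelSpace E q).restrict B) P.X) (hψ : ψ.IsOpenEmb) (W : Opens P.X.pt)
    (hW : (W : Set P.X.pt) ⊆ Set.range ψ.base)
    (hvert : ∀ (C : Opens B) (T : Opens S.X.pt) (hT : ∀ x ∈ C, (ψ.comp π).base x ∈ T) (f : S.X.O T),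
      d.D (img B C) ((ψ.comp π).pull T C hT f) = 0) (f : P.X.O W) :
    chartEquiv ψ hψ W hW ((d.toVField π ψ hψ W hW hvert).D W le_rfl f) =
      d.D _ (chartEquiv ψ hψ W hW f) :=
  AlgEquiv.apply_symm_apply _ _

/-- The contraction of `F^* ω` with a vector field given by a derivation on the model. -/
theorem chartEquiv_pullω {E : Type} [NormedAddCommGroup E] [NormedSpace ℝ E]
    {q : ℕ} {i : ZMod 2} (d : ModelDer E q i) {B : Opens E} {P S : SuperMfd} (π : P ⟶ S)
    (ψ : Hom ((modelSpace E q).restrict B) P.X) (hψ : ψ.IsOpenEmb) (W : Opens P.X.pt)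
    (hW : (W : Set P.X.pt) ⊆ Set.range ψ.base)
    (hvert : ∀ (C : Opens B) (T : Opens S.X.pt) (hT : ∀ x ∈ C, (ψ.comp π).base x ∈ T) (f : S.X.O T),
      d.D (img B C) ((ψ.comp π).pull T C hT f) = 0) (F : P ⟶ R11) :
    chartEquiv ψ hψ W hW (pullω π F W i (d.toVField π ψ hψ W hW hvert)) =
      d.D _ (chartEquiv ψ hψ W hW (P.X.res le_top (coords F).t)) -
        (-1 : ℝ) ^ (i.val * (1 : ZMod 2).val) •
          (chartEquiv ψ hψ W hW (P.X.res le_top (coords F).θ) *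
            d.D _ (chartEquiv ψ hψ W hW (P.X.res le_top (coords F).θ))) := by
  rw [← d.chartEquiv_toVField π ψ hψ W hW hvert, ← d.chartEquiv_toVField π ψ hψ W hW hvert,
    ← map_mul, ← map_smul, ← map_sub]
  rfl

end SuperMfd

/-! ### The differential equations of a map that preserves the form -/

/-- The algebraic heart of the argument. If `t' = t'(t, θ)`, `θ' = θ'(t, θ)` satisfy
`dt' - θ' dθ' = dt - θ dθ`, that is, the two equations `e1` and `e2` below, then `u = ∂θ'/∂θ` is a
constant of square one, `η = θ' - uθ` is constant, and so is `r = t' - t - η u θ`. -/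
theorem const_of_preserves_form {A : Type} [Ring A] [Algebra ℝ A] [SuperAlgebra A]
    (dt dθ : A →ₗ[ℝ] A) (hdt : ∀ f g, dt (f * g) = dt f * g + f * dt g)
    (hθ0 : ∀ f g, f ∈ gr (A := A) 0 → dθ (f * g) = dθ f * g + f * dθ g)
    (hθ1 : ∀ f g, f ∈ gr (A := A) 1 → dθ (f * g) = dθ f * g - f * dθ g)
    (hodd : ∀ f, f ∈ gr (A := A) 1 → dθ f ∈ gr (A := A) 0)
    (hcomm : ∀ f, dθ (dt f) = dt (dθ f)) (hsq : ∀ f, dθ (dθ f) = 0)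
    {t θ t' θ' : A} (htt : dt t = 1) (hθt : dt θ = 0) (htθ : dθ t = 0) (hθθ : dθ θ = 1)
    (hθ : θ ∈ gr (A := A) 1) (hθ' : θ' ∈ gr (A := A) 1)
    (ht : t ∈ gr (A := A) 0) (ht' : t' ∈ gr (A := A) 0)
    (e1 : dt t' - θ' * dt θ' = 1) (e2 : dθ t' + θ' * dθ θ' = θ) :
    ∃ r η u : A, (dt r = 0 ∧ dθ r = 0 ∧ r ∈ gr (A := A) 0) ∧
      (dt η = 0 ∧ dθ η = 0 ∧ η ∈ gr (A := A) 1) ∧ (dt u = 0 ∧ dθ u = 0 ∧ u ∈ gr (A := A) 0) ∧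
      u * u = 1 ∧ θ' = η + u * θ ∧ t' = r + t + η * (u * θ) := by
  have hu : dθ θ' ∈ gr (A := A) 0 := hodd θ' hθ'
  have hdu : dθ (dθ θ') = 0 := hsq θ'
  -- apply `∂/∂θ` to `e2`
  have hu2 : dθ θ' * dθ θ' = 1 := by
    have := congrArg dθ e2
    rwa [map_add, hsq, hθ1 _ _ hθ', hdu, mul_zero, sub_zero, zero_add, hθθ] at this
  -- apply `∂/∂t` to `e2` and `∂/∂θ` to `e1`; the difference is `2 u ∂θ'/∂t = 0`
  have h1 : dt (dθ t') + dt θ' * dθ θ' + θ' * dt (dθ θ') = 0 := by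
    have := congrArg dt e2
    rwa [map_add, hdt, hθt, ← add_assoc] at this
  have hone : dθ 1 = 0 := by
    have := hθ0 1 1 SuperAlgebra.one_mem
    simpa using this
  have h2 : dt (dθ t') - dθ θ' * dt θ' + θ' * dt (dθ θ') = 0 := by
    have := congrArg dθ e1
    rwa [map_sub, hθ1 _ _ hθ', hcomm, hcomm, hone, ← sub_add] at this
  have h3 : dθ θ' * dt θ' = 0 := by
    have h4 : (2 : ℝ) • (dθ θ' * dt θ') = 0 := by
      have h5 := congrArg₂ (· - ·) h1 h2
      simp only [sub_zero] at h5
      rw [← SuperAlgebra.even_comm hu] at h5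
      rw [two_smul, ← h5]
      abel
    exact (smul_eq_zero.mp h4).resolve_left two_ne_zero
  have h4 : dt θ' = 0 := by
    rw [← one_mul (dt θ'), ← hu2, mul_assoc, h3, mul_zero]
  have h5 : dt t' = 1 := by rwa [h4, mul_zero, sub_zero] at e1
  have h6 : dt (dθ θ') = 0 := by rw [← hcomm, h4, map_zero]
  have huθ : dθ (dθ θ' * θ) = dθ θ' := by rw [hθ0 _ _ hu, hdu, hθθ, zero_mul, zero_add, mul_one]
  have htuθ : dt (dθ θ' * θ) = 0 := by rw [hdt, h6, hθt, zero_mul, mul_zero, add_zero]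
  have huθ_odd : dθ θ' * θ ∈ gr (A := A) 1 := by simpa using SuperAlgebra.mul_mem hu hθ
  have h7 : dt (θ' - dθ θ' * θ) = 0 := by rw [map_sub, h4, htuθ, sub_zero]
  have h8 : dθ (θ' - dθ θ' * θ) = 0 := by rw [map_sub, huθ, sub_self]
  refine ⟨t' - t - (θ' - dθ θ' * θ) * (dθ θ' * θ), θ' - dθ θ' * θ, dθ θ', ⟨?_, ?_,
    sub_mem (sub_mem ht' ht) (SuperAlgebra.mul_mem (sub_mem hθ' huθ_odd) huθ_odd)⟩,
    ⟨h7, h8, sub_mem hθ' huθ_odd⟩, ⟨h6, hdu, hu⟩, hu2, (sub_add_cancel _ _).symm, by abel⟩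
  · rw [map_sub, map_sub, h5, htt, hdt, h7, htuθ, zero_mul, mul_zero, add_zero, sub_self, sub_zero]
  · rw [map_sub, map_sub, htθ, hθ1 _ _ (sub_mem hθ' huθ_odd), h8, huθ, zero_mul, zero_sub, sub_zero,
      sub_neg_eq_add, sub_mul, mul_assoc, ← SuperAlgebra.even_comm hu θ, ← mul_assoc, hu2, one_mul,
      eq_sub_of_add_eq e2]
    abel

/-! ### Functions that are constant along the fibres -/

namespace smoothSections

variable {E : Type} [NormedAddCommGroup E] [NormedSpace ℝ E] {q : ℕ}

/-- A function that factors through the first factor is killed by `∂/∂t`. -/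
theorem partialT_eq_zero {C : Opens (E × ℝ)} {D : Opens E} (f : smoothSections (E × ℝ) q C)
    (s : smoothSections E q D) (h : ∀ z : C, ∃ hz : z.1.1 ∈ D, f.1 z = s.1 ⟨z.1.1, hz⟩) :
    (partialT E q).D C f = 0 := by
  refine smoothSections.ext fun z => Grass.ext_components fun l => ?_
  refine (map_pd (0, 1) f l z).trans ?_
  have e : (fun z : E × ℝ => l (extZero f.1 z)) =ᶠ[nhds z.1] fun z => l (extZero s.1 z.1) := by
    filter_upwards [C.2.mem_nhds z.2] with w hw
    obtain ⟨hz, e⟩ := h ⟨w, hw⟩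
    rw [extZero_apply _ hw, extZero_apply _ hz, e]
  obtain ⟨hz, -⟩ := h z
  have h2 : HasFDerivAt (fun z : E × ℝ => l (extZero s.1 z.1)) _ z.1 :=
    (differentiableAt s l hz).hasFDerivAt.comp z.1 hasFDerivAt_fst
  rw [e.fderiv_eq, h2.fderiv]
  change fderiv ℝ _ _ (0 : E) = l 0
  rw [map_zero, map_zero]

/-- A function on a product with a connected open subset of the line does not depend on `t` if its
derivative with respect to `t` vanishes. -/
theorem eq_of_partialT_eq_zero {C : Opens (E × ℝ)} (f : smoothSections (E × ℝ) q C)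
    (hf : (partialT E q).D C f = 0) {V : Opens ℝ} (hV : IsPreconnected (V : Set ℝ)) {y : E}
    (hC : ∀ t ∈ V, (y, t) ∈ C) {t t₀ : ℝ} (ht : t ∈ V) (ht₀ : t₀ ∈ V) :
    f.1 ⟨(y, t), hC t ht⟩ = f.1 ⟨(y, t₀), hC t₀ ht₀⟩ := by
  refine Grass.ext_components fun l => ?_
  have hd : ∀ s ∈ V, HasDerivAt (fun s => l (extZero f.1 (y, s))) 0 s := by
    intro s hs
    have h1 := (differentiableAt f l (hC s hs)).hasFDerivAt
    have h2 : HasDerivAt (fun s : ℝ => (y, s)) (0, 1) s :=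
      (hasDerivAt_const s y).prodMk (hasDerivAt_id s)
    have h3 := h1.comp_hasDerivAt s h2
    have h4 : fderiv ℝ (fun z => l (extZero f.1 z)) (y, s) (0, 1) = 0 := by
      rw [← map_pd (0, 1) f l ⟨(y, s), hC s hs⟩]
      refine (congrArg (fun g : smoothSections (E × ℝ) q C => l (g.1 _)) hf).trans ?_
      exact map_zero l
    rwa [h4] at h3
  have := V.2.is_const_of_deriv_eq_zero hV
    (fun s hs => (hd s hs).differentiableAt.differentiableWithinAt) (fun s hs => (hd s hs).deriv)
    ht ht₀
  rwa [extZero_apply _ (hC t ht), extZero_apply _ (hC t₀ ht₀)] at this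

/-- A function on a product domain that is killed by `∂/∂t` and `∂/∂θ` is pulled back from the
first factor. -/
theorem exists_eq_map_inclGen {C : Opens (E × ℝ)} (f : smoothSections (E × ℝ) (q + 1) C)
    (hf : (partialT E (q + 1)).D C f = 0) (hf' : (partialTheta E q).D C f = 0) {V : Opens ℝ}
    (hV : IsPreconnected (V : Set ℝ)) {t₀ : ℝ} (ht₀ : t₀ ∈ V) {U : Opens E}
    (hC : ∀ z : E × ℝ, z ∈ C ↔ z.1 ∈ U ∧ z.2 ∈ V) :
    ∃ g : smoothSections E q U, ∀ z : C,
      f.1 z = ExteriorAlgebra.map (Grass.inclGen q) (g.1 ⟨z.1.1, ((hC _).mp z.2).1⟩) := by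
  refine ⟨mapLin (ExteriorAlgebra.map (Grass.projGen q)).toLinearMap (comap (fun y => (y, t₀)) C U
    (fun _ _ => contDiffAt_id.prodMk contDiffAt_const) (fun y hy => (hC _).mpr ⟨hy, ht₀⟩) f), ?_⟩
  intro z
  have hz := (hC _).mp z.2
  have h1 := eq_of_partialT_eq_zero f hf hV (y := z.1.1) (fun t ht => (hC _).mpr ⟨hz.1, ht⟩) hz.2 ht₀
  refine Eq.trans h1 ((Grass.eq_add_theta_mul_dtheta _).trans ?_)
  have h2 := congrFun (congrArg Subtype.val hf') ⟨(z.1.1, t₀), (hC _).mpr ⟨hz.1, ht₀⟩⟩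
  have h3 : Grass.dtheta q (f.1 ⟨(z.1.1, t₀), (hC _).mpr ⟨hz.1, ht₀⟩⟩) = 0 := h2
  rw [h3, mul_zero, add_zero]
  rfl

end smoothSections

theorem Grass.eq_zero_of_add_mul_theta {q : ℕ} (a b : Grass q)
    (h : ExteriorAlgebra.map (inclGen q) a + ExteriorAlgebra.map (inclGen q) b * theta q = 0) :
    a = 0 ∧ b = 0 := by
  have h1 := congrArg (dtheta q) h
  rw [map_add, dtheta_map_inclGen, zero_add, map_zero, dtheta, oddDeriv_mul] at h1
  have h2 : oddDeriv (LinearMap.proj 0) (ExteriorAlgebra.map (inclGen q) b) = 0 :=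
    dtheta_map_inclGen b
  have h3 : oddDeriv (LinearMap.proj 0) (theta q) = 1 := dtheta_theta
  rw [h2, h3, zero_mul, mul_one, zero_add] at h1
  have h4 : ExteriorAlgebra.map (inclGen q) b = 0 := by
    have := congrArg CliffordAlgebra.involute h1
    rwa [CliffordAlgebra.involute_involute, map_zero] at this
  rw [h4, zero_mul, add_zero] at h
  have h5 := congrArg (ExteriorAlgebra.map (projGen q)) h
  have h6 := congrArg (ExteriorAlgebra.map (projGen q)) h4
  rw [map_projGen_map_inclGen, map_zero] at h5 h6
  exact ⟨h5, h6⟩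

/-! ### Functions on a product that come from the base -/

namespace SuperMfd

open SuperSpace CategoryTheory

section Local

variable {S N : SuperMfd}

/-- The projection of a product to the base, as a morphism of superspaces. -/
def Prd.proj (Q : Prd S N) : Hom Q.tot.X S.X := Q.fst

/-- The part of a product that lies over an open subset of the base. -/
def Prd.over (Q : Prd S N) (D : Opens S.X.pt) : Opens Q.tot.X.pt := Q.proj.pre D

theorem Prd.over_mono (Q : Prd S N) {D D' : Opens S.X.pt} (h : D ≤ D') : Q.over D ≤ Q.over D' :=
  fun _ hx => h hx

/-- Pullback of functions from the base to the product. -/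
def Prd.pullFst (Q : Prd S N) (D : Opens S.X.pt) : S.X.O D →ₐ[ℝ] Q.tot.X.O (Q.over D) :=
  Q.proj.pull D (Q.over D) fun _ hx => hx

theorem Prd.res_pullFst (Q : Prd S N) {D D' : Opens S.X.pt} (h : D ≤ D') (s : S.X.O D') :
    Q.tot.X.res (Q.over_mono h) (Q.pullFst D' s) = Q.pullFst D (S.X.res h s) :=
  (Q.proj.res_pull (V := D') (Q.over_mono h) (fun _ hx => hx) s).trans
    (Q.proj.pull_res' h (fun _ hx => hx) s).symm

theorem Prd.pullFst_gr (Q : Prd S N) (D : Opens S.X.pt) (i : ZMod 2) (s : S.X.O D)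
    (hs : s ∈ gr (A := S.X.O D) i) : Q.pullFst D s ∈ gr (A := Q.tot.X.O (Q.over D)) i :=
  Q.proj.pull_gr _ _ _ i s hs

variable {Q : Prd S N} {j : N ⟶ R11} {V : Opens ℝ} {c : Patch S}

/-- On the product domain, functions from the base are included as functions that do not depend
on `t` and `θ`. -/
theorem boxFst_pull (c : Patch S) (V : Opens ℝ) (D : Opens c.U)
    (C : Opens (smoothSections.prodOpens c.U V)) (h : ∀ z ∈ C, (boxFst c V).base z ∈ D)
    (s : smoothSections c.E c.q (img c.U D)) (z : img (smoothSections.prodOpens c.U V) C) :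
    ∃ hz : z.1.1 ∈ img c.U D,
      ((boxFst c V).pull D C h s : smoothSections (c.E × ℝ) (c.q + 1) (img _ C)).1 z =
        ExteriorAlgebra.map (Grass.inclGen c.q) (s.1 ⟨z.1.1, hz⟩) := by
  let iU := (modelSpace c.E c.q).incl c.U
  have hm : ∀ z ∈ C, ((boxFst c V).comp iU).base z ∈ img c.U D := fun z hz => ⟨_, h z hz, rfl⟩
  have h1 : ∀ y ∈ D, iU.base y ∈ img c.U D := fun y hy => ⟨y, hy, rfl⟩
  have e1 := (boxFst c V).comp_pull iU (img c.U D) D C hm h h1 s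
  have e2 : iU.pull (img c.U D) D h1 s = s := rfl
  have e3 := Hom.congr_pull (boxFst_comp c V) (V := img c.U D) (U := C) hm s
  rw [e2] at e1
  obtain ⟨z, w, hw, rfl⟩ := z
  refine ⟨?_, ?_⟩
  · have := hm w hw
    rw [boxFst_comp] at this
    exact this
  · exact (congrArg (fun g : smoothSections (c.E × ℝ) (c.q + 1) (img _ C) => g.1 _)
      (e1.symm.trans e3))

/-- In a chart of the product, functions from the base do not depend on `t` and `θ`. -/
theorem BoxChart.pull_proj (b : BoxChart Q j V c) (T : Opens S.X.pt)
    (C : Opens (smoothSections.prodOpens c.U V)) (hT : ∀ z ∈ C, (b.ψ.comp Q.proj).base z ∈ T)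
    (s : S.X.O T) (z : img (smoothSections.prodOpens c.U V) C) :
    ∃ hz : z.1.1 ∈ img c.U (c.φ.pre T),
      ((b.ψ.comp Q.proj).pull T C hT s : smoothSections (c.E × ℝ) (c.q + 1) (img _ C)).1 z =
        ExteriorAlgebra.map (Grass.inclGen c.q)
          ((c.φ.pull T (c.φ.pre T) (fun _ hx => hx) s :
            smoothSections c.E c.q (img c.U (c.φ.pre T))).1 ⟨z.1.1, hz⟩) := by
  have e0 : b.ψ.comp Q.proj = (boxFst c V).comp c.φ := b.comp_fst
  have hT' : ∀ z ∈ C, ((boxFst c V).comp c.φ).base z ∈ T := by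
    rw [← e0]
    exact hT
  have e1 := Hom.congr_pull e0 (V := T) (U := C) hT s
  have e2 := (boxFst c V).comp_pull c.φ T (c.φ.pre T) C hT' hT' (fun _ hx => hx) s
  obtain ⟨hz, h⟩ := boxFst_pull c V (c.φ.pre T) C hT' (c.φ.pull T (c.φ.pre T) (fun _ hx => hx) s) z
  exact ⟨hz, (congrArg (fun g : smoothSections (c.E × ℝ) (c.q + 1) (img _ C) => g.1 z)
    (e1.trans e2)).trans h⟩

theorem BoxChart.partialT_pull_proj (b : BoxChart Q j V c)
    (C : Opens (smoothSections.prodOpens c.U V)) (T : Opens S.X.pt)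
    (hT : ∀ z ∈ C, (b.ψ.comp Q.proj).base z ∈ T) (s : S.X.O T) :
    (partialT c.E (c.q + 1)).D (img _ C) ((b.ψ.comp Q.proj).pull T C hT s) = 0 :=
  smoothSections.partialT_eq_zero _ (smoothSections.mapLin
    (ExteriorAlgebra.map (Grass.inclGen c.q)).toLinearMap (c.φ.pull T (c.φ.pre T)
      (fun _ hx => hx) s : smoothSections c.E c.q (img c.U (c.φ.pre T)))) (b.pull_proj T C hT s)

theorem BoxChart.partialTheta_pull_proj (b : BoxChart Q j V c)
    (C : Opens (smoothSections.prodOpens c.U V)) (T : Opens S.X.pt)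
    (hT : ∀ z ∈ C, (b.ψ.comp Q.proj).base z ∈ T) (s : S.X.O T) :
    (partialTheta c.E c.q).D (img _ C) ((b.ψ.comp Q.proj).pull T C hT s) = 0 :=
  smoothSections.ext fun z => by
    obtain ⟨hz, h⟩ := b.pull_proj T C hT s z
    refine (congrArg (Grass.dtheta c.q) h).trans ?_
    exact Grass.dtheta_map_inclGen _

theorem BoxChart.pull_t (b : BoxChart Q j V c) (C : Opens (smoothSections.prodOpens c.U V))
    (z : img (smoothSections.prodOpens c.U V) C) :
    (b.ψ.pull ⊤ C (fun _ _ => trivial) (coords (Q.snd ≫ j)).t :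
      smoothSections (c.E × ℝ) (c.q + 1) (img _ C)).1 z = algebraMap ℝ _ z.1.2 := by
  have e1 := (b.ψ.comp_pull (Hom.comp Q.snd j) ⊤ ⊤ C (fun _ _ => trivial) (fun _ _ => trivial)
    (fun _ _ => trivial) stdCoords.t).symm
  have e2 := Hom.congr_pull ((Hom.comp_assoc _ _ _).symm.trans b.comp_snd) (V := ⊤) (U := C)
    (fun _ _ => trivial) stdCoords.t
  refine (congrArg (fun g : smoothSections (c.E × ℝ) (c.q + 1) (img _ C) => g.1 z)
    (e1.trans e2)).trans ?_
  exact AlgHom.commutes (ExteriorAlgebra.map (thetaGen c.q)) _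

theorem BoxChart.pull_θ (b : BoxChart Q j V c) (C : Opens (smoothSections.prodOpens c.U V))
    (z : img (smoothSections.prodOpens c.U V) C) :
    (b.ψ.pull ⊤ C (fun _ _ => trivial) (coords (Q.snd ≫ j)).θ :
      smoothSections (c.E × ℝ) (c.q + 1) (img _ C)).1 z = Grass.theta c.q := by
  have e1 := (b.ψ.comp_pull (Hom.comp Q.snd j) ⊤ ⊤ C (fun _ _ => trivial) (fun _ _ => trivial)
    (fun _ _ => trivial) stdCoords.θ).symm
  have e2 := Hom.congr_pull ((Hom.comp_assoc _ _ _).symm.trans b.comp_snd) (V := ⊤) (U := C)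
    (fun _ _ => trivial) stdCoords.θ
  refine (congrArg (fun g : smoothSections (c.E × ℝ) (c.q + 1) (img _ C) => g.1 z)
    (e1.trans e2)).trans ?_
  refine (ExteriorAlgebra.map_apply_ι (thetaGen c.q) _).trans ?_
  simp [thetaGen, Grass.theta]

/-- A function which is affine in `θ` with coefficients from the base determines its
coefficients. -/
theorem eq_zero_of_pullFst_add_mul_theta (hb : ∀ c, Nonempty (BoxChart Q j V c))
    (hV : (V : Set ℝ).Nonempty) (D : Opens S.X.pt) (d e : S.X.O D)
    (h : Q.pullFst D d + Q.pullFst D e * Q.tot.X.res le_top (coords (Q.snd ≫ j)).θ = 0) :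
    d = 0 ∧ e = 0 := by
  obtain ⟨t₀, ht₀⟩ := hV
  -- compare values at the point `(y, t₀)` of a chart of the product
  have key : ∀ (c : Patch S) (y : c.U) (hy : c.φ.base y ∈ D),
      valAt c.φ y D hy d = 0 ∧ valAt c.φ y D hy e = 0 := by
    intro c y hy
    obtain ⟨b⟩ := hb c
    have e0 : b.ψ.comp Q.proj = (boxFst c V).comp c.φ := b.comp_fst
    let C : Opens (smoothSections.prodOpens c.U V) := b.ψ.pre (Q.over D)
    let z : smoothSections.prodOpens c.U V := ⟨(y.1, t₀), y.2, ht₀⟩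
    have hbase : ((boxFst c V).base z : c.U) = y :=
      Subtype.ext (Hom.congr_base (boxFst_comp c V) z)
    have hz : z ∈ C := by
      change (b.ψ.comp Q.proj).base z ∈ D
      rw [e0]
      change c.φ.base ((boxFst c V).base z) ∈ D
      rw [hbase]
      exact hy
    let w : img (smoothSections.prodOpens c.U V) C := ⟨z.1, z, hz, rfl⟩
    have hval : ∀ s : S.X.O D, (b.ψ.pull (Q.over D) C (fun _ hx => hx) (Q.pullFst D s) :
        smoothSections (c.E × ℝ) (c.q + 1) (img _ C)).1 w =
          ExteriorAlgebra.map (Grass.inclGen c.q) (valAt c.φ y D hy s) := by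
      intro s
      obtain ⟨hw, h1⟩ := b.pull_proj D C (fun _ hx => hx) s w
      refine Eq.trans ?_ h1
      exact congrArg (fun g : smoothSections (c.E × ℝ) (c.q + 1) (img _ C) => g.1 w)
        (b.ψ.comp_pull Q.proj D (Q.over D) C (fun _ hx => hx) (fun _ hx => hx)
          (fun _ hx => hx) s).symm
    have hθ : (b.ψ.pull (Q.over D) C (fun _ hx => hx)
        (Q.tot.X.res le_top (coords (Q.snd ≫ j)).θ) :
        smoothSections (c.E × ℝ) (c.q + 1) (img _ C)).1 w = Grass.theta c.q :=
      (congrArg (fun g : smoothSections (c.E × ℝ) (c.q + 1) (img _ C) => g.1 w)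
        (b.ψ.pull_res' le_top (fun _ hx => hx) _)).trans (b.pull_θ C w)
    refine Grass.eq_zero_of_add_mul_theta _ _ ?_
    rw [← hval, ← hval, ← hθ]
    have h2 := congrArg (b.ψ.pull (Q.over D) C fun _ hx => hx) h
    rw [map_add, map_mul, map_zero] at h2
    exact congrArg (fun g : smoothSections (c.E × ℝ) (c.q + 1) (img _ C) => g.1 w) h2
  exact ⟨section_ext _ _ fun c y hy => (key c y hy).1.trans (map_zero _).symm,
    section_ext _ _ fun c y hy => (key c y hy).2.trans (map_zero _).symm⟩

theorem pullFst_injective (hb : ∀ c, Nonempty (BoxChart Q j V c)) (hV : (V : Set ℝ).Nonempty)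
    (D : Opens S.X.pt) : Function.Injective (Q.pullFst D) := by
  refine (injective_iff_map_eq_zero _).mpr fun d hd =>
    (eq_zero_of_pullFst_add_mul_theta hb hV D d 0 ?_).1
  rw [hd, map_zero, zero_mul, add_zero]

theorem BoxChart.over_subset_range (b : BoxChart Q j V c) :
    (Q.over c.range : Set Q.tot.X.pt) ⊆ Set.range b.ψ.base := fun z hz => b.mem_range z hz

/-- Functions over a chart of the base that are killed by `∂/∂t` and `∂/∂θ` come from the base. -/
theorem BoxChart.exists_pullFst_eq (b : BoxChart Q j V c) (hV : _root_.IsConnected (V : Set ℝ))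
    (f : Q.tot.X.O (Q.over c.range))
    (hf : (partialT c.E (c.q + 1)).D _ (chartEquiv b.ψ b.emb _ b.over_subset_range f) = 0)
    (hf' : (partialTheta c.E c.q).D _ (chartEquiv b.ψ b.emb _ b.over_subset_range f) = 0) :
    ∃ s : S.X.O c.range, Q.pullFst c.range s = f := by
  obtain ⟨t₀, ht₀⟩ := hV.nonempty
  have hpre : ∀ z : smoothSections.prodOpens c.U V, z ∈ b.ψ.pre (Q.over c.range) := by
    intro z
    have e0 : b.ψ.comp Q.proj = (boxFst c V).comp c.φ := b.comp_fst
    change (b.ψ.comp Q.proj).base z ∈ c.range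
    rw [e0]
    exact ⟨_, rfl⟩
  obtain ⟨g, hg⟩ := smoothSections.exists_eq_map_inclGen _ hf hf' hV.isPreconnected ht₀ (U := c.U)
    fun z => ⟨fun ⟨w, _, hw⟩ => hw ▸ w.2, fun hz => ⟨⟨z, hz⟩, hpre _, rfl⟩⟩
  obtain ⟨s, hs⟩ := (c.emb.2 c.range subset_rfl).2
    (smoothSections.restr (img_le c.U _) g : smoothSections c.E c.q (img c.U (c.φ.pre c.range)))
  refine ⟨s, (chartEquiv b.ψ b.emb _ b.over_subset_range).injective
    (smoothSections.ext fun z => ?_)⟩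
  refine Eq.trans ?_ (hg z).symm
  obtain ⟨hw, h1⟩ := b.pull_proj c.range _ (fun _ hx => hx) s z
  refine Eq.trans (congrArg (fun g : smoothSections (c.E × ℝ) (c.q + 1) (img _ _) => g.1 z)
    (b.ψ.comp_pull Q.proj c.range (Q.over c.range) _ (fun _ hx => hx) (fun _ hx => hx)
      (fun _ hx => hx) s).symm) (h1.trans ?_)
  exact congrArg (fun g : smoothSections c.E c.q (img c.U (c.φ.pre c.range)) =>
    ExteriorAlgebra.map (Grass.inclGen c.q) (g.1 ⟨z.1.1, hw⟩)) hs

end Local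

end SuperMfd

/-! ### Maps that preserve the form come from the group -/

-- `gr` asks for the algebra structure over the semiring underlying the ring structure; without this
-- shortcut, comparing that semiring with the one of the subalgebra is slow.
noncomputable instance {E : Type} [NormedAddCommGroup E] [NormedSpace ℝ E] {q : ℕ} {W : Opens E} :
    @Algebra ℝ (smoothSections E q W) _ (Subalgebra.toRing (smoothSections E q W)).toSemiring :=
  Subalgebra.algebra _

namespace SuperMfd

open SuperSpace CategoryTheory

section Solve

variable {S N : SuperMfd} {Q : Prd S N} {j : N ⟶ R11} {V : Opens ℝ}

/-- Over the open set `D` of the base, the point `x` is the translate of `y` by the group element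
with coordinates `(r, η, a)`. -/
structure Translates (Q : Prd S N) (y x : R11Pt Q.tot.Fun) (D : Opens S.X.pt) (r η a : S.X.O D) :
    Prop where
  θ_eq : Q.tot.X.res le_top x.θ = Q.pullFst D η + Q.pullFst D a * Q.tot.X.res le_top y.θ
  t_eq : Q.tot.X.res le_top x.t = Q.pullFst D r + Q.tot.X.res le_top y.t +
    Q.pullFst D η * (Q.pullFst D a * Q.tot.X.res le_top y.θ)

theorem Translates.res {y x : R11Pt Q.tot.Fun} {D D' : Opens S.X.pt} {r η a : S.X.O D}
    (h : Translates Q y x D r η a) (hD : D' ≤ D) :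
    Translates Q y x D' (S.X.res hD r) (S.X.res hD η) (S.X.res hD a) := by
  have h1 := congrArg (Q.tot.X.res (Q.over_mono hD)) h.θ_eq
  have h2 := congrArg (Q.tot.X.res (Q.over_mono hD)) h.t_eq
  constructor
  · rw [map_add, map_mul, Q.res_pullFst, Q.res_pullFst, SuperSpace.res_comp,
      SuperSpace.res_comp] at h1
    exact h1
  · rw [map_add, map_add, map_mul, map_mul, Q.res_pullFst, Q.res_pullFst, Q.res_pullFst,
      SuperSpace.res_comp, SuperSpace.res_comp, SuperSpace.res_comp] at h2
    exact h2

/-- The coordinates of the group element are determined by the translate, since `1` and `θ` are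
linearly independent over the functions from the base. -/
theorem Translates.unique (hb : ∀ c, Nonempty (BoxChart Q j V c)) (hV : (V : Set ℝ).Nonempty)
    {x : R11Pt Q.tot.Fun} {D : Opens S.X.pt} {r η a r' η' a' : S.X.O D}
    (h : Translates Q (coords (Q.snd ≫ j)) x D r η a)
    (h' : Translates Q (coords (Q.snd ≫ j)) x D r' η' a') : r = r' ∧ η = η' ∧ a = a' := by
  have h1 := h.θ_eq.symm.trans h'.θ_eq
  obtain ⟨e1, e2⟩ := eq_zero_of_pullFst_add_mul_theta hb hV D (η - η') (a - a') (by
    rw [map_sub, map_sub, sub_mul, sub_add_sub_comm, h1, sub_self])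
  obtain rfl := sub_eq_zero.mp e1
  obtain rfl := sub_eq_zero.mp e2
  have h2 := h.t_eq.symm.trans h'.t_eq
  exact ⟨pullFst_injective hb hV D (add_right_cancel (add_right_cancel h2)), rfl, rfl⟩

/-- `const_of_preserves_form` for the derivations `∂/∂t` and `∂/∂θ` on a product domain. -/
theorem const_of_preserves_form_model {E : Type} [NormedAddCommGroup E] [NormedSpace ℝ E] {q : ℕ}
    {C : Opens (E × ℝ)} (T Θ T' Θ' : smoothSections (E × ℝ) (q + 1) C)
    (hT : ∀ z, T.1 z = algebraMap ℝ _ z.1.2) (hΘ : ∀ z, Θ.1 z = Grass.theta q)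
    (hΘ' : Θ' ∈ gr (A := smoothSections (E × ℝ) (q + 1) C) 1)
    (hT' : T' ∈ gr (A := smoothSections (E × ℝ) (q + 1) C) 0)
    (e1 : (partialT E (q + 1)).D C T' - Θ' * (partialT E (q + 1)).D C Θ' =
      (partialT E (q + 1)).D C T - Θ * (partialT E (q + 1)).D C Θ)
    (e2 : (partialTheta E q).D C T' + Θ' * (partialTheta E q).D C Θ' =
      (partialTheta E q).D C T + Θ * (partialTheta E q).D C Θ) :
    ∃ r η u : smoothSections (E × ℝ) (q + 1) C,
      ((partialT E (q + 1)).D C r = 0 ∧ (partialTheta E q).D C r = 0 ∧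
        r ∈ gr (A := smoothSections (E × ℝ) (q + 1) C) 0) ∧
      ((partialT E (q + 1)).D C η = 0 ∧ (partialTheta E q).D C η = 0 ∧
        η ∈ gr (A := smoothSections (E × ℝ) (q + 1) C) 1) ∧
      ((partialT E (q + 1)).D C u = 0 ∧ (partialTheta E q).D C u = 0 ∧
        u ∈ gr (A := smoothSections (E × ℝ) (q + 1) C) 0) ∧
      u * u = 1 ∧ Θ' = η + u * Θ ∧ T' = r + T + η * (u * Θ) := by
  let dt := (partialT E (q + 1)).D C
  let dθ := (partialTheta E q).D C
  have htt : dt T = 1 := by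
    obtain rfl : T = smoothSections.scalar (fun z => z.2) fun z _ => contDiffAt_snd :=
      smoothSections.ext hT
    refine smoothSections.ext fun z => ?_
    refine (smoothSections.pd_scalar (0, 1) (fun z : E × ℝ => z.2) (fun z _ => contDiffAt_snd)
      z).trans ?_
    rw [fderiv_snd]
    exact map_one (algebraMap ℝ (Grass (q + 1)))
  have hθt : dt Θ = 0 := smoothSections.partialT_eq_zero _
    (smoothSections.const E (q + 1) ⊤ (Grass.theta q)) fun z => ⟨trivial, hΘ z⟩
  have htθ : dθ T = 0 := smoothSections.ext fun z =>
    (congrArg (Grass.dtheta q) (hT z)).trans (Grass.oddDeriv_algebraMap _ _)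
  have hθθ : dθ Θ = 1 := smoothSections.ext fun z =>
    (congrArg (Grass.dtheta q) (hΘ z)).trans Grass.dtheta_theta
  have hΘgr : Θ ∈ gr (A := smoothSections (E × ℝ) (q + 1) C) 1 :=
    smoothSections.mem_gr_iff.mpr fun z => by
      rw [hΘ]
      exact CliffordAlgebra.ι_mem_evenOdd_one _ _
  have hTgr : T ∈ gr (A := smoothSections (E × ℝ) (q + 1) C) 0 :=
    smoothSections.mem_gr_iff.mpr fun z => by
      rw [hT, Algebra.algebraMap_eq_smul_one]
      exact Submodule.smul_mem _ _ (Grass.superAlgebra _).one_mem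
  have hdθ : ∀ (i : ZMod 2) (f g : smoothSections (E × ℝ) (q + 1) C),
      f ∈ gr (A := smoothSections (E × ℝ) (q + 1) C) i →
      dθ (f * g) = dθ f * g + (-1 : ℝ) ^ i.val • (f * dθ g) := by
    intro i f g hf
    have := (partialTheta E q).leibniz C i f g hf
    rwa [ZMod.val_one, one_mul] at this
  refine const_of_preserves_form dt dθ (smoothSections.pd_mul (0, 1)) (fun f g hf => ?_)
    (fun f g hf => ?_) (fun f hf => (partialTheta E q).D_gr C 1 f hf)
    (fun f => (smoothSections.pd_mapLin (0, 1) (Grass.dtheta q) f).symm)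
    (fun f => smoothSections.ext fun z => Grass.oddDeriv_oddDeriv _ _)
    htt hθt htθ hθθ hΘgr hΘ' hTgr hT' ?_ ?_
  · have := hdθ 0 f g hf
    rwa [ZMod.val_zero, pow_zero, one_smul] at this
  · have := hdθ 1 f g hf
    rwa [ZMod.val_one, pow_one, neg_smul, one_smul, ← sub_eq_add_neg] at this
  · refine e1.trans ?_
    change dt T - Θ * dt Θ = 1
    rw [htt, hθt, mul_zero, sub_zero]
  · refine e2.trans ?_
    change dθ T + Θ * dθ Θ = Θ
    rw [htθ, hθθ, mul_one, zero_add]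

/-- Functions over a chart of the base, as smooth functions on the product domain. -/
noncomputable def BoxChart.sections {c : Patch S} (b : BoxChart Q j V c) :
    Q.tot.X.O (Q.over c.range) ≃ₐ[ℝ] smoothSections (c.E × ℝ) (c.q + 1)
      (img (smoothSections.prodOpens c.U V) (b.ψ.pre (Q.over c.range))) :=
  chartEquiv b.ψ b.emb _ b.over_subset_range

/-- The equality of the forms, contracted with `∂/∂t`. -/
theorem BoxChart.partialT_pullω {c : Patch S} (b : BoxChart Q j V c) (x y : Q.tot ⟶ R11)
    (hx : pullω Q.fst x = pullω Q.fst y) :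
    (partialT c.E (c.q + 1)).D _ (b.sections (Q.tot.X.res le_top (coords x).t)) -
        b.sections (Q.tot.X.res le_top (coords x).θ) *
          (partialT c.E (c.q + 1)).D _ (b.sections (Q.tot.X.res le_top (coords x).θ)) =
      (partialT c.E (c.q + 1)).D _ (b.sections (Q.tot.X.res le_top (coords y).t)) -
        b.sections (Q.tot.X.res le_top (coords y).θ) *
          (partialT c.E (c.q + 1)).D _ (b.sections (Q.tot.X.res le_top (coords y).θ)) := by
  have key : ∀ x : Q.tot ⟶ R11,
      b.sections (pullω Q.fst x (Q.over c.range) 0 ((partialT c.E (c.q + 1)).toVField Q.fst b.ψ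
        b.emb _ b.over_subset_range b.partialT_pull_proj)) =
      (partialT c.E (c.q + 1)).D _ (b.sections (Q.tot.X.res le_top (coords x).t)) -
        b.sections (Q.tot.X.res le_top (coords x).θ) *
          (partialT c.E (c.q + 1)).D _ (b.sections (Q.tot.X.res le_top (coords x).θ)) := by
    intro x
    refine (chartEquiv_pullω (partialT c.E (c.q + 1)) Q.fst b.ψ b.emb _ b.over_subset_range
      b.partialT_pull_proj x).trans ?_
    refine congrArg₂ _ rfl ?_
    rw [ZMod.val_zero, zero_mul, pow_zero]
    exact one_smul ℝ _
  rw [← key, ← key, hx]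

/-- The equality of the forms, contracted with `∂/∂θ`; the sign comes from moving this odd vector
field past `θ'`. -/
theorem BoxChart.partialTheta_pullω {c : Patch S} (b : BoxChart Q j V c) (x y : Q.tot ⟶ R11)
    (hx : pullω Q.fst x = pullω Q.fst y) :
    (partialTheta c.E c.q).D _ (b.sections (Q.tot.X.res le_top (coords x).t)) +
        b.sections (Q.tot.X.res le_top (coords x).θ) *
          (partialTheta c.E c.q).D _ (b.sections (Q.tot.X.res le_top (coords x).θ)) =
      (partialTheta c.E c.q).D _ (b.sections (Q.tot.X.res le_top (coords y).t)) +
        b.sections (Q.tot.X.res le_top (coords y).θ) *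
          (partialTheta c.E c.q).D _ (b.sections (Q.tot.X.res le_top (coords y).θ)) := by
  have key : ∀ x : Q.tot ⟶ R11,
      b.sections (pullω Q.fst x (Q.over c.range) 1 ((partialTheta c.E c.q).toVField Q.fst b.ψ
        b.emb _ b.over_subset_range b.partialTheta_pull_proj)) =
      (partialTheta c.E c.q).D _ (b.sections (Q.tot.X.res le_top (coords x).t)) +
        b.sections (Q.tot.X.res le_top (coords x).θ) *
          (partialTheta c.E c.q).D _ (b.sections (Q.tot.X.res le_top (coords x).θ)) := by
    intro x
    refine (chartEquiv_pullω (partialTheta c.E c.q) Q.fst b.ψ b.emb _ b.over_subset_range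
      b.partialTheta_pull_proj x).trans ?_
    refine (sub_eq_add_neg _ _).trans (congrArg₂ _ rfl ?_)
    rw [ZMod.val_one, one_mul, pow_one]
    exact (congrArg Neg.neg (neg_one_smul ℝ _)).trans (neg_neg _)
  rw [← key, ← key, hx]

theorem BoxChart.sections_gr {c : Patch S} (b : BoxChart Q j V c) (i : ZMod 2)
    (f : Q.tot.X.O (Q.over c.range)) : f ∈ gr (A := Q.tot.X.O (Q.over c.range)) i ↔
      b.sections f ∈ gr (A := smoothSections (c.E × ℝ) (c.q + 1) _) i :=
  chartEquiv_gr b.ψ b.emb _ b.over_subset_range i f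

theorem BoxChart.sections_t {c : Patch S} (b : BoxChart Q j V c) (z) :
    (b.sections (Q.tot.X.res le_top (coords (Q.snd ≫ j)).t)).1 z = algebraMap ℝ _ z.1.2 :=
  (congrArg (fun g : smoothSections (c.E × ℝ) (c.q + 1) (img _ _) => g.1 z)
    (b.ψ.pull_res' (V := Q.over c.range) le_top (fun _ hx => hx) _)).trans (b.pull_t _ z)

theorem BoxChart.sections_θ {c : Patch S} (b : BoxChart Q j V c) (z) :
    (b.sections (Q.tot.X.res le_top (coords (Q.snd ≫ j)).θ)).1 z = Grass.theta c.q :=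
  (congrArg (fun g : smoothSections (c.E × ℝ) (c.q + 1) (img _ _) => g.1 z)
    (b.ψ.pull_res' (V := Q.over c.range) le_top (fun _ hx => hx) _)).trans (b.pull_θ _ z)

/-- A homogeneous function which is constant along the fibres is the pullback of a function of the
same parity on the base. -/
theorem BoxChart.exists_sections_pullFst_eq (hb : ∀ c, Nonempty (BoxChart Q j V c))
    {c : Patch S} (b : BoxChart Q j V c) (hV : _root_.IsConnected (V : Set ℝ)) (i : ZMod 2)
    (F : smoothSections (c.E × ℝ) (c.q + 1)
      (img (smoothSections.prodOpens c.U V) (b.ψ.pre (Q.over c.range))))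
    (h1 : (partialT c.E (c.q + 1)).D _ F = 0) (h2 : (partialTheta c.E c.q).D _ F = 0)
    (hF : F ∈ gr (A := smoothSections (c.E × ℝ) (c.q + 1) _) i) :
    ∃ s : S.X.O c.range, b.sections (Q.pullFst c.range s) = F ∧ s ∈ gr (A := S.X.O c.range) i := by
  obtain ⟨s, hs⟩ := b.exists_pullFst_eq hV (b.sections.symm F)
    ((congrArg _ (b.sections.apply_symm_apply F)).trans h1)
    ((congrArg _ (b.sections.apply_symm_apply F)).trans h2)
  have hs' : b.sections (Q.pullFst c.range s) = F := by rw [hs, AlgEquiv.apply_symm_apply]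
  refine ⟨s, hs', gr_of_map_gr (Q.pullFst c.range) (pullFst_injective hb hV.nonempty c.range)
    (Q.pullFst_gr c.range) i s ((b.sections_gr i _).mpr ?_)⟩
  rw [hs']
  exact hF

/-- A map that preserves the form is locally over the base a translate. -/
theorem BoxChart.exists_translates (hb : ∀ c, Nonempty (BoxChart Q j V c))
    (hV : _root_.IsConnected (V : Set ℝ)) (x : Q.tot ⟶ R11)
    (hx : pullω Q.fst x = pullω Q.fst (Q.snd ≫ j)) (c : Patch S) :
    ∃ r η a : S.X.O c.range, Translates Q (coords (Q.snd ≫ j)) (coords x) c.range r η a ∧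
      r ∈ gr (A := S.X.O c.range) 0 ∧ η ∈ gr (A := S.X.O c.range) 1 ∧
      a ∈ gr (A := S.X.O c.range) 0 ∧ a * a = 1 := by
  obtain ⟨b⟩ := hb c
  have hT := b.sections_t
  have hΘ := b.sections_θ
  have hΘ'gr := (b.sections_gr 1 _).mp (Q.tot.X.res_gr le_top 1 _ (coords x).odd)
  have hT'gr := (b.sections_gr 0 _).mp (Q.tot.X.res_gr le_top 0 _ (coords x).even)
  have e1 := b.partialT_pullω _ _ hx
  have e2 := b.partialTheta_pullω _ _ hx
  have hd := fun i => BoxChart.exists_sections_pullFst_eq hb b hV i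
  have hinj : ∀ f g : Q.tot.X.O (Q.over c.range), b.sections f = b.sections g → f = g :=
    fun f g h => b.sections.injective h
  have hmul : ∀ f g, b.sections (f * g) = b.sections f * b.sections g := fun f g => map_mul _ f g
  have hadd : ∀ f g, b.sections (f + g) = b.sections f + b.sections g := fun f g => map_add _ f g
  have hone : b.sections 1 = 1 := map_one _
  obtain ⟨R, H, A, ⟨hr1, hr2, hr3⟩, ⟨hη1, hη2, hη3⟩, ⟨ha1, ha2, ha3⟩, hA, hθ', ht'⟩ :=
    const_of_preserves_form_model _ _ _ _ hT hΘ hΘ'gr hT'gr e1 e2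
  obtain ⟨a, ha, ha_gr⟩ := hd 0 _ ha1 ha2 ha3
  obtain ⟨η, hη, hη_gr⟩ := hd 1 _ hη1 hη2 hη3
  obtain ⟨r, hr, hr_gr⟩ := hd 0 _ hr1 hr2 hr3
  refine ⟨r, η, a, ⟨hinj _ _ ?_, hinj _ _ ?_⟩, hr_gr, hη_gr, ha_gr,
    pullFst_injective hb hV.nonempty c.range (hinj _ _ ?_)⟩
  · rw [hadd, hmul, ha, hη]
    exact hθ'
  · rw [hadd, hadd, hmul, hmul, ha, hη, hr]
    exact ht'
  · rw [map_mul (Q.pullFst c.range) a a, hmul, ha, hA, map_one (Q.pullFst c.range), hone]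

/-- A map that preserves the form is a translate: the local group elements glue because they are
unique. -/
theorem exists_translates (hb : ∀ c, Nonempty (BoxChart Q j V c))
    (hV : _root_.IsConnected (V : Set ℝ)) (x : Q.tot ⟶ R11)
    (hx : pullω Q.fst x = pullω Q.fst (Q.snd ≫ j)) :
    ∃ r η a : S.Fun, Translates Q (coords (Q.snd ≫ j)) (coords x) ⊤ r η a ∧
      r ∈ gr (A := S.Fun) 0 ∧ η ∈ gr (A := S.Fun) 1 ∧ a ∈ gr (A := S.Fun) 0 ∧ a * a = 1 := by
  choose r η a hs hr hη ha hsq using BoxChart.exists_translates hb hV x hx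
  let C : S.X.pt → Opens S.X.pt := fun p => (patchAt p).range
  have hC : ∀ p ∈ (⊤ : Opens S.X.pt), ∃ i, p ∈ C i := fun p _ => ⟨p, ⟨patchPt p, base_patchPt p⟩⟩
  have hu : ∀ (i k : S.X.pt) (W : Opens S.X.pt) (hi : W ≤ C i) (hk : W ≤ C k),
      S.X.res hi (r (patchAt i)) = S.X.res hk (r (patchAt k)) ∧
      S.X.res hi (η (patchAt i)) = S.X.res hk (η (patchAt k)) ∧
      S.X.res hi (a (patchAt i)) = S.X.res hk (a (patchAt k)) := fun i k W hi hk =>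
    Translates.unique hb hV.nonempty ((hs _).res hi) ((hs _).res hk)
  obtain ⟨R, hR, -⟩ := S.X.glue ⊤ C (fun _ => le_top) hC (fun i => r (patchAt i))
    fun i k W hi hk => (hu i k W hi hk).1
  obtain ⟨H, hH, -⟩ := S.X.glue ⊤ C (fun _ => le_top) hC (fun i => η (patchAt i))
    fun i k W hi hk => (hu i k W hi hk).2.1
  obtain ⟨A, hA, -⟩ := S.X.glue ⊤ C (fun _ => le_top) hC (fun i => a (patchAt i))
    fun i k W hi hk => (hu i k W hi hk).2.2
  have hgr : ∀ (i : ZMod 2) (f : S.Fun), (∀ p, S.X.res (le_top : C p ≤ ⊤) f ∈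
      gr (A := S.X.O (C p)) i) → f ∈ gr (A := S.Fun) i := fun i f h =>
    gr_of_locally_gr i f fun p hp => by
      obtain ⟨k, hk⟩ := hC p hp
      exact ⟨C k, le_top, hk, h k⟩
  have hcov : ∀ f g : Q.tot.X.O (Q.over ⊤), (∀ p, Q.tot.X.res (Q.over_mono (le_top : C p ≤ ⊤)) f =
      Q.tot.X.res (Q.over_mono (le_top : C p ≤ ⊤)) g) → f = g := fun f g h =>
    eq_of_locally_eq f g fun z _ => by
      obtain ⟨k, hk⟩ := hC (Q.proj.base z) trivial
      exact ⟨Q.over (C k), Q.over_mono le_top, hk, h k⟩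
  refine ⟨R, H, A, ⟨hcov _ _ fun p => ?_, hcov _ _ fun p => ?_⟩, hgr 0 R fun p => ?_,
    hgr 1 H fun p => ?_, hgr 0 A fun p => ?_, ?_⟩
  · rw [map_add, map_mul, Q.res_pullFst (le_top : C p ≤ ⊤),
      Q.res_pullFst (le_top : C p ≤ ⊤), SuperSpace.res_comp, SuperSpace.res_comp, hH p, hA p]
    exact (hs _).θ_eq
  · rw [map_add, map_add, map_mul, map_mul, Q.res_pullFst (le_top : C p ≤ ⊤),
      Q.res_pullFst (le_top : C p ≤ ⊤), Q.res_pullFst (le_top : C p ≤ ⊤),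
      SuperSpace.res_comp, SuperSpace.res_comp, SuperSpace.res_comp, hH p, hA p, hR p]
    exact (hs _).t_eq
  · rw [hR]
    exact hr _
  · rw [hH]
    exact hη _
  · rw [hA]
    exact ha _
  · refine eq_of_locally_eq _ _ fun p hp => ?_
    obtain ⟨k, hk⟩ := hC p hp
    refine ⟨C k, le_top, hk, ?_⟩
    rw [map_mul, hA, map_one]
    exact hsq _

end Solve

end SuperMfd

/-! ### Translates preserve the form -/

section Points

variable {A B : Type} [Ring A] [Algebra ℝ A] [SuperAlgebra A] [Ring B] [Algebra ℝ B]
  [SuperAlgebra B]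

theorem IsomPt.smul_t (g : IsomPt A) (y : R11Pt A) :
    (g • y).t = g.left.t + y.t + g.left.θ * (g.right.val * y.θ) := rfl

theorem IsomPt.smul_θ (g : IsomPt A) (y : R11Pt A) :
    (g • y).θ = g.left.θ + g.right.val * y.θ := rfl

variable (f : A →ₐ[ℝ] B) (hf : ∀ i, ∀ a ∈ gr (A := A) i, f a ∈ gr (A := B) i)

theorem R11Pt.map_smul (g : IsomPt A) (y : R11Pt A) :
    R11Pt.map f hf (g • y) = IsomPt.map f hf g • R11Pt.map f hf y := by
  refine R11Pt.ext ?_ ?_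
  · change f (g.left.t + y.t + g.left.θ * (g.right.val * y.θ)) =
      f g.left.t + f y.t + f g.left.θ * (f g.right.val * f y.θ)
    simp only [map_add, map_mul]
  · change f (g.left.θ + g.right.val * y.θ) = f g.left.θ + f g.right.val * f y.θ
    simp only [map_add, map_mul]

theorem IsomPt.map_mul (g h : IsomPt A) :
    IsomPt.map f hf (g * h) = IsomPt.map f hf g * IsomPt.map f hf h :=
  SemidirectProduct.ext (R11Pt.map_smul f hf g h.left) (SignPt.ext (_root_.map_mul f _ _))

theorem IsomPt.map_one : IsomPt.map f hf 1 = 1 := by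
  have h := IsomPt.map_mul f hf 1 1
  rw [mul_one] at h
  exact mul_eq_left.mp h.symm

end Points

namespace SuperMfd

open SuperSpace CategoryTheory

variable {S N P : SuperMfd}

/-- A vertical vector field kills the functions from the base. -/
theorem VField.pullback_eq_zero {π : P ⟶ S} {W : Opens P.X.pt} {i : ZMod 2} (X : VField π W i)
    (f : S.Fun) : X.D W le_rfl (P.X.res le_top (pullback π f)) = 0 := by
  have h : P.X.res le_top (pullback π f) = Hom.pull π ⊤ W (fun _ _ => trivial) f :=
    Hom.res_pull (X := P.X) π (V := ⊤) (le_top : W ≤ ⊤) (fun _ _ => trivial) f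
  rw [h]
  exact X.vert W le_rfl ⊤ (fun _ _ => trivial) f

theorem VField.mul_of_eq_zero {π : P ⟶ S} {W : Opens P.X.pt} {i : ZMod 2} (X : VField π W i)
    (k : ZMod 2) {f : P.X.O W} (hf : f ∈ gr (A := P.X.O W) k) (hX : X.D W le_rfl f = 0)
    (g : P.X.O W) : X.D W le_rfl (f * g) = (-1 : ℝ) ^ (i.val * k.val) • (f * X.D W le_rfl g) := by
  rw [X.leibniz W le_rfl k f g hf, hX, zero_mul, zero_add]

/-- The translate of a map by a group element over the base has the same pullback of `ω`. With
`Xr = Xη = Xa = 0` and `a² = 1`, the terms `X(ηaθ)` and `η X(aθ)` cancel. -/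
theorem pullω_eq_of_coords_eq_smul (π : P ⟶ S) (x y : P ⟶ R11) (g : S ⟶ IsomR11)
    (h : coords x = baseIsom π g • coords y) : pullω π x = pullω π y := by
  funext W i X
  have ht : P.X.res (le_top : W ≤ ⊤) (coords x).t =
      P.X.res le_top (pullback π (isomCoords g).left.t) + P.X.res le_top (coords y).t +
      P.X.res le_top (pullback π (isomCoords g).left.θ) *
        (P.X.res le_top (pullback π (isomCoords g).right.val) * P.X.res le_top (coords y).θ) := by
    rw [h, IsomPt.smul_t, map_add, map_add, map_mul, map_mul]
    rfl
  have hθ : P.X.res (le_top : W ≤ ⊤) (coords x).θ =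
      P.X.res le_top (pullback π (isomCoords g).left.θ) +
        P.X.res le_top (pullback π (isomCoords g).right.val) * P.X.res le_top (coords y).θ := by
    rw [h, IsomPt.smul_θ, map_add, map_mul]
    rfl
  have hη := P.X.res_gr (le_top : W ≤ ⊤) 1 _ (pullback_gr π 1 _ (isomCoords g).left.odd)
  have ha := P.X.res_gr (le_top : W ≤ ⊤) 0 _ (pullback_gr π 0 _ (isomCoords g).right.even)
  have hsq : P.X.res (le_top : W ≤ ⊤) (pullback π (isomCoords g).right.val) *
      P.X.res le_top (pullback π (isomCoords g).right.val) = 1 := by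
    rw [← map_mul, ← map_mul, (isomCoords g).right.sq, map_one, map_one]
  have hr0 := X.pullback_eq_zero (isomCoords g).left.t
  have hη0 := X.pullback_eq_zero (isomCoords g).left.θ
  have ha0 := X.pullback_eq_zero (isomCoords g).right.val
  change X.D W le_rfl (P.X.res le_top (coords x).t) - (-1 : ℝ) ^ (i.val * (1 : ZMod 2).val) •
      (P.X.res le_top (coords x).θ * X.D W le_rfl (P.X.res le_top (coords x).θ)) =
    X.D W le_rfl (P.X.res le_top (coords y).t) - (-1 : ℝ) ^ (i.val * (1 : ZMod 2).val) •
      (P.X.res le_top (coords y).θ * X.D W le_rfl (P.X.res le_top (coords y).θ))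
  rw [ht, hθ]
  generalize P.X.res (le_top : W ≤ ⊤) (pullback π (isomCoords g).left.t) = r at *
  generalize P.X.res (le_top : W ≤ ⊤) (pullback π (isomCoords g).left.θ) = η at *
  generalize P.X.res (le_top : W ≤ ⊤) (pullback π (isomCoords g).right.val) = a at *
  generalize P.X.res (le_top : W ≤ ⊤) (coords y).t = t
  generalize P.X.res (le_top : W ≤ ⊤) (coords y).θ = θ
  have e1 : X.D W le_rfl (a * θ) = a * X.D W le_rfl θ := by
    rw [X.mul_of_eq_zero 0 ha ha0, ZMod.val_zero, mul_zero, pow_zero, one_smul]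
  have e2 : a * θ * (a * X.D W le_rfl θ) = θ * X.D W le_rfl θ := by
    rw [SuperAlgebra.even_comm ha θ, mul_assoc, ← mul_assoc a a, hsq, one_mul]
  rw [map_add, map_add, map_add, hr0, hη0, zero_add, zero_add, X.mul_of_eq_zero 1 hη hη0, e1,
    add_mul, e2, smul_add]
  abel

section Fibre

variable {Q : Prd S N} {j : N ⟶ R11}

/-- Over the whole base, being a translate in coordinates means being moved by the action. -/
theorem translates_top_iff (x y : R11Pt Q.tot.Fun) (g : S ⟶ IsomR11) :
    Translates Q y x ⊤ (isomCoords g).left.t (isomCoords g).left.θ (isomCoords g).right.val ↔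
      x = baseIsom Q.fst g • y := by
  have hres : ∀ f : Q.tot.Fun, Q.tot.X.res (le_top : Q.over ⊤ ≤ ⊤) f = f := Q.tot.X.res_id
  constructor
  · intro h
    have h1 := h.t_eq
    have h2 := h.θ_eq
    rw [hres, hres, hres] at h1
    rw [hres, hres] at h2
    exact R11Pt.ext h1 h2
  · rintro rfl
    constructor
    · rw [hres, hres]
      rfl
    · rw [hres, hres, hres]
      rfl

/-- A map that preserves the form is given by the action of a group element. -/
theorem exists_coords_eq_smul (hj : IsOpenEmb j) {V : Opens ℝ}
    (hV : _root_.IsConnected (V : Set ℝ))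
    (hVj : ∀ t : ℝ, t ∈ V ↔ t ∈ Set.range (Hom.base j)) (x : Q.tot ⟶ R11)
    (hx : pullω Q.fst x = pullω Q.fst (Q.snd ≫ j)) :
    ∃ g : S ⟶ IsomR11, coords x = baseIsom Q.fst g • coords (Q.snd ≫ j) := by
  obtain ⟨r, η, a, h, hr, hη, ha, hsq⟩ :=
    exists_translates (nonempty_boxChart Q j hj V hVj) hV x hx
  obtain ⟨g, hg⟩ := isomCoords_surjective (T := S) ⟨⟨r, η, hr, hη⟩, ⟨a, ha, hsq⟩⟩
  refine ⟨g, (translates_top_iff _ _ g).mp ?_⟩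
  rw [hg]
  exact h

/-- A group element over the base is determined by its action on the fibres. -/
theorem eq_of_smul_coords_eq (hj : IsOpenEmb j) {V : Opens ℝ} (hV : (V : Set ℝ).Nonempty)
    (hVj : ∀ t : ℝ, t ∈ V ↔ t ∈ Set.range (Hom.base j)) (g g' : S ⟶ IsomR11)
    (h : baseIsom Q.fst g • coords (Q.snd ≫ j) = baseIsom Q.fst g' • coords (Q.snd ≫ j)) :
    g = g' := by
  obtain ⟨e1, e2, e3⟩ := Translates.unique (nonempty_boxChart Q j hj V hVj) hV
    ((translates_top_iff _ _ g).mpr rfl) ((translates_top_iff _ _ g').mpr h)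
  exact isomCoords_injective (SemidirectProduct.ext (R11Pt.ext e1 e2) (SignPt.ext e3))

end Fibre

end SuperMfd

/-! ### The families defined by group elements -/

namespace SuperMfd

open SuperSpace CategoryTheory

section OpenEmb

variable {S N N' M : SuperMfd}

theorem IsOpenEmb.comp {F : M ⟶ N} {G : N ⟶ N'} (hF : IsOpenEmb F) (hG : IsOpenEmb G) :
    IsOpenEmb (F ≫ G) := Hom.IsOpenEmb.comp hF hG

theorem isOpenEmb_iso (e : M ≅ N) : IsOpenEmb e.hom :=
  Hom.IsOpenEmb.of_inverse e.hom_inv_id e.inv_hom_id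

theorem IsOpenEmb.cancel {F : M ⟶ N} (hF : IsOpenEmb F) {G G' : S ⟶ M} (h : G ≫ F = G' ≫ F) :
    G = G' := Hom.IsOpenEmb.cancel hF h

theorem IsOpenEmb.exists_factor {F : M ⟶ N} (hF : IsOpenEmb F) (G : S ⟶ N)
    (h : ∀ z, Hom.base G z ∈ Set.range (Hom.base F)) : ∃ G' : S ⟶ M, G' ≫ F = G :=
  ⟨Hom.IsOpenEmb.lift hF G h, Hom.IsOpenEmb.lift_comp hF G h⟩

/-- The product of the identity of `S` with an open embedding is an open embedding: its inverse is
defined on the preimage of the range. -/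
theorem isOpenEmb_prod {j : N ⟶ N'} (hj : IsOpenEmb j) (Q : Prd S N) (P : Prd S N')
    (k : Q.tot ⟶ P.tot) (h1 : k ≫ P.fst = Q.fst) (h2 : k ≫ P.snd = Q.snd ≫ j) : IsOpenEmb k := by
  let D : Opens P.tot.X.pt := Hom.pre P.snd ⟨Set.range (Hom.base j), hj.1.isOpen_range⟩
  let i := inclM P.tot D
  have hi : IsOpenEmb i := P.tot.X.incl_isOpenEmb D
  obtain ⟨f, hf⟩ := hj.exists_factor (i ≫ P.snd) fun z => z.2
  obtain ⟨h, hh1, hh2⟩ := Q.exists_lift (i ≫ P.fst) f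
  obtain ⟨k', hk'⟩ := hi.exists_factor k fun z => by
    refine ⟨⟨Hom.base k z, Hom.base Q.snd z, ?_⟩, rfl⟩
    exact (Hom.congr_base h2 z).symm
  have e1 : k' ≫ h = 𝟙 _ := by
    refine Q.hom_ext ?_ (hj.cancel ?_)
    · rw [Category.assoc, hh1, ← Category.assoc, hk', h1, Category.id_comp]
    · rw [Category.assoc k' h Q.snd, hh2, Category.assoc, hf, ← Category.assoc, hk', h2, Category.id_comp]
  have e2 : h ≫ k' = 𝟙 _ := by
    refine hi.cancel ?_
    rw [Category.assoc, hk', Category.id_comp]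
    refine P.hom_ext ?_ ?_
    · rw [Category.assoc, h1, hh1]
    · rw [Category.assoc, h2, ← Category.assoc, hh2, hf]
  rw [← hk']
  exact (isOpenEmb_iso ⟨k', h, e1, e2⟩).comp hi

end OpenEmb

section Translate

variable {S S' T T' : SuperMfd}

theorem baseIsom_comp (F : T' ⟶ T) (π : T ⟶ S) (g : S ⟶ IsomR11) :
    baseIsom (F ≫ π) g = IsomPt.map (pullback F) (pullback_gr F) (baseIsom π g) := by
  refine SemidirectProduct.ext (R11Pt.ext ?_ ?_) (SignPt.ext ?_) <;> exact pullback_comp F π _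

theorem baseIsom_base_change (π : T ⟶ S) (f : S ⟶ S') (g : S' ⟶ IsomR11) :
    baseIsom π (f ≫ g) = baseIsom (π ≫ f) g := by
  rw [baseIsom_comp, baseIsom, isomCoords_comp]
  rfl

theorem exists_translate (P : Prd S R11) (π : T ⟶ S) (y : T ⟶ R11) (g : S ⟶ IsomR11) :
    ∃ Φ : T ⟶ P.tot, Φ ≫ P.fst = π ∧ coords (Φ ≫ P.snd) = baseIsom π g • coords y := by
  obtain ⟨x, hx⟩ := coords_surjective (baseIsom π g • coords y)
  obtain ⟨Φ, h1, h2⟩ := P.exists_lift π x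
  exact ⟨Φ, h1, by rw [h2, hx]⟩

/-- The map `(π, g(π) · y)` to `S × ℝ^{1|1}`. -/
noncomputable def translate (P : Prd S R11) (π : T ⟶ S) (y : T ⟶ R11) (g : S ⟶ IsomR11) :
    T ⟶ P.tot := (exists_translate P π y g).choose

theorem translate_fst (P : Prd S R11) (π : T ⟶ S) (y : T ⟶ R11) (g : S ⟶ IsomR11) :
    translate P π y g ≫ P.fst = π := (exists_translate P π y g).choose_spec.1

theorem coords_translate_snd (P : Prd S R11) (π : T ⟶ S) (y : T ⟶ R11) (g : S ⟶ IsomR11) :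
    coords (translate P π y g ≫ P.snd) = baseIsom π g • coords y :=
  (exists_translate P π y g).choose_spec.2

theorem eq_translate (P : Prd S R11) {π : T ⟶ S} {y : T ⟶ R11} {g : S ⟶ IsomR11} {Φ : T ⟶ P.tot}
    (h1 : Φ ≫ P.fst = π) (h2 : coords (Φ ≫ P.snd) = baseIsom π g • coords y) :
    Φ = translate P π y g :=
  P.hom_ext (h1.trans (translate_fst P π y g).symm)
    (coords_injective (h2.trans (coords_translate_snd P π y g).symm))

/-- Translates are compatible with maps of their source. -/
theorem comp_translate (P : Prd S R11) (F : T' ⟶ T) (π : T ⟶ S) (y : T ⟶ R11)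
    (g : S ⟶ IsomR11) : F ≫ translate P π y g = translate P (F ≫ π) (F ≫ y) g := by
  refine eq_translate P ?_ ?_
  · rw [Category.assoc, translate_fst]
  · rw [Category.assoc, coords_comp, coords_translate_snd, R11Pt.map_smul, ← baseIsom_comp,
      ← coords_comp]

/-- Translates are compatible with change of the base. -/
theorem translate_base_change (P : Prd S R11) (P' : Prd S' R11) (f : S' ⟶ S)
    (F : P'.tot ⟶ P.tot) (h1 : F ≫ P.fst = P'.fst ≫ f) (h2 : F ≫ P.snd = P'.snd)
    (π : T ⟶ S') (y : T ⟶ R11) (g : S ⟶ IsomR11) :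
    translate P' π y (f ≫ g) ≫ F = translate P (π ≫ f) y g := by
  refine eq_translate P ?_ ?_
  · rw [Category.assoc, h1, ← Category.assoc, translate_fst]
  · rw [Category.assoc, h2, coords_translate_snd, baseIsom_base_change]

theorem translate_translate (P : Prd S R11) (π : T ⟶ S) (y : T ⟶ R11) {g g' g'' : S ⟶ IsomR11}
    (h : isomCoords g'' = isomCoords g' * isomCoords g) :
    translate P π y g ≫ translate P P.fst P.snd g' = translate P π y g'' := by
  refine eq_translate P ?_ ?_
  · rw [Category.assoc, translate_fst, translate_fst]
  · rw [comp_translate, coords_translate_snd, coords_translate_snd, translate_fst, ← mul_smul,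
      baseIsom, baseIsom, ← IsomPt.map_mul, ← h]
    rfl

theorem translate_one (P : Prd S R11) {g : S ⟶ IsomR11} (h : isomCoords g = 1) :
    translate P P.fst P.snd g = 𝟙 _ := by
  refine (eq_translate P (Category.id_comp _) ?_).symm
  rw [Category.id_comp, baseIsom, h, IsomPt.map_one, one_smul]

theorem exists_inverse (g : S ⟶ IsomR11) :
    ∃ g' : S ⟶ IsomR11, isomCoords g' = (isomCoords g)⁻¹ := isomCoords_surjective _

/-- The action of a group element on `S × ℝ^{1|1}`, as a diffeomorphism. -/
noncomputable def translateIso (P : Prd S R11) (g : S ⟶ IsomR11) : P.tot ≅ P.tot where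
  hom := translate P P.fst P.snd g
  inv := translate P P.fst P.snd (exists_inverse g).choose
  hom_inv_id := by
    obtain ⟨g₀, h₀⟩ := isomCoords_surjective (T := S) 1
    rw [translate_translate P P.fst P.snd (g'' := g₀), translate_one P h₀]
    rw [h₀, (exists_inverse g).choose_spec, inv_mul_cancel]
  inv_hom_id := by
    obtain ⟨g₀, h₀⟩ := isomCoords_surjective (T := S) 1
    rw [translate_translate P P.fst P.snd (g'' := g₀), translate_one P h₀]
    rw [h₀, (exists_inverse g).choose_spec, mul_inv_cancel]

/-- The family of diffeomorphisms defined by a group element. -/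
noncomputable def diffFam (P : Prd S R11) (g : S ⟶ IsomR11) : DiffFam P where
  Φ := translateIso P g
  fibred := translate_fst P _ _ g
  pres := pullω_eq_of_coords_eq_smul _ _ _ g (coords_translate_snd P _ _ g)

theorem domIncl_isOpenEmb (U : Opens ℝ) : IsOpenEmb (domIncl U) :=
  SuperSpace.incl_isOpenEmb R11space U

/-- The family of embeddings of a domain defined by a group element. -/
noncomputable def embFam {U : Opens ℝ} (Q : Prd S (dom U)) (P : Prd S R11) (g : S ⟶ IsomR11) :
    EmbFam Q P where
  Φ := translate P Q.fst (Q.snd ≫ domIncl U) g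
  fibred := translate_fst P _ _ g
  emb := by
    obtain ⟨k, h1, h2⟩ := P.exists_lift Q.fst (Q.snd ≫ domIncl U)
    have h : k ≫ translate P P.fst P.snd g = translate P Q.fst (Q.snd ≫ domIncl U) g := by
      rw [comp_translate, h1, h2]
    rw [← h]
    exact (isOpenEmb_prod (domIncl_isOpenEmb U) Q P k h1 h2).comp (isOpenEmb_iso (translateIso P g))
  pres := pullω_eq_of_coords_eq_smul _ _ _ g (coords_translate_snd P _ _ g)

theorem DiffFam.ext_of_hom {P : Prd S R11} {A B : DiffFam P} (h : A.Φ.hom = B.Φ.hom) : A = B := by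
  obtain ⟨Φ, _, _⟩ := A
  obtain ⟨Ψ, _, _⟩ := B
  obtain rfl : Φ = Ψ := Iso.ext h
  rfl

theorem EmbFam.ext_of_map {U : Opens ℝ} {Q : Prd S (dom U)} {P : Prd S R11} {A B : EmbFam Q P}
    (h : A.Φ = B.Φ) : A = B := by
  obtain ⟨Φ, _, _, _⟩ := A
  obtain ⟨Ψ, _, _, _⟩ := B
  obtain rfl : Φ = Ψ := h
  rfl

/-- Every family of embeddings of a connected domain that preserves `ω` is given by a unique group
element. -/
theorem embFam_bijective {U : Opens ℝ} (hU : _root_.IsConnected (U : Set ℝ)) (Q : Prd S (dom U))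
    (P : Prd S R11) : Function.Bijective (embFam Q P) := by
  have hr : ∀ t : ℝ, t ∈ U ↔ t ∈ Set.range (Hom.base (domIncl U)) := fun t =>
    ⟨fun h => ⟨⟨t, h⟩, rfl⟩, by rintro ⟨x, rfl⟩; exact x.2⟩
  refine ⟨fun g g' h => ?_, fun A => ?_⟩
  · refine eq_of_smul_coords_eq (domIncl_isOpenEmb U) hU.nonempty hr g g' (Q := Q) ?_
    rw [← coords_translate_snd P, ← coords_translate_snd P]
    exact congrArg (fun A : EmbFam Q P => coords (A.Φ ≫ P.snd)) h
  · obtain ⟨g, hg⟩ := exists_coords_eq_smul (domIncl_isOpenEmb U) hU hr _ A.pres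
    exact ⟨g, EmbFam.ext_of_map (eq_translate P A.fibred hg).symm⟩

/-- The argument of `embFam_bijective` for the whole of `ℝ^{1|1}`. -/
theorem diffFam_bijective (P : Prd S R11) : Function.Bijective (diffFam P) := by
  have hj : IsOpenEmb (𝟙 R11) := isOpenEmb_iso (Iso.refl R11)
  have hr : ∀ t : ℝ, t ∈ (⊤ : Opens ℝ) ↔ t ∈ Set.range (Hom.base (𝟙 R11)) := fun t =>
    ⟨fun _ => ⟨t, rfl⟩, fun _ => trivial⟩
  have hc : _root_.IsConnected ((⊤ : Opens ℝ) : Set ℝ) := isConnected_univ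
  refine ⟨fun g g' h => ?_, fun A => ?_⟩
  · refine eq_of_smul_coords_eq hj hc.nonempty hr g g' (Q := P) ?_
    rw [Category.comp_id, ← coords_translate_snd P, ← coords_translate_snd P]
    exact congrArg (fun A : DiffFam P => coords (A.Φ.hom ≫ P.snd)) h
  · obtain ⟨g, hg⟩ := exists_coords_eq_smul hj hc hr (A.Φ.hom ≫ P.snd) (by
      rw [Category.comp_id, A.pres])
    rw [Category.comp_id] at hg
    exact ⟨g, DiffFam.ext_of_hom (eq_translate P A.fibred hg).symm⟩

end Translate

end SuperMfd

open CategoryTheory SuperMfd in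
theorem mainTheorem10 :
    -- `S`-points of the super Lie group `ℝ^{1|1} ⋊ ℤ/2`
    (∀ S : SuperMfd, Function.Bijective (isomCoords : (S ⟶ IsomR11) → IsomPt S.Fun)) ∧
    ∃ e : ∀ {S : SuperMfd} (P : Prd S R11), (S ⟶ IsomR11) ≃ DiffFam P,
      -- the action is the standard one
      (∀ {S : SuperMfd} (P : Prd S R11) (g : S ⟶ IsomR11),
        coords ((e P g).Φ.hom ≫ P.snd) = baseIsom P.fst g • coords P.snd) ∧
      -- naturality in `S`
      (∀ {S S' : SuperMfd} (f : S' ⟶ S) (P : Prd S R11) (P' : Prd S' R11) (F : P'.tot ⟶ P.tot),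
        F ≫ P.fst = P'.fst ≫ f → F ≫ P.snd = P'.snd →
        ∀ g : S ⟶ IsomR11, (e P' (f ≫ g)).Φ.hom ≫ F = F ≫ (e P g).Φ.hom) ∧
      -- compatibility with the group structures
      (∀ {S : SuperMfd} (P : Prd S R11) (g g' : S ⟶ IsomR11), ∃ g'' : S ⟶ IsomR11,
        isomCoords g'' = isomCoords g' * isomCoords g ∧
        (e P g'').Φ.hom = (e P g).Φ.hom ≫ (e P g').Φ.hom) ∧
      -- the local version, for embeddings of connected domains
      ∀ U : Opens ℝ, _root_.IsConnected (U : Set ℝ) →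
        ∃ ε : ∀ {S : SuperMfd} (Q : Prd S (dom U)) (P : Prd S R11), (S ⟶ IsomR11) ≃ EmbFam Q P,
          (∀ {S : SuperMfd} (Q : Prd S (dom U)) (P : Prd S R11) (g : S ⟶ IsomR11),
            coords ((ε Q P g).Φ ≫ P.snd) = baseIsom Q.fst g • coords (Q.snd ≫ domIncl U)) ∧
          (∀ {S : SuperMfd} (Q : Prd S (dom U)) (P : Prd S R11) (j : Q.tot ⟶ P.tot),
            j ≫ P.fst = Q.fst → j ≫ P.snd = Q.snd ≫ domIncl U →
            ∀ g : S ⟶ IsomR11, (ε Q P g).Φ = j ≫ (e P g).Φ.hom) ∧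
          (∀ {S S' : SuperMfd} (f : S' ⟶ S) (Q : Prd S (dom U)) (P : Prd S R11)
            (Q' : Prd S' (dom U)) (P' : Prd S' R11) (G : Q'.tot ⟶ Q.tot) (F : P'.tot ⟶ P.tot),
            G ≫ Q.fst = Q'.fst ≫ f → G ≫ Q.snd = Q'.snd →
            F ≫ P.fst = P'.fst ≫ f → F ≫ P.snd = P'.snd →
            ∀ g : S ⟶ IsomR11, (ε Q' P' (f ≫ g)).Φ ≫ F = G ≫ (ε Q P g).Φ) := by
  refine ⟨fun S => ⟨isomCoords_injective, isomCoords_surjective⟩,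
    fun P => Equiv.ofBijective (diffFam P) (diffFam_bijective P),
    fun P g => coords_translate_snd P _ _ g, fun f P P' F h1 h2 g => ?_, fun P g g' => ?_,
    fun U hU => ⟨fun Q P => Equiv.ofBijective (embFam Q P) (embFam_bijective hU Q P),
      fun Q P g => coords_translate_snd P _ _ g, fun Q P j h1 h2 g => ?_,
      fun f Q P Q' P' G F h1 h2 h3 h4 g => ?_⟩⟩
  · refine (translate_base_change P P' f F h1 h2 _ _ g).trans ?_
    rw [← h1, ← h2]
    exact (comp_translate P F _ _ g).symm
  · obtain ⟨g'', h⟩ := isomCoords_surjective (isomCoords g' * isomCoords g)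
    exact ⟨g'', h, (translate_translate P _ _ h).symm⟩
  · refine Eq.trans ?_ (comp_translate P j _ _ g).symm
    rw [h1, h2]
    rfl
  · refine (translate_base_change P P' f F h3 h4 _ _ g).trans ?_
    rw [← h1, ← h2, Category.assoc]
    exact (comp_translate P G _ _ g).symm
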